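/- Let $M$ be a closed (compact, without boundary), connected, smooth $n$-dimensional Riemannian manifold with Riemannian volume $\mu$. For $T>0$, a smooth solution on $[0,T)$ of the $\dot H^1$ Euler--Arnold equation is a time-dependent vector field $u$ on $M$, $C^\infty$ on $[0,T)\times M$, such that $\rho=\operatorname{div}u$ satisfies $$\rho_t+u\cdot\nabla\rho+\tfrac12\rho^2=-\frac{\int_M\rho^2\,d\mu}{2\mu(M)}\qquad\text{on }[0,T)\times M .$$ Let $u_0$ be a smooth vector field on $M$ whose divergence does not vanish identically, let $$\kappa>0,\qquad \kappa^2=\frac1{4\mu(M)}\int_M(\operatorname{div}u_0)^2\,d\mu ,\qquad T_{\max}=\frac{\pi}{2\kappa}+\frac1\kappa\arctan\Big(\frac1{2\kappa}\inf_{x\in M}\operatorname{div}u_0(x)\Big).$$ Then $T_{\max}$ is the maximal existence time of smooth solutions of the Cauchy problem with data $\rho(0,x)=\operatorname{div}u_0(x)$, and the $C^1$ norm blows up there. That is: 1. $0<T_{\max}<\infty$. 2. There is a smooth solution $u$ on $[0,T_{\max})$ with $u(0,\cdot)=u_0$. 3. If $T>0$ and $u$ is a smooth solution on $[0,T)$ with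 $\operatorname{div}u(0,\cdot)=\operatorname{div}u_0$, then $T\le T_{\max}$. 4. If $u$ is any smooth solution on $[0,T_{\max})$ with $\operatorname{div}u(0,\cdot)=\operatorname{div}u_0$, then $\lVert u(t)\rVert_{C^1}\to\infty$ as $t\nearrow T_{\max}$, where $\lVert u\rVert_{C^1}=\sup_M|u|+\sup_M|\nabla u|$ with $\nabla$ the Levi-Civita connection. -/

import Mathlib

open scoped Manifold ContDiff Topology ENNReal

noncomputable section

namespace HdotEulerArnold

variable {n : ℕ} {M : Type*} [TopologicalSpace M] [ChartedSpace (EuclideanSpace ℝ (Fin n)) M]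

section Coordinates

/-- The coordinate vector field `∂_i` of the chart centred at `p`, at the point with
coordinates `y`. -/
def coordBasis (p : M) (i : Fin n) (y : EuclideanSpace ℝ (Fin n)) :
    TangentSpace (𝓡 n) ((extChartAt (𝓡 n) p).symm y) :=
  mfderiv 𝓘(ℝ, EuclideanSpace ℝ (Fin n)) (𝓡 n) (extChartAt (𝓡 n) p).symm y
    (EuclideanSpace.single i (1 : ℝ))

/-- The component `u^i` of the vector field `u` in the chart centred at `p`, as a function of the
coordinates `y`. -/
def coordComp (u : (x : M) → TangentSpace (𝓡 n) x) (p : M) (i : Fin n)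
    (y : EuclideanSpace ℝ (Fin n)) : ℝ :=
  (show EuclideanSpace ℝ (Fin n) from
    mfderiv (𝓡 n) 𝓘(ℝ, EuclideanSpace ℝ (Fin n)) (extChartAt (𝓡 n) p)
      ((extChartAt (𝓡 n) p).symm y) (u ((extChartAt (𝓡 n) p).symm y))) i

/-- The partial derivative `∂_i f` at `y` of a function of the coordinates. -/
def partialDeriv (i : Fin n) (f : EuclideanSpace ℝ (Fin n) → ℝ)
    (y : EuclideanSpace ℝ (Fin n)) : ℝ :=
  fderiv ℝ f y (EuclideanSpace.single i (1 : ℝ))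

/-- The derivative `⟨v, ∇f⟩ = df(v)` of a function `f` at `x` in the direction `v`. -/
def dirDeriv (f : M → ℝ) (x : M) (v : TangentSpace (𝓡 n) x) : ℝ :=
  mfderiv (𝓡 n) 𝓘(ℝ, ℝ) f x v

end Coordinates

variable [IsManifold (𝓡 n) ∞ M]

/-- A smooth Riemannian metric on `M`. -/
abbrev SmoothMetric (n : ℕ) (M : Type*) [TopologicalSpace M]
    [ChartedSpace (EuclideanSpace ℝ (Fin n)) M] [IsManifold (𝓡 n) ∞ M] :=
  Bundle.ContMDiffRiemannianMetric (𝓡 n) ∞ (EuclideanSpace ℝ (Fin n))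
    (fun x : M => TangentSpace (𝓡 n) x)

/-- A smooth vector field on `M`. -/
def IsSmoothField (u : (x : M) → TangentSpace (𝓡 n) x) : Prop :=
  ContMDiff (𝓡 n) (𝓡 n).tangent ∞ (fun x => (⟨x, u x⟩ : TangentBundle (𝓡 n) M))

/-- The matrix `g_ij = g(∂_i, ∂_j)` of the metric in the chart centred at `p`. -/
def metricMatrix (g : SmoothMetric n M) (p : M) (y : EuclideanSpace ℝ (Fin n)) :
    Matrix (Fin n) (Fin n) ℝ :=
  Matrix.of fun i j => g.inner ((extChartAt (𝓡 n) p).symm y) (coordBasis p i y) (coordBasis p j y)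

/-- The Riemannian volume density `√(det g_ij)` in the chart centred at `p`. -/
def volDensity (g : SmoothMetric n M) (p : M) (y : EuclideanSpace ℝ (Fin n)) : ℝ :=
  Real.sqrt (metricMatrix g p y).det

/-- The divergence `(1/√det g) ∑ᵢ ∂_i (√det g uⁱ)` of `u` at `x`. -/
def divergence (g : SmoothMetric n M) (u : (x : M) → TangentSpace (𝓡 n) x) (x : M) : ℝ :=
  (volDensity g x (extChartAt (𝓡 n) x x))⁻¹ *
    ∑ i, partialDeriv i (fun y => volDensity g x y * coordComp u x i y) (extChartAt (𝓡 n) x x)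

/-- The Christoffel symbol `Γ^k_ij` of the Levi-Civita connection in the chart centred at `p`. -/
def christoffel (g : SmoothMetric n M) (p : M) (k i j : Fin n)
    (y : EuclideanSpace ℝ (Fin n)) : ℝ :=
  (1 / 2) * ∑ l, (metricMatrix g p y)⁻¹ k l *
    (partialDeriv i (fun z => metricMatrix g p z j l) y
      + partialDeriv j (fun z => metricMatrix g p z i l) y
      - partialDeriv l (fun z => metricMatrix g p z i j) y)

/-- The component `(∇_{∂_i} u)^k = ∂_i u^k + ∑ⱼ Γ^k_ij u^j` of the covariant derivative of `u`
for the Levi-Civita connection, in the chart centred at `p`. -/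
def covComp (g : SmoothMetric n M) (u : (x : M) → TangentSpace (𝓡 n) x) (p : M) (i k : Fin n)
    (y : EuclideanSpace ℝ (Fin n)) : ℝ :=
  partialDeriv i (coordComp u p k) y + ∑ j, christoffel g p k i j y * coordComp u p j y

/-- The pointwise norm `|u|` at `x`. -/
def fieldNorm (g : SmoothMetric n M) (u : (x : M) → TangentSpace (𝓡 n) x) (x : M) : ℝ :=
  Real.sqrt (g.inner x (u x) (u x))

/-- The pointwise tensor norm `|∇u|` at `x`, i.e. the square root of
`∑ g^{ij} g_{kl} (∇_i u)^k (∇_j u)^l`. -/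
def covNorm (g : SmoothMetric n M) (u : (x : M) → TangentSpace (𝓡 n) x) (x : M) : ℝ :=
  let y := extChartAt (𝓡 n) x x
  Real.sqrt (∑ i, ∑ j, ∑ k, ∑ l,
    (metricMatrix g x y)⁻¹ i j * metricMatrix g x y k l * covComp g u x i k y * covComp g u x j l y)

/-- The `C¹` norm `sup |u| + sup |∇u|`, with values in `[0, ∞]` (it is finite for a smooth
field on a compact manifold). -/
def normC1 (g : SmoothMetric n M) (u : (x : M) → TangentSpace (𝓡 n) x) : ℝ≥0∞ :=
  (⨆ x, ENNReal.ofReal (fieldNorm g u x)) + ⨆ x, ENNReal.ofReal (covNorm g u x)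

variable [MeasurableSpace M]

/-- The Riemannian volume of the domain of the chart centred at `p`: the image on `M` of the
measure `√(det g_ij) dy` on the range of that chart. -/
def chartVolume (g : SmoothMetric n M) (p : M) : MeasureTheory.Measure M :=
  (((MeasureTheory.volume : MeasureTheory.Measure (EuclideanSpace ℝ (Fin n))).restrict
    (extChartAt (𝓡 n) p).target).withDensity
      (fun y => ENNReal.ofReal (volDensity g p y))).map (extChartAt (𝓡 n) p).symm

/-- The Riemannian volume measure `μ`. The measures `chartVolume g p` are the restrictions of one
measure, `μ`, to chart domains covering `M`, so `μ` is their least upper bound. -/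
def riemVolume (g : SmoothMetric n M) : MeasureTheory.Measure M :=
  ⨆ p : M, chartVolume g p

/-- `u` is a smooth solution on `[0, T) × M` of
`ρ_t + u · ∇ρ + ρ²/2 = - (∫ ρ² dμ) / (2 μ(M))`, where `ρ = div u`. The term `u · ∇ρ` is
the derivative of `ρ` in the direction `u`. -/
structure IsSolution (g : SmoothMetric n M) (T : ℝ)
    (u : ℝ → (x : M) → TangentSpace (𝓡 n) x) : Prop where
  smooth : ContMDiffOn (𝓘(ℝ, ℝ).prod (𝓡 n)) (𝓡 n).tangent ∞
    (fun q : ℝ × M => (⟨q.2, u q.1 q.2⟩ : TangentBundle (𝓡 n) M)) (Set.Ico 0 T ×ˢ Set.univ)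
  equation : ∀ t ∈ Set.Ico 0 T, ∀ x : M,
    derivWithin (fun s => divergence g (u s) x) (Set.Ico 0 T) t
        + dirDeriv (divergence g (u t)) x (u t x)
        + (1 / 2) * divergence g (u t) x ^ 2
      = - (∫ z, divergence g (u t) z ^ 2 ∂(riemVolume g))
          / (2 * (riemVolume g).real Set.univ)

/-- `κ ≥ 0` with `κ² = (1 / (4 μ(M))) ∫ (div u₀)² dμ`. -/
def kappa (g : SmoothMetric n M) (u₀ : (x : M) → TangentSpace (𝓡 n) x) : ℝ :=
  Real.sqrt (1 / (4 * (riemVolume g).real Set.univ)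
    * ∫ z, divergence g u₀ z ^ 2 ∂(riemVolume g))

/-- `T_max = π / (2κ) + (1/κ) arctan ((1/(2κ)) inf div u₀)`. -/
def maxTime (g : SmoothMetric n M) (u₀ : (x : M) → TangentSpace (𝓡 n) x) : ℝ :=
  Real.pi / (2 * kappa g u₀)
    + 1 / kappa g u₀ * Real.arctan (1 / (2 * kappa g u₀) * ⨅ x : M, divergence g u₀ x)

end HdotEulerArnold

end

/-! Write ρ₀ = div u₀ and let ρ = div u for a solution u.

Upper bound and blow-up. The right-hand side of the equation is constant in space, say c(t), so
(ρ²)_t = 2cρ - div(ρ²u). By the divergence theorem ∫ρ² is conserved (`integral_sq_divergence_eq`),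
and the non-local term is the constant -2κ². At a spatial minimum of ρ the transport term vanishes,
and what remains is the Riccati equation ρ_t = -2κ² - ρ²/2, for which arctan(ρ/2κ) + κt is
stationary. A Dini-derivative argument then shows that the minimum of this quantity over M does not
increase (`exists_arctan_divergence_le`). So at each time t some point satisfies arctan(ρ/2κ) ≤
κ(T_max - t) - π/2. At t = T_max this is impossible, and as t tends to T_max it forces inf ρ → -∞.
Since the divergence is the trace of ∇u, |ρ| ≤ √n |∇u| (`abs_divergence_le`), and the C¹ norm blows
up.

Existence. Along particle paths the equation says that the square root f of the Jacobian solves f''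
= -κ²f, so f = cos κt + (ρ₀/2κ) sin κt, which stays positive exactly up to T_max. It remains to find
a flow with Jacobian f² and initial velocity u₀. This is Moser's method, run on the inverse flow. By
the choice of κ the function ρ₀²/(4κ) - κ has mean zero, hence is div v for a smooth field v
(`isDivergence_of_integral_eq_zero`). The momentum m = -cos(2κt) u₀ - sin(2κt) v has div m =
-∂_t(f²), so w = m/f² and J = f² satisfy the continuity equation ∂_t J + div(Jw) = 0
(`isDensity_jacobianRoot_sq`). Let η be the flow of w. Liouville's theorem gives η_t^*(Jμ) = μ up to
sign (`weightedJacobian_sq`), so dη_t is invertible and dη_t(u_t) = -w_t∘η_t defines a smooth field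
u, the velocity of the inverse flow; only pointwise invertibility of dη_t is needed. Coordinate
invariance of the divergence (`densityDiv_comp`) yields div u = R(t, η) with R = ∂_t J / J = 2f'/f.
As R solves the Riccati equation and functions of the form R(t, η) are transported by u, u is a
solution; and u(0) = -w(0) = u₀.

Two tools need separate work. Smooth dependence of flows on initial values comes from the implicit
function theorem, applied to the Picard operator on C([0,1], E). Surjectivity of the divergence onto
mean-zero functions comes from an explicit primitive in a cube, globalized by connectedness. -/

noncomputable section

namespace HdotEulerArnold

/-! ### Smoothness of superposition operators on spaces of continuous functions. -/

section Nemytskii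

universe u w
variable {K : Type w} [TopologicalSpace K] [CompactSpace K]
  {E F : Type u} [NormedAddCommGroup E] [NormedSpace ℝ E] [NormedAddCommGroup F] [NormedSpace ℝ F]

/-- Pointwise application of a continuous family of operators to a continuous family of vectors. -/
def pointwiseApply (K : Type w) [TopologicalSpace K] [CompactSpace K] (E F : Type u)
    [NormedAddCommGroup E] [NormedSpace ℝ E] [NormedAddCommGroup F] [NormedSpace ℝ F] :
    C(K, E →L[ℝ] F) →L[ℝ] C(K, E) →L[ℝ] C(K, F) :=
  LinearMap.mkContinuous₂
    (LinearMap.mk₂ ℝ (fun (a : C(K, E →L[ℝ] F)) (b : C(K, E)) =>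
      (⟨fun t => a t (b t), by fun_prop⟩ : C(K, F)))
      (by intros; ext; simp) (by intros; ext; simp) (by intros; ext; simp) (by intros; ext; simp))
    1 (by
      intro a b
      rw [ContinuousMap.norm_le _ (by positivity)]
      intro t
      calc ‖a t (b t)‖ ≤ ‖a t‖ * ‖b t‖ := (a t).le_opNorm _
        _ ≤ ‖a‖ * ‖b‖ := by
          gcongr
          · exact a.norm_coe_le_norm t
          · exact b.norm_coe_le_norm t
        _ = 1 * ‖a‖ * ‖b‖ := by ring)

/-- Superposition operator `α ↦ v ∘ α` on continuous functions. -/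
def superposition (K : Type w) [TopologicalSpace K] (v : C(E, F)) (α : C(K, E)) : C(K, F) := v.comp α

/-- The range of α is compact, so `fderiv ℝ v` varies by at most c on δ-balls about its points, with
one δ for the whole range. The mean value inequality in the ball around α(t) then bounds the
remainder by c‖β‖ uniformly in t. -/
lemma hasFDerivAt_superposition (v : C(E, F)) (hv : ContDiff ℝ 1 v) (α : C(K, E)) :
    HasFDerivAt (superposition K v)
      (pointwiseApply K E F
        (superposition K ⟨fderiv ℝ v, hv.continuous_fderiv (by norm_num)⟩ α)) α := by
  rw [hasFDerivAt_iff_isLittleO_nhds_zero, Asymptotics.isLittleO_iff]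
  intro c hc
  have hS : IsCompact (Set.range α) := isCompact_range α.continuous
  have hU := hS.uniformContinuousAt_of_continuousAt (fderiv ℝ v)
    (fun a _ => (hv.continuous_fderiv (by norm_num)).continuousAt) (Metric.dist_mem_uniformity hc)
  obtain ⟨δ, hδ, hδU⟩ := Metric.mem_uniformity_dist.1 hU
  filter_upwards [Metric.ball_mem_nhds (0 : C(K, E)) hδ] with β hβ
  rw [mem_ball_zero_iff] at hβ
  rw [ContinuousMap.norm_le _ (by positivity)]
  intro t
  have key : ‖v (α t + β t) - v (α t) - fderiv ℝ v (α t) ((α t + β t) - α t)‖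
      ≤ c * ‖(α t + β t) - α t‖ := by
    apply (convex_ball (α t) δ).norm_image_sub_le_of_norm_hasFDerivWithin_le'
      (f' := fun y => fderiv ℝ v y)
    · intro y _
      exact ((hv.differentiable (by norm_num)) y).hasFDerivAt.hasFDerivWithinAt
    · intro y hy
      have := @hδU (α t) y (by rw [dist_comm]; exact hy) ⟨t, rfl⟩
      rw [← dist_eq_norm, dist_comm]
      exact this.le
    · exact Metric.mem_ball_self hδ
    · rw [mem_ball_iff_norm, add_sub_cancel_left]
      exact (β.norm_coe_le_norm t).trans_lt hβ
  rw [add_sub_cancel_left] at key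
  exact key.trans (by gcongr; exact β.norm_coe_le_norm t)

/-- The derivative of superposition by v is superposition by `fderiv ℝ v` followed by a continuous
linear map, so the order goes up by induction. The target F is generalized because it becomes `E
→L[ℝ] F` in the step; E and F share a universe so that this is again an admissible target. -/
lemma contDiff_superposition_nat (n : ℕ) : ∀ {F : Type u} [NormedAddCommGroup F] [NormedSpace ℝ F]
    (v : C(E, F)), ContDiff ℝ ∞ v → ContDiff ℝ n (superposition K v) := by
  induction n with
  | zero =>
    intro F _ _ v hv
    rw [Nat.cast_zero, contDiff_zero]
    exact continuous_iff_continuousAt.2 fun α =>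
      (hasFDerivAt_superposition v (hv.of_le (by norm_cast)) α).continuousAt
  | succ n ih =>
    intro F _ _ v hv
    have h1 : ContDiff ℝ 1 v := hv.of_le (by norm_cast)
    rw [Nat.cast_succ, contDiff_succ_iff_hasFDerivAt]
    refine ⟨_, ?_, hasFDerivAt_superposition v h1⟩
    refine (pointwiseApply K E F).contDiff.comp (ih _ ?_)
    exact hv.fderiv_right (by simp)

lemma contDiff_superposition (v : C(E, F)) (hv : ContDiff ℝ ∞ v) :
    ContDiff ℝ ∞ (superposition K v) :=
  contDiff_infty.2 fun n => contDiff_superposition_nat n v hv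

end Nemytskii

/-! ### The integration operator on C([0,1], E). -/

section Volterra

variable {E : Type*} [NormedAddCommGroup E]

/-- The extension of a continuous function on `[0, 1]` to the line, constant outside. -/
def extendUnit (β : C(Set.Icc (0 : ℝ) 1, E)) : C(ℝ, E) :=
  ⟨Set.IccExtend zero_le_one β, β.continuous.Icc_extend'⟩

lemma extendUnit_apply (β : C(Set.Icc (0 : ℝ) 1, E)) {t : ℝ} (ht : t ∈ Set.Icc (0 : ℝ) 1) :
    extendUnit β t = β ⟨t, ht⟩ := Set.IccExtend_of_mem _ _ ht

variable [NormedSpace ℝ E] [CompleteSpace E]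

/-- The primitive vanishing at `0`, as an operator on continuous functions on `[0, 1]`. -/
def volterra (E : Type*) [NormedAddCommGroup E] [NormedSpace ℝ E] [CompleteSpace E] :
    C(Set.Icc (0 : ℝ) 1, E) →L[ℝ] C(Set.Icc (0 : ℝ) 1, E) :=
  LinearMap.mkContinuous
    { toFun := fun β => ⟨fun t => ∫ s in (0 : ℝ)..t, extendUnit β s,
        (intervalIntegral.continuous_primitive
          (fun a b => (extendUnit β).continuous.intervalIntegrable a b) 0).comp
          continuous_subtype_val⟩
      map_add' := by
        intro β γ
        ext t
        simp only [ContinuousMap.coe_mk, ContinuousMap.add_apply]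
        rw [← intervalIntegral.integral_add
          ((extendUnit β).continuous.intervalIntegrable _ _)
          ((extendUnit γ).continuous.intervalIntegrable _ _)]
        rfl
      map_smul' := by
        intro c β
        ext t
        simp only [ContinuousMap.coe_mk, ContinuousMap.smul_apply, RingHom.id_apply]
        rw [← intervalIntegral.integral_smul]
        rfl }
    1 (by
      intro β
      rw [ContinuousMap.norm_le _ (by positivity)]
      rintro ⟨t, ht⟩
      have := intervalIntegral.norm_integral_le_of_norm_le_const (a := (0 : ℝ)) (b := t)
        (f := extendUnit β) (C := ‖β‖) (fun s _ => by
          exact β.norm_coe_le_norm _)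
      refine this.trans ?_
      rw [sub_zero, abs_of_nonneg ht.1, mul_comm]
      gcongr
      exact ht.2)

end Volterra

/-! ### Smooth short-time flows of Lipschitz fields on a Banach space. -/

section LocalFlow

variable {E : Type*} [NormedAddCommGroup E] [NormedSpace ℝ E] [CompleteSpace E]

/-- The Picard operator `α ↦ x + ε ∫ v ∘ α` for integral curves rescaled to `[0, 1]`. -/
def rescaledPicard (v : C(E, E)) (ε : ℝ) (x : E) (α : C(Set.Icc (0 : ℝ) 1, E)) :
    C(Set.Icc (0 : ℝ) 1, E) :=
  ContinuousLinearMap.const ℝ (Set.Icc (0 : ℝ) 1) x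
    + ε • volterra E (superposition (Set.Icc (0 : ℝ) 1) v α)

lemma norm_volterra_le (β : C(Set.Icc (0 : ℝ) 1, E)) : ‖volterra E β‖ ≤ ‖β‖ := by
  simpa using (volterra E).le_of_opNorm_le (LinearMap.mkContinuous_norm_le _ zero_le_one _) β

variable {v : C(E, E)} {L : NNReal}

lemma contractingWith_rescaledPicard (hL : LipschitzWith L v) {ε : ℝ} (hε : |ε| * L < 1) (x : E) :
    ContractingWith (‖ε‖₊ * L) (rescaledPicard v ε x) := by
  refine ⟨by rw [← NNReal.coe_lt_coe]; simpa using hε, LipschitzWith.of_dist_le_mul ?_⟩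
  intro α β
  rw [dist_eq_norm, rescaledPicard, rescaledPicard, add_sub_add_left_eq_sub, ← smul_sub, ← map_sub,
    norm_smul]
  push_cast
  rw [mul_assoc]
  gcongr
  refine (norm_volterra_le _).trans ?_
  rw [ContinuousMap.norm_le _ (by positivity)]
  intro t
  have := hL.dist_le_mul (α t) (β t)
  rw [dist_eq_norm] at this
  exact this.trans (by gcongr; exact ContinuousMap.dist_apply_le_dist t)

lemma contDiff_rescaledPicard (hv : ContDiff ℝ ∞ v) :
    ContDiff ℝ ∞ (fun z : (ℝ × E) × C(Set.Icc (0 : ℝ) 1, E) => rescaledPicard v z.1.1 z.1.2 z.2) := by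
  unfold rescaledPicard
  refine ((ContinuousLinearMap.contDiff _).comp (contDiff_snd.comp contDiff_fst)).add ?_
  refine ContDiff.smul (contDiff_fst.comp contDiff_fst) ?_
  exact (volterra E).contDiff.comp ((contDiff_superposition v hv).comp contDiff_snd)

lemma hasFDerivAt_rescaledPicard (hv : ContDiff ℝ ∞ v) (ε : ℝ) (x : E)
    (α : C(Set.Icc (0 : ℝ) 1, E)) :
    HasFDerivAt (rescaledPicard v ε x) (ε • (volterra E ∘L (pointwiseApply _ E E
        (superposition _ ⟨fderiv ℝ v, (hv.of_le (by norm_cast) : ContDiff ℝ 1 v).continuous_fderiv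
          (by norm_num)⟩ α)))) α := by
  have h := hasFDerivAt_superposition (K := Set.Icc (0 : ℝ) 1) v (hv.of_le (by norm_cast)) α
  exact (((volterra E).hasFDerivAt.comp α h).const_smul ε).const_add _

/-- For a smooth Lipschitz vector field, short rescaled integral curves depend smoothly on the
time scale and on the initial value. -/
lemma exists_rescaled_curves (hv : ContDiff ℝ ∞ v) (hL : LipschitzWith L v) :
    ∃ A : ℝ × E → C(Set.Icc (0 : ℝ) 1, E),
      (∀ (ε : ℝ) (x : E), |ε| * L < 1 → ∀ α, rescaledPicard v ε x α = α ↔ α = A (ε, x)) ∧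
      ContDiffOn ℝ ∞ A {z | |z.1| * L < 1} := by
  classical
  let A : ℝ × E → C(Set.Icc (0 : ℝ) 1, E) := fun z =>
    if h : |z.1| * L < 1 then ContractingWith.fixedPoint _ (contractingWith_rescaledPicard hL h z.2)
    else 0
  have hA : ∀ (ε : ℝ) (x : E), |ε| * L < 1 → ∀ α, rescaledPicard v ε x α = α ↔ α = A (ε, x) := by
    intro ε x h α
    have hc := contractingWith_rescaledPicard hL h x
    simp only [A, h, dite_true]
    constructor
    · intro hα
      exact hc.fixedPoint_unique hα
    · rintro rfl
      exact hc.fixedPoint_isFixedPt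
  refine ⟨A, hA, ?_⟩
  rintro ⟨ε, x⟩ hz
  apply ContDiffAt.contDiffWithinAt
  have hz : |ε| * L < 1 := hz
  set u : (ℝ × E) × C(Set.Icc (0 : ℝ) 1, E) := ((ε, x), A (ε, x))
  -- The fixed points are the zeros of f. Its partial derivative in the curve is 1 - D with ‖D‖ ≤
  -- |ε|L < 1, invertible by a Neumann series, so the implicit function theorem applies.
  let f : (ℝ × E) × C(Set.Icc (0 : ℝ) 1, E) → C(Set.Icc (0 : ℝ) 1, E) := fun z =>
    z.2 - rescaledPicard v z.1.1 z.1.2 z.2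
  have hf : ContDiff ℝ ∞ f := contDiff_snd.sub (contDiff_rescaledPicard hv)
  have hfu : ContDiffAt ℝ ∞ f u := hf.contDiffAt
  set D := ε • (volterra E ∘L (pointwiseApply _ E E
        (superposition _ ⟨fderiv ℝ v, (hv.of_le (by norm_cast) : ContDiff ℝ 1 v).continuous_fderiv
          (by norm_num)⟩ (A (ε, x)))))
  have hD : fderiv ℝ f u ∘L .inr ℝ (ℝ × E) C(Set.Icc (0 : ℝ) 1, E) = 1 - D := by
    have h1 : HasFDerivAt (fun α => f ((ε, x), α)) (1 - D) (A (ε, x)) :=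
      (hasFDerivAt_id _).sub (hasFDerivAt_rescaledPicard hv ε x _)
    have h2 : HasFDerivAt (fun α => f ((ε, x), α))
        (fderiv ℝ f u ∘L .inr ℝ (ℝ × E) C(Set.Icc (0 : ℝ) 1, E)) (A (ε, x)) :=
      ((hf.differentiable (by norm_num)) u).hasFDerivAt.comp (A (ε, x)) (hasFDerivAt_prodMk_right _ _)
    exact h2.unique h1
  have hDnorm : ‖D‖ < 1 := by
    refine lt_of_le_of_lt ?_ hz
    refine ContinuousLinearMap.opNorm_le_bound _ (by positivity) fun β => ?_
    simp only [D, smul_apply, norm_smul, ContinuousLinearMap.comp_apply]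
    rw [mul_assoc]
    gcongr
    · exact le_of_eq (Real.norm_eq_abs _)
    refine (norm_volterra_le _).trans ?_
    rw [ContinuousMap.norm_le _ (by positivity)]
    intro t
    refine (ContinuousLinearMap.le_opNorm _ _).trans ?_
    gcongr
    · exact norm_fderiv_le_of_lipschitz ℝ hL
    · exact β.norm_coe_le_norm t
  have hinv : (fderiv ℝ f u ∘L .inr ℝ (ℝ × E) C(Set.Icc (0 : ℝ) 1, E)).IsInvertible := by
    rw [hD]
    have h1 := (Units.oneSub D hDnorm).mul_inv
    have h2 := (Units.oneSub D hDnorm).inv_mul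
    rw [Units.val_oneSub] at h1 h2
    exact ContinuousLinearMap.IsInvertible.of_inverse h1 h2
  have hsm := hfu.contDiffAt_implicitFunction (by norm_num) hinv
  refine hsm.congr_of_eventuallyEq ?_
  -- Uniqueness of the fixed point identifies the implicit function with A near (ε, x), without any
  -- prior continuity of A.
  have hev := hfu.eventually_apply_implicitFunction (by norm_num) hinv
  have hfu0 : f u = 0 := sub_eq_zero.2 ((hA ε x hz _).2 rfl).symm
  have hopen : IsOpen {z : ℝ × E | |z.1| * L < 1} :=
    isOpen_lt (by fun_prop) continuous_const
  filter_upwards [hev, hopen.mem_nhds hz] with z hz1 hz2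
  rw [hfu0] at hz1
  exact ((hA z.1 z.2 hz2 _).1 (sub_eq_zero.1 hz1).symm).symm

/-- Short-time flow of a smooth Lipschitz vector field. -/
theorem exists_flow_of_lipschitz (hv : ContDiff ℝ ∞ v) (hL : LipschitzWith L v) :
    ∃ φ : ℝ × E → E, ∃ ε > 0, ContDiffOn ℝ ∞ φ (Set.Ioo (-ε) ε ×ˢ Set.univ) ∧
      ∀ x, φ (0, x) = x ∧ ∀ t ∈ Set.Ioo (-ε) ε, HasDerivAt (fun s => φ (s, x)) (v (φ (t, x))) t := by
  obtain ⟨A, hA, hAs⟩ := exists_rescaled_curves hv hL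
  set ε : ℝ := 1 / (L + 1)
  have hε : 0 < ε := by positivity
  have hlt : ∀ t ∈ Set.Ioo (-ε) ε, |t| * L < 1 := by
    intro t ht
    have h1 : |t| < ε := abs_lt.2 ht
    calc |t| * L ≤ ε * L := by gcongr
      _ < 1 := by
        simp only [ε]
        rw [div_mul_eq_mul_div, one_mul, div_lt_one (by positivity)]
        linarith
  let e1 : Set.Icc (0 : ℝ) 1 := ⟨1, by simp⟩
  have hfix : ∀ t ∈ Set.Ioo (-ε) ε, ∀ x, ∀ s : Set.Icc (0 : ℝ) 1,
      A (t, x) s = x + t • ∫ r in (0 : ℝ)..s, v (extendUnit (A (t, x)) r) := by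
    intro t ht x s
    conv_lhs => rw [← (hA t x (hlt t ht) _).2 rfl]
    rfl
  -- The curve r ↦ A(t, x)(s r) is a fixed point of the Picard operator with time scale t s, hence
  -- equals A(t s, x). So the time-1 values t ↦ A(t, x)(1) trace out a single integral curve.
  have hscale : ∀ t ∈ Set.Ioo (-ε) ε, ∀ x, ∀ s : Set.Icc (0 : ℝ) 1,
      A (t, x) s = A (t * s, x) e1 := by
    intro t ht x s
    have hts : t * s ∈ Set.Ioo (-ε) ε := by
      rw [Set.mem_Ioo, ← abs_lt, abs_mul, abs_of_nonneg s.2.1]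
      exact (mul_le_of_le_one_right (abs_nonneg _) s.2.2).trans_lt (abs_lt.2 ht)
    let β : C(Set.Icc (0 : ℝ) 1, E) := ⟨fun r => A (t, x) ⟨s * r, unitInterval.mul_mem s.2 r.2⟩,
      by fun_prop⟩
    have hβ : rescaledPicard v (t * s) x β = β := by
      ext r
      have h1 : β r = x + t • ∫ q in (0 : ℝ)..(s * r), v (extendUnit (A (t, x)) q) :=
        hfix t ht x ⟨s * r, unitInterval.mul_mem s.2 r.2⟩
      rw [h1]
      have h2 : rescaledPicard v (t * s) x β r
          = x + (t * s : ℝ) • ∫ q in (0 : ℝ)..r, v (extendUnit β q) := rfl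
      rw [h2, mul_smul]
      congr 2
      have h3 := intervalIntegral.smul_integral_comp_mul_left (a := 0) (b := (r : ℝ))
        (fun q => v (extendUnit (A (t, x)) q)) (s : ℝ)
      rw [mul_zero] at h3
      rw [← h3]
      congr 1
      apply intervalIntegral.integral_congr
      intro q hq
      rw [Set.uIcc_of_le r.2.1] at hq
      have hq1 : q ∈ Set.Icc (0 : ℝ) 1 := ⟨hq.1, hq.2.trans r.2.2⟩
      simp only
      rw [extendUnit_apply _ hq1, extendUnit_apply _ (unitInterval.mul_mem s.2 hq1)]
      rfl
    have := (hA (t * s) x (hlt _ hts) β).1 hβ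
    rw [← this]
    simp [β, e1]
  refine ⟨fun z => A z e1, ε, hε, ?_, fun x => ⟨?_, ?_⟩⟩
  · have hev : ContDiff ℝ ∞ (fun α : C(Set.Icc (0 : ℝ) 1, E) => α e1) :=
      (ContinuousMap.evalCLM ℝ e1 : C(Set.Icc (0 : ℝ) 1, E) →L[ℝ] E).contDiff
    exact hev.comp_contDiffOn (hAs.mono fun z hz => hlt z.1 hz.1)
  · have := hfix 0 ⟨by linarith, hε⟩ x e1
    simpa using this
  have hcont : ContinuousOn (fun s => A (s, x) e1) (Set.Ioo (-ε) ε) := by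
    have h1 := hAs.continuousOn.comp (f := fun s : ℝ => (s, x)) (s := Set.Ioo (-ε) ε)
      (by fun_prop) (fun s hs => hlt s hs)
    exact (continuous_eval_const e1).comp_continuousOn h1
  have hint : ∀ t ∈ Set.Ioo (-ε) ε, A (t, x) e1 = x + ∫ r in (0 : ℝ)..t, v (A (r, x) e1) := by
    intro t ht
    rw [hfix t ht x e1]
    have h3 := intervalIntegral.smul_integral_comp_mul_left (a := 0) (b := (1 : ℝ))
        (fun q => v (A (q, x) e1)) t
    rw [mul_zero, mul_one] at h3
    rw [← h3]
    congr 2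
    apply intervalIntegral.integral_congr
    intro q hq
    rw [Set.uIcc_of_le zero_le_one] at hq
    simp only
    rw [extendUnit_apply _ hq, hscale t ht x ⟨q, hq⟩]
  intro t ht
  have hcv : ContinuousOn (fun r => v (A (r, x) e1)) (Set.Ioo (-ε) ε) :=
    v.continuous.comp_continuousOn hcont
  have hsub : Set.uIcc 0 t ⊆ Set.Ioo (-ε) ε :=
    (Set.ordConnected_Ioo).uIcc_subset ⟨by linarith, hε⟩ ht
  have hd : HasDerivAt (fun u => ∫ r in (0 : ℝ)..u, v (A (r, x) e1)) (v (A (t, x) e1)) t := by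
    apply intervalIntegral.integral_hasDerivAt_right
    · exact (hcv.mono hsub).intervalIntegrable
    · exact hcv.stronglyMeasurableAtFilter isOpen_Ioo t ht
    · exact hcv.continuousAt (isOpen_Ioo.mem_nhds ht)
  refine (hd.const_add x).congr_of_eventuallyEq ?_
  filter_upwards [isOpen_Ioo.mem_nhds ht] with s hs
  exact hint s hs

end LocalFlow

/-! ### Coordinates of tangent vectors in a chart. -/

section ChartRep

variable {E : Type*} [NormedAddCommGroup E] [NormedSpace ℝ E]
  {H : Type*} [TopologicalSpace H] {I : ModelWithCorners ℝ E H}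
  {N : Type*} [TopologicalSpace N] [ChartedSpace H N]
  {E' : Type*} [NormedAddCommGroup E'] [NormedSpace ℝ E']
  {H' : Type*} [TopologicalSpace H'] {I' : ModelWithCorners ℝ E' H'}
  {X : Type*} [TopologicalSpace X] [ChartedSpace H' X]

/-- The coordinates of the tangent vector `v` at `x` in the chart centred at `p`. -/
def chartRep (I : ModelWithCorners ℝ E H) (p x : N) (v : TangentSpace I x) : E :=
  mfderiv I 𝓘(ℝ, E) (extChartAt I p) x v

lemma chartRep_add (p x : N) (v w : TangentSpace I x) :
    chartRep I p x (v + w) = chartRep I p x v + chartRep I p x w :=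
  map_add (mfderiv I 𝓘(ℝ, E) (extChartAt I p) x) v w

lemma chartRep_smul (p x : N) (c : ℝ) (v : TangentSpace I x) :
    chartRep I p x (c • v) = c • chartRep I p x v :=
  map_smul (mfderiv I 𝓘(ℝ, E) (extChartAt I p) x) c v

lemma chartRep_zero (p x : N) : chartRep I p x 0 = 0 :=
  map_zero (mfderiv I 𝓘(ℝ, E) (extChartAt I p) x)

lemma isManifold_one_of_infty [IsManifold I ∞ N] : IsManifold I 1 N :=
  .of_le (n := ∞) (by norm_cast)

variable [IsManifold I ∞ N]

/-- The fibre coordinate of the trivialization at p is the derivative of `extChartAt I p`. Any p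
whose chart contains the base point is allowed, which reduces smoothness of fields to smoothness of
vector-valued functions in a fixed chart. -/
lemma contMDiffWithinAt_tangentBundle_iff {n : ℕ∞} {b : X → N} {u : ∀ q, TangentSpace I (b q)}
    {s : Set X} {q₀ : X} {p : N} (hp : b q₀ ∈ (extChartAt I p).source) :
    ContMDiffWithinAt I' I.tangent n (fun q => (⟨b q, u q⟩ : TangentBundle I N)) s q₀ ↔
      ContMDiffWithinAt I' I n b s q₀ ∧
        ContMDiffWithinAt I' 𝓘(ℝ, E) n (fun q => chartRep I p (b q) (u q)) s q₀ := by
  have h1 : IsManifold I 1 N := isManifold_one_of_infty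
  have h2 : ContMDiffVectorBundle n E (TangentSpace I : N → Type _) I := by
    have : IsManifold I (n + 1) N := .of_le (n := ∞) (by norm_cast; exact le_top)
    exact TangentBundle.contMDiffVectorBundle
  rw [extChartAt_source] at hp
  rw [(trivializationAt E (TangentSpace I) p).contMDiffWithinAt_iff (IB := I)
    (by rw [Bundle.Trivialization.mem_source]; exact hp)]
  refine and_congr_right fun hb => ?_
  have key : ∀ q, b q ∈ (chartAt H p).source →
      ((trivializationAt E (TangentSpace I) p) (⟨b q, u q⟩ : TangentBundle I N)).2
        = chartRep I p (b q) (u q) := by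
    intro q hq
    rw [← (trivializationAt E (TangentSpace I) p).continuousLinearMapAt_apply_of_mem (R := ℝ)
      (by exact hq), TangentBundle.continuousLinearMapAt_trivializationAt hq]
    rfl
  refine Filter.EventuallyEq.contMDiffWithinAt_iff ?_ (key q₀ hp)
  filter_upwards [hb.continuousWithinAt ((chartAt H p).open_source.mem_nhds hp)] with q hq
  exact key q hq

lemma contDiffOn_chartRep {V : ∀ x : N, TangentSpace I x}
    (hV : ContMDiff I I.tangent ∞ (fun x => (⟨x, V x⟩ : TangentBundle I N))) (p : N) :
    ContDiffOn ℝ ∞ (fun y => chartRep I p ((extChartAt I p).symm y) (V ((extChartAt I p).symm y)))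
      (extChartAt I p).target := by
  rw [← contMDiffOn_iff_contDiffOn]
  intro y hy
  have h := (hV ((extChartAt I p).symm y)).comp_contMDiffWithinAt y
    (contMDiffOn_extChartAt_symm (n := ∞) p y hy)
  exact ((contMDiffWithinAt_tangentBundle_iff (I := I) (n := ⊤) (p := p)
    ((extChartAt I p).map_target hy)).1 h).2

variable [I.Boundaryless]

lemma mfderiv_extChartAt_symm_comp {p : N} {y : E} (hy : y ∈ (extChartAt I p).target) :
    (mfderiv 𝓘(ℝ, E) I (extChartAt I p).symm y) ∘L
      (mfderiv I 𝓘(ℝ, E) (extChartAt I p) ((extChartAt I p).symm y))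
      = ContinuousLinearMap.id ℝ _ := by
  have h1 : IsManifold I 1 N := isManifold_one_of_infty
  have := mfderivWithin_extChartAt_symm_comp_mfderiv_extChartAt (I := I) hy
  rwa [I.range_eq_univ, mfderivWithin_univ] at this

lemma mfderiv_extChartAt_comp {p : N} {y : E} (hy : y ∈ (extChartAt I p).target) :
    (mfderiv I 𝓘(ℝ, E) (extChartAt I p) ((extChartAt I p).symm y)) ∘L
      (mfderiv 𝓘(ℝ, E) I (extChartAt I p).symm y)
      = ContinuousLinearMap.id ℝ _ := by
  have h1 : IsManifold I 1 N := isManifold_one_of_infty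
  have := mfderiv_extChartAt_comp_mfderivWithin_extChartAt_symm (I := I) hy
  rwa [I.range_eq_univ, mfderivWithin_univ] at this

/-- The tangent vector with coordinates `w` at the point with coordinates `y` in the chart centred
at `p`. -/
def chartVec (I : ModelWithCorners ℝ E H) (p : N) (y w : E) :
    TangentSpace I ((extChartAt I p).symm y) :=
  mfderiv 𝓘(ℝ, E) I (extChartAt I p).symm y w

lemma chartVec_chartRep {p : N} {y : E} (hy : y ∈ (extChartAt I p).target)
    (v : TangentSpace I ((extChartAt I p).symm y)) :
    chartVec I p y (chartRep I p ((extChartAt I p).symm y) v) = v :=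
  DFunLike.congr_fun (mfderiv_extChartAt_symm_comp hy) v

lemma chartRep_chartVec {p : N} {y : E} (hy : y ∈ (extChartAt I p).target) (w : E) :
    chartRep I p ((extChartAt I p).symm y) (chartVec I p y w) = w :=
  DFunLike.congr_fun (mfderiv_extChartAt_comp hy) w

lemma contMDiffAt_extChartAt_symm {p : N} {y : E} (hy : y ∈ (extChartAt I p).target) :
    ContMDiffAt 𝓘(ℝ, E) I ∞ (extChartAt I p).symm y :=
  (contMDiffOn_extChartAt_symm p).contMDiffAt ((isOpen_extChartAt_target p).mem_nhds hy)

end ChartRep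

/-! ### Smoothness of local and complete flows on a manifold. -/

section ManifoldFlow

open Set

variable {E : Type*} [NormedAddCommGroup E] [NormedSpace ℝ E] [FiniteDimensional ℝ E]
  {H : Type*} [TopologicalSpace H] {I : ModelWithCorners ℝ E H} [I.Boundaryless]
  {N : Type*} [TopologicalSpace N] [ChartedSpace H N] [IsManifold I ∞ N]

/-- Every point has a neighbourhood on which a smooth vector field has a smooth short-time flow. -/
theorem exists_local_flow {V : ∀ x : N, TangentSpace I x}
    (hV : ContMDiff I I.tangent ∞ (fun x => (⟨x, V x⟩ : TangentBundle I N))) (p : N) :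
    ∃ φ : ℝ × N → N, ∃ ε > 0, ∃ U ∈ 𝓝 p,
      ContMDiffOn (𝓘(ℝ, ℝ).prod I) I ∞ φ (Ioo (-ε) ε ×ˢ U) ∧
      ∀ x ∈ U, φ (0, x) = x ∧ IsMIntegralCurveOn (fun t => φ (t, x)) V (Ioo (-ε) ε) := by
  set Ω := (extChartAt I p).target
  set ψ := (extChartAt I p).symm
  set y₀ := extChartAt I p p
  have hΩ : IsOpen Ω := isOpen_extChartAt_target p
  have hy₀ : y₀ ∈ Ω := mem_extChartAt_target p
  obtain ⟨R, hR, hRΩ⟩ := Metric.isOpen_iff.1 hΩ y₀ hy₀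
  -- The cut-off is 1 on the ball of radius R/4 and supported in a closed ball inside the chart
  -- target. So the cut-off field is smooth with compact support on all of E, hence Lipschitz.
  let χ : ContDiffBump y₀ := ⟨R / 4, R / 2, by positivity, by linarith⟩
  set vh : E → E := fun y => chartRep I p (ψ y) (V (ψ y))
  have hvh : ContDiffOn ℝ ∞ vh Ω := contDiffOn_chartRep hV p
  have hsub : Metric.closedBall y₀ (R / 2) ⊆ Ω :=
    (Metric.closedBall_subset_ball (by linarith)).trans hRΩ
  have hv : ContDiff ℝ ∞ (fun y => χ y • vh y) := by
    rw [contDiff_iff_contDiffAt]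
    intro y
    by_cases hy : y ∈ Ω
    · exact χ.contDiff.contDiffAt.smul (hvh.contDiffAt (hΩ.mem_nhds hy))
    · have : (fun y => χ y • vh y) =ᶠ[𝓝 y] fun _ => 0 := by
        filter_upwards [(Metric.isClosed_closedBall (x := y₀) (ε := R / 2)).isOpen_compl.mem_nhds
          (fun h => hy (hsub h))] with z hz
        have : χ z = 0 := by
          apply χ.zero_of_le_dist
          simp only [Set.mem_compl_iff, Metric.mem_closedBall, not_le] at hz
          exact hz.le
        simp [this]
      exact contDiffAt_const.congr_of_eventuallyEq this
  have hcs : HasCompactSupport (fun y => χ y • vh y) := χ.hasCompactSupport.smul_right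
  obtain ⟨L, hL⟩ := (hv.of_le (by norm_cast) : ContDiff ℝ 1 _).lipschitzWith_of_hasCompactSupport
    hcs one_ne_zero
  obtain ⟨f, ε, hε, hf, hfx⟩ := exists_flow_of_lipschitz (v := ⟨_, hv.continuous⟩) hv hL
  have hfc : ContinuousAt f (0, y₀) := (hf.continuousOn).continuousAt
    ((isOpen_Ioo.prod isOpen_univ).mem_nhds ⟨⟨by linarith, hε⟩, mem_univ _⟩)
  -- For short times and nearby initial points the curves stay where the cut-off equals 1, so they
  -- are integral curves of V itself.
  have hB : f ⁻¹' Metric.ball y₀ (R / 4) ∈ 𝓝 ((0 : ℝ), y₀) := by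
    apply hfc
    rw [(hfx y₀).1]
    exact Metric.ball_mem_nhds _ (by positivity)
  obtain ⟨S, hS, T, hT, hST⟩ := mem_nhds_prod_iff.1 hB
  obtain ⟨δ, hδ, hδS⟩ := Metric.mem_nhds_iff.1 hS
  set ε' := min ε δ
  have hε' : 0 < ε' := lt_min hε hδ
  have hI1 : Ioo (-ε') ε' ⊆ Ioo (-ε) ε :=
    Ioo_subset_Ioo (neg_le_neg (min_le_left _ _)) (min_le_left _ _)
  have hI2 : Ioo (-ε') ε' ⊆ S := by
    intro t ht
    apply hδS
    rw [mem_ball_zero_iff, Real.norm_eq_abs]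
    exact (abs_lt.2 ht).trans_le (min_le_right _ _)
  refine ⟨fun z => ψ (f (z.1, extChartAt I p z.2)), ε', hε',
    (extChartAt I p).source ∩ extChartAt I p ⁻¹' T,
    Filter.inter_mem (extChartAt_source_mem_nhds p) ((continuousAt_extChartAt p) hT), ?_, ?_⟩
  · have hmem : ∀ z ∈ Ioo (-ε') ε' ×ˢ ((extChartAt I p).source ∩ extChartAt I p ⁻¹' T),
        f (z.1, extChartAt I p z.2) ∈ Ω := by
      intro z hz
      exact hsub (Metric.ball_subset_closedBall.trans (Metric.closedBall_subset_closedBall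
        (by linarith)) (hST (mk_mem_prod (hI2 hz.1) hz.2.2)))
    refine (contMDiffOn_extChartAt_symm (n := ∞) p).comp ?_ hmem
    refine (hf.contMDiffOn).comp (t := Ioo (-ε) ε ×ˢ univ) ?_ (fun z hz => ⟨hI1 hz.1, mem_univ _⟩)
    rw [modelWithCornersSelf_prod, ← chartedSpaceSelf_prod]
    refine contMDiffOn_fst.prodMk ?_
    exact (contMDiffOn_extChartAt (n := ∞)).comp contMDiffOn_snd
      (fun z hz => by rw [← extChartAt_source I]; exact hz.2.1)
  · rintro x ⟨hx, hxT⟩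
    refine ⟨?_, ?_⟩
    · simp only [(hfx _).1]
      exact (extChartAt I p).left_inv hx
    · intro t ht
      apply HasMFDerivAt.hasMFDerivWithinAt
      have hball : f (t, extChartAt I p x) ∈ Metric.ball y₀ (R / 4) := hST (mk_mem_prod (hI2 ht) hxT)
      have hft : f (t, extChartAt I p x) ∈ Ω := hsub (Metric.ball_subset_closedBall.trans
        (Metric.closedBall_subset_closedBall (by linarith)) hball)
      have hd := (hfx (extChartAt I p x)).2 t (hI1 ht)
      have hone : χ (f (t, extChartAt I p x)) = 1 :=
        χ.one_of_mem_closedBall (Metric.ball_subset_closedBall hball)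
      simp only [ContinuousMap.coe_mk, hone, one_smul] at hd
      have h1 := ((contMDiffAt_extChartAt_symm hft).mdifferentiableAt (by norm_num)).hasMFDerivAt
      have h2 := h1.comp t (hd.hasFDerivAt.hasMFDerivAt)
      refine h2.congr_mfderiv ?_
      refine ContinuousLinearMap.ext_ring ?_
      have := chartVec_chartRep hft (V (ψ (f (t, extChartAt I p x))))
      change chartVec I p _ ((1 : ℝ) • vh _) = (1 : ℝ) • V _
      rw [one_smul, one_smul]
      exact this

variable [T2Space N]

omit [FiniteDimensional ℝ E] in
lemma isMIntegralCurve_unique {V : ∀ x : N, TangentSpace I x}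
    (hV : ContMDiff I I.tangent ∞ (fun x => (⟨x, V x⟩ : TangentBundle I N)))
    {γ γ' : ℝ → N} {a b t₀ : ℝ} (ht₀ : t₀ ∈ Ioo a b) (hγ : IsMIntegralCurveOn γ V (Ioo a b))
    (hγ' : IsMIntegralCurveOn γ' V (Ioo a b)) (h : γ t₀ = γ' t₀) : EqOn γ γ' (Ioo a b) := by
  have h1 : IsManifold I 1 N := isManifold_one_of_infty
  exact isMIntegralCurveOn_Ioo_eqOn_of_contMDiff_boundaryless ht₀ (hV.of_le (by norm_cast)) hγ hγ' h

/-- The flow of a complete smooth vector field is smooth. -/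
theorem contMDiff_flow {V : ∀ x : N, TangentSpace I x}
    (hV : ContMDiff I I.tangent ∞ (fun x => (⟨x, V x⟩ : TangentBundle I N)))
    {Φ : ℝ × N → N} (hΦ0 : ∀ x, Φ (0, x) = x) (hΦ : ∀ x, IsMIntegralCurve (fun t => Φ (t, x)) V) :
    ContMDiff (𝓘(ℝ, ℝ).prod I) I ∞ Φ := by
  have hgroup : ∀ s t x, Φ (s + t, x) = Φ (s, Φ (t, x)) := by
    intro s t x
    have h1 := (hΦ x).comp_add t
    have h2 := hΦ (Φ (t, x))
    have h3 := isMIntegralCurve_unique (a := -(|s| + 1)) (b := |s| + 1) (t₀ := 0) hV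
      ⟨by linarith [abs_nonneg s], by linarith [abs_nonneg s]⟩
      (h1.isMIntegralCurveOn _) (h2.isMIntegralCurveOn _) (by simp [hΦ0])
    exact h3 (abs_lt.1 (lt_add_one _))
  have hloc : ∀ p, ∃ ε > 0, ∀ t ∈ Ioo (-ε) ε, ContMDiffAt (𝓘(ℝ, ℝ).prod I) I ∞ Φ (t, p) := by
    intro p
    obtain ⟨φ, ε, hε, U, hU, hφ, hφx⟩ := exists_local_flow hV p
    refine ⟨ε, hε, fun t ht => ?_⟩
    have hmem : Ioo (-ε) ε ×ˢ U ∈ 𝓝 (t, p) := prod_mem_nhds (isOpen_Ioo.mem_nhds ht) hU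
    refine (hφ.contMDiffAt hmem).congr_of_eventuallyEq ?_
    filter_upwards [hmem] with z hz
    exact isMIntegralCurve_unique (t₀ := 0) hV ⟨by linarith, hε⟩
      ((hΦ z.2).isMIntegralCurveOn _) (hφx z.2 hz.2).2 (by simp [hΦ0, (hφx z.2 hz.2).1]) hz.1
  -- Near (s + t, p) the group law factors Φ through Φ(t, ·) and then Φ near (s, Φ(t, p)), so
  -- smoothness propagates along an orbit.
  have hext : ∀ s t p, ContMDiffAt (𝓘(ℝ, ℝ).prod I) I ∞ Φ (t, p) →
      ContMDiffAt (𝓘(ℝ, ℝ).prod I) I ∞ Φ (s, Φ (t, p)) →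
      ContMDiffAt (𝓘(ℝ, ℝ).prod I) I ∞ Φ (s + t, p) := by
    intro s t p h1 h2
    have h3 : ContMDiffAt I I ∞ (fun x => Φ (t, x)) p :=
      h1.comp p (contMDiffAt_const.prodMk contMDiffAt_id)
    have h4 : ContMDiffAt (𝓘(ℝ, ℝ).prod I) (𝓘(ℝ, ℝ).prod I) ∞
        (fun z : ℝ × N => (z.1 - t, Φ (t, z.2))) (s + t, p) := by
      refine ContMDiffAt.prodMk ?_ ?_
      · exact ((contDiff_id.sub contDiff_const).contMDiff.contMDiffAt).comp _ contMDiffAt_fst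
      · exact ContMDiffAt.comp (s + t, p) (I' := I) (g := fun x => Φ (t, x)) (f := Prod.snd)
          h3 contMDiffAt_snd
    have h5 : ContMDiffAt (𝓘(ℝ, ℝ).prod I) I ∞ (fun z : ℝ × N => Φ (z.1 - t, Φ (t, z.2)))
        (s + t, p) := by
      refine ContMDiffAt.comp (s + t, p) (g := Φ) ?_ h4
      simpa using h2
    refine h5.congr_of_eventuallyEq (Filter.Eventually.of_forall fun z => ?_)
    simp only [← hgroup, sub_add_cancel, Prod.mk.eta]
  rintro ⟨t, p⟩
  -- The set of times at which Φ is smooth along the orbit of p is clopen and contains 0. It is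
  -- closed because the local flow around Φ(s, p) has one existence time ε valid from every nearby
  -- orbit point Φ(r, p).
  let S : Set ℝ := {t | ContMDiffAt (𝓘(ℝ, ℝ).prod I) I ∞ Φ (t, p)}
  have hc : Continuous (fun t => Φ (t, p)) := (hΦ p).continuous
  suffices h : IsClopen S by
    have h0 : (0 : ℝ) ∈ S := by
      obtain ⟨ε, hε, h⟩ := hloc p
      exact h 0 ⟨by linarith, hε⟩
    have h1 : t ∈ S := by
      rw [h.eq_univ ⟨0, h0⟩]
      exact mem_univ t
    exact h1
  constructor
  · rw [← isOpen_compl_iff, isOpen_iff_mem_nhds]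
    intro s hs
    obtain ⟨φ, ε, hε, U, hU, hφ, hφx⟩ := exists_local_flow hV (Φ (s, p))
    have hmem : ∀ᶠ r in 𝓝 s, Φ (r, p) ∈ interior U :=
      hc.continuousAt (isOpen_interior.mem_nhds (mem_interior_iff_mem_nhds.2 hU))
    filter_upwards [hmem, Metric.ball_mem_nhds s hε] with r hr hrs hrS
    apply hs
    have hrs' : s - r ∈ Ioo (-ε) ε := by
      rw [mem_Ioo, ← abs_lt, abs_sub_comm]
      exact hrs
    have h1 : ContMDiffAt (𝓘(ℝ, ℝ).prod I) I ∞ Φ (s - r, Φ (r, p)) := by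
      have hm : Ioo (-ε) ε ×ˢ interior U ∈ 𝓝 (s - r, Φ (r, p)) :=
        prod_mem_nhds (isOpen_Ioo.mem_nhds hrs') (isOpen_interior.mem_nhds hr)
      refine ((hφ.mono (prod_mono_right interior_subset)).contMDiffAt hm).congr_of_eventuallyEq ?_
      filter_upwards [hm] with z hz
      have hz2 := interior_subset hz.2
      exact isMIntegralCurve_unique (t₀ := 0) hV ⟨by linarith, hε⟩
        ((hΦ z.2).isMIntegralCurveOn _) (hφx z.2 hz2).2 (by simp [hΦ0, (hφx z.2 hz2).1]) hz.1
    have := hext (s - r) r p hrS h1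
    rwa [sub_add_cancel] at this
  · rw [isOpen_iff_mem_nhds]
    intro s hs
    obtain ⟨ε, hε, h⟩ := hloc (Φ (s, p))
    filter_upwards [Metric.ball_mem_nhds s hε] with r hr
    have h1 := hext (r - s) s p hs (h (r - s) (abs_lt.1 hr))
    rwa [sub_add_cancel] at h1

end ManifoldFlow

/-! ### Flows of time-dependent fields via suspension to ℝ × N. -/

section TimeDependentFlow

open Set

variable {E : Type*} [NormedAddCommGroup E] [NormedSpace ℝ E]
  {H : Type*} [TopologicalSpace H] {I : ModelWithCorners ℝ E H}
  {N : Type*} [TopologicalSpace N] [ChartedSpace H N]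

/-- The autonomous vector field `(1, w_t)` on `ℝ × N` attached to a time-dependent field `w`. -/
def suspension (w : ℝ → ∀ x : N, TangentSpace I x) (z : ℝ × N) :
    TangentSpace (𝓘(ℝ, ℝ).prod I) z :=
  ((1 : ℝ), w z.1 z.2)

/-- `γ` is an integral curve at time `t` of the time-dependent field `w`. -/
def IsCurveAt (w : ℝ → ∀ x : N, TangentSpace I x) (γ : ℝ → N) (t : ℝ) : Prop :=
  HasMFDerivAt 𝓘(ℝ, ℝ) I γ t ((1 : ℝ →L[ℝ] ℝ).smulRight (w t (γ t)))

lemma hasMFDerivAt_suspension {w : ℝ → ∀ x : N, TangentSpace I x} {γ : ℝ → N} {t : ℝ}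
    (h : IsCurveAt w γ t) :
    HasMFDerivAt 𝓘(ℝ, ℝ) (𝓘(ℝ, ℝ).prod I) (fun s => (s, γ s)) t
      ((1 : ℝ →L[ℝ] ℝ).smulRight (suspension w (t, γ t))) := by
  have h1 : HasMFDerivAt 𝓘(ℝ, ℝ) 𝓘(ℝ, ℝ) (fun s : ℝ => s) t (ContinuousLinearMap.id ℝ ℝ) :=
    hasMFDerivAt_id t
  refine (h1.prodMk h).congr_mfderiv ?_
  refine ContinuousLinearMap.ext_ring ?_
  change ((1 : ℝ), (1 : ℝ) • w t (γ t)) = (1 : ℝ) • ((1 : ℝ), w t (γ t))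
  simp

variable [IsManifold I ∞ N]

lemma contMDiff_suspension {w : ℝ → ∀ x : N, TangentSpace I x}
    (hw : ContMDiff (𝓘(ℝ, ℝ).prod I) I.tangent ∞
      (fun z : ℝ × N => (⟨z.2, w z.1 z.2⟩ : TangentBundle I N))) :
    ContMDiff (𝓘(ℝ, ℝ).prod I) (𝓘(ℝ, ℝ).prod I).tangent ∞
      (fun z : ℝ × N => (⟨z, suspension w z⟩ : TangentBundle (𝓘(ℝ, ℝ).prod I) (ℝ × N))) := by
  have h1 : IsManifold I 1 N := isManifold_one_of_infty
  have h2 : ContMDiff 𝓘(ℝ, ℝ) 𝓘(ℝ, ℝ).tangent ∞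
      (fun t : ℝ => (⟨t, (1 : ℝ)⟩ : TangentBundle 𝓘(ℝ, ℝ) ℝ)) := by
    intro t
    refine (contMDiffWithinAt_tangentBundle_iff (I := 𝓘(ℝ, ℝ)) (n := ⊤) (p := t) (by simp)).2
      ⟨contMDiffWithinAt_id, ?_⟩
    have : (fun q : ℝ => chartRep 𝓘(ℝ, ℝ) t q (1 : ℝ)) = fun _ => (1 : ℝ) := by
      ext q
      have h3 : (extChartAt 𝓘(ℝ, ℝ) t : ℝ → ℝ) = id := by
        rw [extChartAt_model_space_eq_id]
        rfl
      change mfderiv 𝓘(ℝ, ℝ) 𝓘(ℝ, ℝ) (extChartAt 𝓘(ℝ, ℝ) t : ℝ → ℝ) q (1 : ℝ) = (1 : ℝ)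
      rw [h3, mfderiv_id]
      rfl
    rw [this]
    exact contMDiffWithinAt_const
  exact (contMDiff_equivTangentBundleProd_symm (I := 𝓘(ℝ, ℝ)) (M := ℝ) (I' := I) (M' := N)
    (n := ∞)).comp ((h2.comp contMDiff_fst).prodMk hw)

variable [FiniteDimensional ℝ E] [I.Boundaryless] [T2Space N]

omit [FiniteDimensional ℝ E] in
/-- Uniqueness of integral curves of globally defined smooth time-dependent fields. -/
lemma isCurveAt_unique_of_contMDiff {w : ℝ → ∀ x : N, TangentSpace I x}
    (hw : ContMDiff (𝓘(ℝ, ℝ).prod I) I.tangent ∞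
      (fun z : ℝ × N => (⟨z.2, w z.1 z.2⟩ : TangentBundle I N)))
    {γ γ' : ℝ → N} {a b t₀ : ℝ} (ht₀ : t₀ ∈ Ioo a b) (hγ : ∀ t ∈ Ioo a b, IsCurveAt w γ t)
    (hγ' : ∀ t ∈ Ioo a b, IsCurveAt w γ' t) (h : γ t₀ = γ' t₀) : EqOn γ γ' (Ioo a b) := by
  have h1 := isMIntegralCurve_unique (contMDiff_suspension hw) ht₀
    (fun t ht => (hasMFDerivAt_suspension (hγ t ht)).hasMFDerivWithinAt)
    (fun t ht => (hasMFDerivAt_suspension (hγ' t ht)).hasMFDerivWithinAt) (by simp [h])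
  intro t ht
  exact congrArg Prod.snd (h1 ht)

variable [CompactSpace N]

/-- A smooth time-dependent field on a compact manifold vanishing outside a compact time interval
has a global smooth flow. -/
lemma exists_flow_of_compact_time {w : ℝ → ∀ x : N, TangentSpace I x}
    (hw : ContMDiff (𝓘(ℝ, ℝ).prod I) I.tangent ∞
      (fun z : ℝ × N => (⟨z.2, w z.1 z.2⟩ : TangentBundle I N)))
    {a b : ℝ} (hab : ∀ t, t ∉ Icc a b → ∀ x, w t x = 0) :
    ∃ η : ℝ × N → N, ContMDiff (𝓘(ℝ, ℝ).prod I) I ∞ η ∧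
      ∀ x, η (0, x) = x ∧ ∀ t, IsCurveAt w (fun s => η (s, x)) t := by
  set V := suspension w
  have hV := contMDiff_suspension hw
  have hV1 : ContMDiff (𝓘(ℝ, ℝ).prod I) (𝓘(ℝ, ℝ).prod I).tangent 1
      (fun z : ℝ × N => (⟨z, suspension w z⟩ : TangentBundle (𝓘(ℝ, ℝ).prod I) (ℝ × N))) :=
    hV.of_le (by norm_cast)
  have hlocal : ∃ ε > 0, ∀ z ∈ Icc (a - 1) (b + 1) ×ˢ (univ : Set N), ∃ γ : ℝ → ℝ × N,
      γ 0 = z ∧ IsMIntegralCurveOn γ V (Ioo (-ε) ε) := by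
    refine (isCompact_Icc.prod isCompact_univ).induction_on
      (p := fun S => ∃ ε > 0, ∀ z ∈ S, ∃ γ : ℝ → ℝ × N,
        γ 0 = z ∧ IsMIntegralCurveOn γ V (Ioo (-ε) ε)) ?_ ?_ ?_ ?_
    · exact ⟨1, one_pos, by simp⟩
    · rintro S T hST ⟨ε, hε, h⟩
      exact ⟨ε, hε, fun z hz => h z (hST hz)⟩
    · rintro S T ⟨ε, hε, h⟩ ⟨δ, hδ, h'⟩
      refine ⟨min ε δ, lt_min hε hδ, ?_⟩
      rintro z (hz | hz)
      · obtain ⟨γ, h0, hγ⟩ := h z hz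
        exact ⟨γ, h0, hγ.mono (Ioo_subset_Ioo (neg_le_neg (min_le_left _ _)) (min_le_left _ _))⟩
      · obtain ⟨γ, h0, hγ⟩ := h' z hz
        exact ⟨γ, h0, hγ.mono (Ioo_subset_Ioo (neg_le_neg (min_le_right _ _)) (min_le_right _ _))⟩
    · intro z _
      obtain ⟨φ, ε, hε, U, hU, -, h⟩ := exists_local_flow hV z
      exact ⟨U, mem_nhdsWithin_of_mem_nhds hU, ε, hε, fun y hy => ⟨fun t => φ (t, y), h y hy⟩⟩
  obtain ⟨ε, hε, hloc⟩ := hlocal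
  -- A uniform existence time makes the suspended field complete. On the compact slab it comes from
  -- `hlocal`; off the slab the field is (1, 0) for |s| < 1, because the slab exceeds [a, b] by 1 on
  -- each side, which is also why the time is capped by 1.
  have huniform : ∀ z : ℝ × N, ∃ γ : ℝ → ℝ × N,
      γ 0 = z ∧ IsMIntegralCurveOn γ V (Ioo (-(min ε 1)) (min ε 1)) := by
    rintro ⟨t, x⟩
    by_cases ht : t ∈ Icc (a - 1) (b + 1)
    · obtain ⟨γ, h0, hγ⟩ := hloc (t, x) ⟨ht, mem_univ _⟩
      exact ⟨γ, h0, hγ.mono (Ioo_subset_Ioo (neg_le_neg (min_le_left _ _)) (min_le_left _ _))⟩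
    · refine ⟨fun s => (t + s, x), by simp, fun s hs => HasMFDerivAt.hasMFDerivWithinAt ?_⟩
      have hs1 : -1 < s ∧ s < 1 :=
        ⟨by linarith [hs.1, min_le_right ε 1], by linarith [hs.2, min_le_right ε 1]⟩
      have hw0 : w (t + s) x = 0 := by
        apply hab
        intro h
        exact ht ⟨by linarith [h.1], by linarith [h.2]⟩
      have h1 : HasMFDerivAt 𝓘(ℝ, ℝ) 𝓘(ℝ, ℝ) (fun s : ℝ => t + s) s
          (ContinuousLinearMap.id ℝ ℝ) :=
        ((hasFDerivAt_id s).const_add t).hasMFDerivAt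
      have h2 : HasMFDerivAt 𝓘(ℝ, ℝ) I (fun _ : ℝ => x) s 0 := hasMFDerivAt_const x s
      refine (h1.prodMk h2).congr_mfderiv ?_
      refine ContinuousLinearMap.ext_ring ?_
      change ((1 : ℝ), (0 : TangentSpace I x)) = (1 : ℝ) • ((1 : ℝ), w (t + s) x)
      rw [hw0]
      simp
  have h1 : IsManifold (𝓘(ℝ, ℝ).prod I) 1 (ℝ × N) := isManifold_one_of_infty
  choose γ hγ0 hγ using exists_isMIntegralCurve_of_isMIntegralCurveOn hV1
    (lt_min hε one_pos) huniform
  have hΦ : ContMDiff (𝓘(ℝ, ℝ).prod (𝓘(ℝ, ℝ).prod I)) (𝓘(ℝ, ℝ).prod I) ∞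
      (fun z : ℝ × (ℝ × N) => γ z.2 z.1) := contMDiff_flow hV hγ0 hγ
  -- The time component of the suspended field is 1, so the curve parameter is the time itself.
  have hfst : ∀ x s, (γ (0, x) s).1 = s := by
    intro x s
    have hd : ∀ r, HasDerivAt (fun r => (γ (0, x) r).1 - r) 0 r := by
      intro r
      have h2 := (hasMFDerivAt_fst (γ (0, x) r)).comp r (hγ (0, x) r)
      have h3 : HasFDerivAt (fun r => (γ (0, x) r).1) (ContinuousLinearMap.id ℝ ℝ) r := by
        refine (hasMFDerivAt_iff_hasFDerivAt.1 h2).congr_fderiv ?_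
        refine ContinuousLinearMap.ext_ring ?_
        change (1 : ℝ) • (1 : ℝ) = 1
        simp
      have h4 : HasDerivAt (fun r => (γ (0, x) r).1) 1 r := h3.hasDerivAt
      have h5 := h4.sub (hasDerivAt_id r)
      rw [sub_self] at h5
      exact h5
    have := is_const_of_deriv_eq_zero (fun r => (hd r).differentiableAt) (fun r => (hd r).deriv) s 0
    simp only [hγ0, sub_zero] at this
    linarith
  refine ⟨fun z => (γ (0, z.2) z.1).2, ?_, fun x => ⟨by simp [hγ0], fun t => ?_⟩⟩
  · have h2 : ContMDiff (𝓘(ℝ, ℝ).prod I) (𝓘(ℝ, ℝ).prod (𝓘(ℝ, ℝ).prod I)) ∞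
        (fun z : ℝ × N => (z.1, ((0 : ℝ), z.2))) :=
      contMDiff_fst.prodMk (contMDiff_const.prodMk contMDiff_snd)
    exact contMDiff_snd.comp (hΦ.comp h2)
  · have h2 := (hasMFDerivAt_snd (γ (0, x) t)).comp t (hγ (0, x) t)
    refine HasMFDerivAt.congr_mfderiv h2 ?_
    refine ContinuousLinearMap.ext_ring ?_
    change (1 : ℝ) • w (γ (0, x) t).1 (γ (0, x) t).2 = (1 : ℝ) • w t (γ (0, x) t).2
    rw [hfst]

omit [I.Boundaryless] [T2Space N] [FiniteDimensional ℝ E] [CompactSpace N] in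
/-- A time-dependent field on an open time interval can be cut off in time. -/
lemma exists_time_cutoff {w : ℝ → ∀ x : N, TangentSpace I x} {a b a' b' : ℝ}
    (hw : ContMDiffOn (𝓘(ℝ, ℝ).prod I) I.tangent ∞
      (fun z : ℝ × N => (⟨z.2, w z.1 z.2⟩ : TangentBundle I N)) (Ioo a b ×ˢ univ))
    (ha : a < a') (hab : a' < b') (hb : b' < b) :
    ∃ w' : ℝ → ∀ x : N, TangentSpace I x, ContMDiff (𝓘(ℝ, ℝ).prod I) I.tangent ∞
      (fun z : ℝ × N => (⟨z.2, w' z.1 z.2⟩ : TangentBundle I N)) ∧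
      (∀ t ∈ Icc a' b', w' t = w t) ∧ ∀ t, t ∉ Icc a b → ∀ x, w' t x = 0 := by
  -- The bump in time is supported in [a' - d/2, b' + d/2], strictly inside (a, b), which leaves
  -- room to patch smoothly with zero.
  set d := min (a' - a) (b - b')
  have hd : 0 < d := lt_min (by linarith) (by linarith)
  have hd1 : d ≤ a' - a := min_le_left _ _
  have hd2 : d ≤ b - b' := min_le_right _ _
  let χ : ContDiffBump ((a' + b') / 2) := ⟨(b' - a') / 2, (b' - a') / 2 + d / 2, by linarith,
    by linarith⟩
  have hone : ∀ t ∈ Icc a' b', χ t = 1 := by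
    intro t ht
    apply χ.one_of_mem_closedBall
    rw [Metric.mem_closedBall, Real.dist_eq, abs_le]
    change -((b' - a') / 2) ≤ _ ∧ _ ≤ (b' - a') / 2
    exact ⟨by linarith [ht.1], by linarith [ht.2]⟩
  have hsupp : ∀ t, t ∉ Icc (a' - d / 2) (b' + d / 2) → χ t = 0 := by
    intro t ht
    apply χ.zero_of_le_dist
    by_contra h
    rw [not_le, Real.dist_eq, abs_lt] at h
    change -((b' - a') / 2 + d / 2) < _ ∧ _ < (b' - a') / 2 + d / 2 at h
    exact ht ⟨by linarith [h.1], by linarith [h.2]⟩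
  refine ⟨fun t x => χ t • w t x, ?_, fun t ht => ?_, fun t ht x => ?_⟩
  · rintro ⟨t, x⟩
    rw [← contMDiffWithinAt_univ]
    refine (contMDiffWithinAt_tangentBundle_iff (I := I) (n := ⊤) (p := x)
      (mem_extChartAt_source x)).2 ⟨contMDiffWithinAt_snd, ?_⟩
    rw [contMDiffWithinAt_univ]
    by_cases ht : t ∈ Ioo a b
    · have h1 := ((contMDiffWithinAt_tangentBundle_iff (I := I) (n := ⊤) (p := x)
        (mem_extChartAt_source x)).1 (hw (t, x) ⟨ht, mem_univ _⟩)).2.contMDiffAt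
          ((isOpen_Ioo.prod isOpen_univ).mem_nhds ⟨ht, mem_univ _⟩)
      have h2 : ContMDiffAt (𝓘(ℝ, ℝ).prod I) 𝓘(ℝ, ℝ) ∞ (fun z : ℝ × N => χ z.1) (t, x) :=
        (χ.contDiff.contMDiff.contMDiffAt).comp (t, x) contMDiffAt_fst
      refine (h2.smul h1).congr_of_eventuallyEq (Filter.Eventually.of_forall fun z => ?_)
      exact chartRep_smul _ _ _ _
    · have h0 : (fun z : ℝ × N => chartRep I x z.2 (χ z.1 • w z.1 z.2)) =ᶠ[𝓝 (t, x)]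
          fun _ => 0 := by
        have : (Icc (a' - d / 2) (b' + d / 2))ᶜ ∈ 𝓝 t := isClosed_Icc.isOpen_compl.mem_nhds
          fun h => ht ⟨by linarith [h.1], by linarith [h.2]⟩
        filter_upwards [prod_mem_nhds this Filter.univ_mem] with z hz
        rw [hsupp _ hz.1, zero_smul, chartRep_zero]
      exact contMDiffAt_const.congr_of_eventuallyEq h0
  · ext1 x
    change χ t • w t x = w t x
    rw [hone t ht, one_smul]
  · change χ t • w t x = 0
    rw [hsupp t fun h => ht ⟨by linarith [h.1], by linarith [h.2]⟩, zero_smul]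

omit [CompactSpace N] [FiniteDimensional ℝ E] in
lemma isCurveAt_unique {w : ℝ → ∀ x : N, TangentSpace I x} {a b a' b' : ℝ}
    (hw : ContMDiffOn (𝓘(ℝ, ℝ).prod I) I.tangent ∞
      (fun z : ℝ × N => (⟨z.2, w z.1 z.2⟩ : TangentBundle I N)) (Ioo a b ×ˢ univ))
    (ha : a < a') (hb : b' < b)
    {γ γ' : ℝ → N} {t₀ : ℝ} (ht₀ : t₀ ∈ Ioo a' b') (hγ : ∀ t ∈ Ioo a' b', IsCurveAt w γ t)
    (hγ' : ∀ t ∈ Ioo a' b', IsCurveAt w γ' t) (h : γ t₀ = γ' t₀) : EqOn γ γ' (Ioo a' b') := by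
  obtain ⟨w', hw', heq, -⟩ := exists_time_cutoff hw ha (ht₀.1.trans ht₀.2) hb
  refine isCurveAt_unique_of_contMDiff hw' ht₀ (fun t ht => ?_) (fun t ht => ?_) h
  · unfold IsCurveAt
    rw [heq t (Ioo_subset_Icc_self ht)]
    exact hγ t ht
  · unfold IsCurveAt
    rw [heq t (Ioo_subset_Icc_self ht)]
    exact hγ' t ht

/-- A smooth time-dependent field on a compact manifold has a smooth flow on its whole open
interval of definition. -/
theorem exists_timeDependent_flow {w : ℝ → ∀ x : N, TangentSpace I x} {a b : ℝ}
    (ha : a < 0) (hb : 0 < b)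
    (hw : ContMDiffOn (𝓘(ℝ, ℝ).prod I) I.tangent ∞
      (fun z : ℝ × N => (⟨z.2, w z.1 z.2⟩ : TangentBundle I N)) (Ioo a b ×ˢ univ)) :
    ∃ η : ℝ × N → N, ContMDiffOn (𝓘(ℝ, ℝ).prod I) I ∞ η (Ioo a b ×ˢ univ) ∧
      ∀ x, η (0, x) = x ∧ ∀ t ∈ Ioo a b, IsCurveAt w (fun s => η (s, x)) t := by
  -- The flow is first built on the shrunken intervals (θa, θb), where a time cut-off does not
  -- change the field; uniqueness glues these flows as θ increases to 1.
  have hexists : ∀ θ : ℝ, ∃ η : ℝ × N → N, θ ∈ Ioo (0 : ℝ) 1 →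
      ContMDiff (𝓘(ℝ, ℝ).prod I) I ∞ η ∧
      ∀ x, η (0, x) = x ∧ ∀ t ∈ Ioo (θ * a) (θ * b), IsCurveAt w (fun s => η (s, x)) t := by
    intro θ
    by_cases hθ : θ ∈ Ioo (0 : ℝ) 1
    · obtain ⟨w', hw', heq, h0⟩ := exists_time_cutoff (a' := θ * a) (b' := θ * b) hw
        (by nlinarith [hθ.1, hθ.2]) (by nlinarith [hθ.1, hθ.2]) (by nlinarith [hθ.1, hθ.2])
      obtain ⟨η, hη, hηx⟩ := exists_flow_of_compact_time hw' h0
      refine ⟨η, fun _ => ⟨hη, fun x => ⟨(hηx x).1, fun t ht => ?_⟩⟩⟩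
      have := (hηx x).2 t
      unfold IsCurveAt at this
      rwa [heq t (Ioo_subset_Icc_self ht)] at this
    · exact ⟨fun z => z.2, fun h => absurd h hθ⟩
  choose η hη using hexists
  have hagree : ∀ θ ∈ Ioo (0 : ℝ) 1, ∀ θ' ∈ Ioo (0 : ℝ) 1, ∀ t ∈ Ioo (θ * a) (θ * b),
      t ∈ Ioo (θ' * a) (θ' * b) → ∀ x, η θ (t, x) = η θ' (t, x) := by
    have hle : ∀ θ ∈ Ioo (0 : ℝ) 1, ∀ θ' ∈ Ioo (0 : ℝ) 1, θ ≤ θ' → ∀ t ∈ Ioo (θ * a) (θ * b),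
        ∀ x, η θ (t, x) = η θ' (t, x) := by
      intro θ hθ θ' hθ' hle t ht x
      refine isCurveAt_unique (a' := θ * a) (b' := θ * b) (t₀ := 0)
        (γ := fun s => η θ (s, x)) (γ' := fun s => η θ' (s, x)) hw (by nlinarith [hθ.1, hθ.2])
        (by nlinarith [hθ.1, hθ.2]) ⟨by nlinarith [hθ.1], by nlinarith [hθ.1]⟩
        (((hη θ hθ).2 x).2) (fun s hs => ((hη θ' hθ').2 x).2 s
          ⟨by nlinarith [hs.1], by nlinarith [hs.2]⟩) ?_ ht
      rw [((hη θ hθ).2 x).1, ((hη θ' hθ').2 x).1]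
    intro θ hθ θ' hθ' t ht ht' x
    rcases le_total θ θ' with h | h
    · exact hle θ hθ θ' hθ' h t ht x
    · exact (hle θ' hθ' θ hθ h t ht' x).symm
  -- For a < t < b, max(t/a, t/b) is the smallest θ ≥ 0 with t in [θa, θb]; averaging it with 1
  -- gives an admissible θ whose open interval contains t. Near a given time the parameter may be
  -- frozen, by agreement of the flows.
  let r : ℝ → ℝ := fun t => (1 + max (t / a) (t / b)) / 2
  have hr : ∀ t ∈ Ioo a b, r t ∈ Ioo (0 : ℝ) 1 ∧ t ∈ Ioo (r t * a) (r t * b) := by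
    intro t ht
    have h1 : t / a < 1 := (div_lt_one_of_neg ha).2 ht.1
    have h2 : t / b < 1 := (div_lt_one hb).2 ht.2
    have h3 : 0 ≤ max (t / a) (t / b) := by
      rcases le_total t 0 with h | h
      · exact le_max_of_le_left (div_nonneg_of_nonpos h ha.le)
      · exact le_max_of_le_right (div_nonneg h hb.le)
    have h4 : max (t / a) (t / b) < 1 := max_lt h1 h2
    have h5 : max (t / a) (t / b) < r t := by simp only [r]; linarith
    refine ⟨⟨by simp only [r]; linarith, by simp only [r]; linarith⟩, ?_, ?_⟩
    · have := (le_max_left (t / a) (t / b)).trans_lt h5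
      rwa [div_lt_iff_of_neg ha] at this
    · have := (le_max_right (t / a) (t / b)).trans_lt h5
      rwa [div_lt_iff₀ hb] at this
  have hev : ∀ t ∈ Ioo a b, ∀ᶠ s in 𝓝 t, ∀ x, η (r s) (s, x) = η (r t) (s, x) := by
    intro t ht
    filter_upwards [isOpen_Ioo.mem_nhds ht, isOpen_Ioo.mem_nhds (hr t ht).2] with s hs1 hs2 x
    exact hagree _ (hr s hs1).1 _ (hr t ht).1 s (hr s hs1).2 hs2 x
  refine ⟨fun z => η (r z.1) z, ?_, fun x => ⟨?_, fun t ht => ?_⟩⟩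
  · rintro ⟨t, x⟩ ⟨ht, -⟩
    apply ContMDiffAt.contMDiffWithinAt
    refine ((hη _ (hr t ht).1).1 (t, x)).congr_of_eventuallyEq ?_
    filter_upwards [(hev t ht).prod_inl_nhds x] with z hz
    exact hz z.2
  · exact ((hη _ (hr 0 ⟨ha, hb⟩).1).2 x).1
  · have h1 := ((hη _ (hr t ht).1).2 x).2 t (hr t ht).2
    refine HasMFDerivAt.congr_of_eventuallyEq h1 ?_
    filter_upwards [hev t ht] with s hs
    exact hs x

end TimeDependentFlow

/-! ### Derivatives of determinants, and invariance of the divergence. -/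

section Jacobi

variable {n : ℕ}

local notation "𝔼" => EuclideanSpace ℝ (Fin n)

/-- Jacobi's formula. -/
lemma hasDerivAt_matrix_det {ι : Type*} [Fintype ι] [DecidableEq ι] {M : ℝ → Matrix ι ι ℝ}
    {M' : Matrix ι ι ℝ} {t : ℝ} (h : ∀ i j, HasDerivAt (fun s => M s i j) (M' i j) t) :
    HasDerivAt (fun s => (M s).det) ((M t).adjugate * M').trace t := by
  have h1 : HasDerivAt (fun s => (M s).det)
      (∑ σ : Equiv.Perm ι, (Equiv.Perm.sign σ : ℝ) *
        ∑ k, (∏ j ∈ Finset.univ.erase k, M t (σ j) j) • M' (σ k) k) t := by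
    simp only [Matrix.det_apply']
    refine HasDerivAt.fun_sum fun σ _ => HasDerivAt.const_mul _ ?_
    exact HasDerivAt.fun_finsetProd fun j _ => h (σ j) j
  convert! h1 using 1
  have h2 : ((M t).adjugate * M').trace = ∑ k, ((M t).updateCol k (fun i => M' i k)).det := by
    rw [Matrix.trace]
    refine Finset.sum_congr rfl fun k _ => ?_
    rw [Matrix.diag_apply, Matrix.mul_apply]
    have := congrFun (Matrix.cramer_eq_adjugate_mulVec (M t) (fun i => M' i k)) k
    rw [Matrix.cramer_apply] at this
    rw [this]
    rfl
  rw [h2]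
  simp only [Matrix.det_apply', Finset.mul_sum]
  rw [Finset.sum_comm]
  refine Finset.sum_congr rfl fun σ _ => Finset.sum_congr rfl fun k _ => ?_
  rw [← Finset.mul_prod_erase _ _ (Finset.mem_univ k)]
  rw [Matrix.updateCol_self, smul_eq_mul, mul_comm (M' _ _)]
  congr 2
  refine Finset.prod_congr rfl fun j hj => ?_
  rw [Matrix.updateCol_ne (Finset.ne_of_mem_erase hj)]

/-- The matrix of an endomorphism of Euclidean space. -/
def clmMatrix (A : 𝔼 →L[ℝ] 𝔼) : Matrix (Fin n) (Fin n) ℝ :=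
  LinearMap.toMatrix (EuclideanSpace.basisFun (Fin n) ℝ).toBasis
    (EuclideanSpace.basisFun (Fin n) ℝ).toBasis (A : 𝔼 →ₗ[ℝ] 𝔼)

lemma clmMatrix_apply (A : 𝔼 →L[ℝ] 𝔼) (i j : Fin n) :
    clmMatrix A i j = A (EuclideanSpace.single j 1) i := by
  simp [clmMatrix, LinearMap.toMatrix_apply]

lemma clmMatrix_comp (A B : 𝔼 →L[ℝ] 𝔼) : clmMatrix (A ∘L B) = clmMatrix A * clmMatrix B :=
  LinearMap.toMatrix_comp _ _ _ _ _

lemma clmMatrix_id : clmMatrix (ContinuousLinearMap.id ℝ 𝔼) = 1 :=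
  LinearMap.toMatrix_id _

lemma clmMatrix_add (A B : 𝔼 →L[ℝ] 𝔼) : clmMatrix (A + B) = clmMatrix A + clmMatrix B := by
  simp [clmMatrix]

lemma det_clmMatrix (A : 𝔼 →L[ℝ] 𝔼) : (clmMatrix A).det = A.det :=
  LinearMap.det_toMatrix _ _

lemma hasDerivAt_clmMatrix {A : ℝ → 𝔼 →L[ℝ] 𝔼} {A' : 𝔼 →L[ℝ] 𝔼} {t : ℝ} (h : HasDerivAt A A' t)
    (i j : Fin n) : HasDerivAt (fun s => clmMatrix (A s) i j) (clmMatrix A' i j) t := by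
  simp only [clmMatrix_apply]
  have h1 := h.clm_apply (hasDerivAt_const t (EuclideanSpace.single j (1 : ℝ)))
  refine HasDerivAt.congr_deriv
    ((EuclideanSpace.proj (𝕜 := ℝ) i).hasFDerivAt.comp_hasDerivAt t h1) ?_
  simp

/-- By Jacobi's formula the derivative is tr(adj(A) B A), which cyclicity of the trace and A adj(A)
= det(A) turn into tr(B) det(A). -/
lemma hasDerivAt_det_left {A : ℝ → 𝔼 →L[ℝ] 𝔼} {B : 𝔼 →L[ℝ] 𝔼} {t : ℝ}
    (h : HasDerivAt A (B ∘L A t) t) :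
    HasDerivAt (fun s => (A s).det) ((clmMatrix B).trace * (A t).det) t := by
  have h1 := hasDerivAt_matrix_det (hasDerivAt_clmMatrix h)
  simp only [det_clmMatrix] at h1
  convert! h1 using 1
  rw [clmMatrix_comp, ← mul_assoc, Matrix.trace_mul_comm, ← mul_assoc, Matrix.mul_adjugate,
    det_clmMatrix]
  simp [mul_comm]

lemma hasDerivAt_det_right {A : ℝ → 𝔼 →L[ℝ] 𝔼} {B : 𝔼 →L[ℝ] 𝔼} {t : ℝ}
    (h : HasDerivAt A (A t ∘L B) t) :
    HasDerivAt (fun s => (A s).det) ((clmMatrix B).trace * (A t).det) t := by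
  have h1 := hasDerivAt_matrix_det (hasDerivAt_clmMatrix h)
  simp only [det_clmMatrix] at h1
  convert! h1 using 1
  rw [clmMatrix_comp, ← mul_assoc, Matrix.adjugate_mul, det_clmMatrix]
  simp [mul_comm]

/-- The divergence `s⁻¹ ∑ᵢ ∂ᵢ (s vⁱ)` of a vector field on Euclidean space with respect to the
density `s`. -/
def densityDiv (s : 𝔼 → ℝ) (v : 𝔼 → 𝔼) (y : 𝔼) : ℝ :=
  (s y)⁻¹ * ∑ i, partialDeriv i (fun z => s z * v z i) y

lemma trace_clmMatrix (A : 𝔼 →L[ℝ] 𝔼) :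
    (clmMatrix A).trace = ∑ i, A (EuclideanSpace.single i 1) i := by
  simp [Matrix.trace, clmMatrix_apply]

lemma sum_partialDeriv_mul {s : 𝔼 → ℝ} {v : 𝔼 → 𝔼} {y : 𝔼} (hs : DifferentiableAt ℝ s y)
    (hv : DifferentiableAt ℝ v y) :
    ∑ i, partialDeriv i (fun z => s z * v z i) y
      = s y * (clmMatrix (fderiv ℝ v y)).trace + fderiv ℝ s y (v y) := by
  have h1 : ∀ i, partialDeriv i (fun z => s z * v z i) y
      = s y * fderiv ℝ v y (EuclideanSpace.single i 1) i
        + v y i * fderiv ℝ s y (EuclideanSpace.single i 1) := by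
    intro i
    have hvi : HasFDerivAt (fun z => v z i)
        ((EuclideanSpace.proj (𝕜 := ℝ) i : 𝔼 →L[ℝ] ℝ) ∘L fderiv ℝ v y) y :=
      (EuclideanSpace.proj (𝕜 := ℝ) i : 𝔼 →L[ℝ] ℝ).hasFDerivAt.comp y hv.hasFDerivAt
    rw [partialDeriv, (hs.hasFDerivAt.fun_mul hvi).fderiv]
    simp
  simp only [h1, Finset.sum_add_distrib, trace_clmMatrix, Finset.mul_sum]
  congr 1
  have h2 : v y = ∑ i, v y i • EuclideanSpace.single i (1 : ℝ) := by
    ext j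
    simp [Finset.sum_apply, Pi.single_apply]
  conv_rhs => rw [h2, map_sum]
  simp

lemma densityDiv_eq {s : 𝔼 → ℝ} {v : 𝔼 → 𝔼} {y : 𝔼} (hs : DifferentiableAt ℝ s y)
    (hv : DifferentiableAt ℝ v y) (h0 : s y ≠ 0) :
    densityDiv s v y = (clmMatrix (fderiv ℝ v y)).trace + (s y)⁻¹ * fderiv ℝ s y (v y) := by
  rw [densityDiv, sum_partialDeriv_mul hs hv, mul_add, inv_mul_cancel_left₀ h0]

/-- The divergence does not depend on the coordinates: it is preserved by a change of variables
under which the field transforms as a vector and the density as a density. -/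
theorem densityDiv_comp {τ : 𝔼 → 𝔼} {s σ : 𝔼 → ℝ} {v w : 𝔼 → 𝔼} {y : 𝔼}
    (hτ : ContDiffAt ℝ ∞ τ y) (hs : DifferentiableAt ℝ s y) (hσ : DifferentiableAt ℝ σ (τ y))
    (hv : DifferentiableAt ℝ v y) (hw : DifferentiableAt ℝ w (τ y)) (hs0 : s y ≠ 0)
    (hvw : ∀ᶠ z in 𝓝 y, w (τ z) = fderiv ℝ τ z (v z))
    (hsσ : ∀ᶠ z in 𝓝 y, s z ^ 2 = (fderiv ℝ τ z).det ^ 2 * σ (τ z) ^ 2) :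
    densityDiv s v y = densityDiv σ w (τ y) := by
  have hdet0 : (fderiv ℝ τ y).det ≠ 0 := by
    intro h
    have := hsσ.self_of_nhds
    rw [h] at this
    exact hs0 (by simpa using this)
  have hσ0 : σ (τ y) ≠ 0 := by
    intro h
    have := hsσ.self_of_nhds
    rw [h] at this
    exact hs0 (by simpa using this)
  rw [densityDiv_eq hs hv hs0, densityDiv_eq hσ hw hσ0]
  set A := fderiv ℝ τ with hA
  have hτ1 : HasFDerivAt τ (A y) y := (hτ.differentiableAt (by norm_num)).hasFDerivAt
  have hAd : DifferentiableAt ℝ A y :=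
    (hτ.fderiv_right (m := 1) (by norm_cast)).differentiableAt (by norm_num)
  have hsymm : ∀ h k, fderiv ℝ A y h k = fderiv ℝ A y k h := by
    have := hτ.isSymmSndFDerivAt (by
      rw [minSmoothness_of_isRCLikeNormedField]
      exact WithTop.coe_le_coe.2 le_top)
    exact fun h k => this h k
  set D := fderiv ℝ A y (v y)
  -- Differentiating w∘τ = Dτ·v gives Dw∘Dτ = Dτ∘Dv + D²τ(·, v); symmetry of the second derivative
  -- rewrites the last term as the derivative D of Dτ along v.
  have hdw : fderiv ℝ w (τ y) ∘L A y = A y ∘L fderiv ℝ v y + D := by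
    have h1 : HasFDerivAt (fun z => w (τ z)) (fderiv ℝ w (τ y) ∘L A y) y :=
      hw.hasFDerivAt.comp y hτ1
    have h2 := hAd.hasFDerivAt.clm_apply hv.hasFDerivAt
    have h3 := (h2.congr_of_eventuallyEq hvw).unique h1
    rw [← h3]
    ext h : 1
    simp [D, hsymm h (v y)]
  -- the endomorphism `C` with `D = A y ∘ C`
  obtain ⟨e, he⟩ : ∃ e : 𝔼 ≃L[ℝ] 𝔼, (e : 𝔼 →L[ℝ] 𝔼) = A y :=
    ⟨(A y).toContinuousLinearEquivOfDetNeZero hdet0, by ext; simp⟩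
  set C : 𝔼 →L[ℝ] 𝔼 := (e.symm : 𝔼 →L[ℝ] 𝔼) ∘L D
  have hC : A y ∘L C = D := by
    rw [← he]
    ext
    simp [C]
  have htr : (clmMatrix (fderiv ℝ w (τ y))).trace
      = (clmMatrix (fderiv ℝ v y)).trace + (clmMatrix C).trace := by
    have h1 : fderiv ℝ w (τ y) = (A y ∘L (fderiv ℝ v y + C)) ∘L (e.symm : 𝔼 →L[ℝ] 𝔼) := by
      rw [ContinuousLinearMap.comp_add, hC, ← hdw, ← he]
      ext
      simp
    have h2 : clmMatrix (e.symm : 𝔼 →L[ℝ] 𝔼) * clmMatrix (A y) = 1 := by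
      rw [← clmMatrix_comp, ← he]
      rw [e.coe_symm_comp_coe]
      exact clmMatrix_id
    rw [h1, clmMatrix_comp, Matrix.trace_mul_comm, clmMatrix_comp, ← mul_assoc, h2, one_mul,
      clmMatrix_add, Matrix.trace_add]
  -- differentiate the relation between the densities along the field
  have hline : HasDerivAt (fun t : ℝ => y + t • v y) (v y) 0 := by
    simpa using ((hasDerivAt_id (0 : ℝ)).smul_const (v y)).const_add y
  have hy : y + (0 : ℝ) • v y = y := by simp
  have hds : HasDerivAt (fun t : ℝ => s (y + t • v y)) (fderiv ℝ s y (v y)) 0 :=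
    HasFDerivAt.comp_hasDerivAt 0 (by rw [hy]; exact hs.hasFDerivAt) hline
  have hdτ : HasDerivAt (fun t : ℝ => τ (y + t • v y)) (A y (v y)) 0 :=
    HasFDerivAt.comp_hasDerivAt 0 (by rw [hy]; exact hτ1) hline
  have hdσ : HasDerivAt (fun t : ℝ => σ (τ (y + t • v y))) (fderiv ℝ σ (τ y) (A y (v y))) 0 :=
    HasFDerivAt.comp_hasDerivAt 0 (by rw [hy]; exact hσ.hasFDerivAt) hdτ
  have hdA : HasDerivAt (fun t : ℝ => A (y + t • v y)) D 0 :=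
    HasFDerivAt.comp_hasDerivAt 0 (by rw [hy]; exact hAd.hasFDerivAt) hline
  have hddet : HasDerivAt (fun t : ℝ => (A (y + t • v y)).det)
      ((clmMatrix C).trace * (A y).det) 0 := by
    have := hasDerivAt_det_right (A := fun t : ℝ => A (y + t • v y)) (B := C) (t := 0)
      (by rw [hy, hC]; exact hdA)
    rwa [hy] at this
  have hL := hds.pow 2
  have hR := (hddet.pow 2).mul (hdσ.pow 2)
  -- The derivative of the density relation along v says s'/s = tr C + σ'/σ, while tr Dw = tr Dv +
  -- tr C. The trace of C therefore enters both divergences equally. The relation is used in squared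
  -- form because the sign of det Dτ is not controlled.
  have hLR := hL.unique (hR.congr_of_eventuallyEq (by
    have : Filter.Tendsto (fun t : ℝ => y + t • v y) (𝓝 0) (𝓝 y) := by
      have := hline.continuousAt.tendsto
      rwa [hy] at this
    filter_upwards [this.eventually hsσ] with t ht
    simpa using ht))
  have h0 := hsσ.self_of_nhds
  simp only [hy, Nat.cast_ofNat, Pi.pow_apply] at hLR
  rw [hvw.self_of_nhds, htr, add_assoc]
  congr 1
  have e1 : (s y)⁻¹ * fderiv ℝ s y (v y) = (s y * fderiv ℝ s y (v y)) / s y ^ 2 := by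
    field_simp
  rw [e1, h0]
  field_simp
  norm_num at hLR
  linear_combination hLR / 2

end Jacobi

/-! ### The metric, its density and the divergence under change of charts. -/

section Coordinates

variable {n : ℕ} {M : Type*} [TopologicalSpace M] [ChartedSpace (EuclideanSpace ℝ (Fin n)) M]

local notation "𝔼" => EuclideanSpace ℝ (Fin n)

/-- The vector field `u` in the chart centred at `p`. -/
def fieldRep (u : (x : M) → TangentSpace (𝓡 n) x) (p : M) (y : 𝔼) : 𝔼 :=
  chartRep (𝓡 n) p ((extChartAt (𝓡 n) p).symm y) (u ((extChartAt (𝓡 n) p).symm y))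

lemma coordComp_eq (u : (x : M) → TangentSpace (𝓡 n) x) (p : M) (i : Fin n) (y : 𝔼) :
    coordComp u p i y = fieldRep u p y i := rfl

lemma coordBasis_eq (p : M) (i : Fin n) (y : 𝔼) :
    coordBasis p i y = chartVec (𝓡 n) p y (EuclideanSpace.single i 1) := rfl

lemma fieldRep_extChartAt (u : (x : M) → TangentSpace (𝓡 n) x) {p x : M}
    (hx : x ∈ (extChartAt (𝓡 n) p).source) :
    fieldRep u p (extChartAt (𝓡 n) p x) = chartRep (𝓡 n) p x (u x) :=
  congrArg (fun x => chartRep (𝓡 n) p x (u x)) ((extChartAt (𝓡 n) p).left_inv hx)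

variable [IsManifold (𝓡 n) ∞ M]

lemma divergence_eq_densityDiv (g : SmoothMetric n M) (u : (x : M) → TangentSpace (𝓡 n) x) (x : M) :
    divergence g u x = densityDiv (volDensity g x) (fieldRep u x) (extChartAt (𝓡 n) x x) := rfl

lemma contDiffOn_fieldRep {u : (x : M) → TangentSpace (𝓡 n) x} (hu : IsSmoothField u) (p : M) :
    ContDiffOn ℝ ∞ (fieldRep u p) (extChartAt (𝓡 n) p).target :=
  contDiffOn_chartRep hu p

lemma differentiableAt_fieldRep {u : (x : M) → TangentSpace (𝓡 n) x} (hu : IsSmoothField u) {p : M}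
    {y : 𝔼} (hy : y ∈ (extChartAt (𝓡 n) p).target) : DifferentiableAt ℝ (fieldRep u p) y :=
  ((contDiffOn_fieldRep hu p).contDiffAt ((isOpen_extChartAt_target p).mem_nhds hy)).differentiableAt
    (by norm_num)

lemma contMDiffOn_chartVec (p : M) (w : 𝔼) :
    ContMDiffOn 𝓘(ℝ, 𝔼) (𝓡 n).tangent ∞
      (fun y => (⟨(extChartAt (𝓡 n) p).symm y, chartVec (𝓡 n) p y w⟩ : TangentBundle (𝓡 n) M))
      (extChartAt (𝓡 n) p).target := by
  intro y hy
  refine (contMDiffWithinAt_tangentBundle_iff (I := 𝓡 n) (n := ⊤) (p := p)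
    ((extChartAt (𝓡 n) p).map_target hy)).2 ⟨contMDiffOn_extChartAt_symm (n := ∞) p y hy, ?_⟩
  exact contMDiffWithinAt_const.congr (fun z hz => chartRep_chartVec hz w) (chartRep_chartVec hy w)

lemma contDiffOn_inner (g : SmoothMetric n M) (p : M) (v w : 𝔼) :
    ContDiffOn ℝ ∞ (fun y => g.inner ((extChartAt (𝓡 n) p).symm y) (chartVec (𝓡 n) p y v)
      (chartVec (𝓡 n) p y w)) (extChartAt (𝓡 n) p).target := by
  have h1 : IsManifold (𝓡 n) 1 M := isManifold_one_of_infty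
  rw [← contMDiffOn_iff_contDiffOn]
  intro y hy
  have h2 : ContMDiffWithinAt 𝓘(ℝ, 𝔼) ((𝓡 n).prod 𝓘(ℝ)) ∞
      (fun y => Bundle.TotalSpace.mk' ℝ (E := Bundle.Trivial M ℝ) ((extChartAt (𝓡 n) p).symm y)
        (g.inner ((extChartAt (𝓡 n) p).symm y) (chartVec (𝓡 n) p y v) (chartVec (𝓡 n) p y w)))
      (extChartAt (𝓡 n) p).target y := by
    apply ContMDiffWithinAt.clm_bundle_apply₂ (F₁ := 𝔼) (F₂ := 𝔼)
    · exact ContMDiffAt.comp_contMDiffWithinAt y g.contMDiff.contMDiffAt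
        (contMDiffOn_extChartAt_symm p y hy)
    · exact contMDiffOn_chartVec p v y hy
    · exact contMDiffOn_chartVec p w y hy
  simp only [Bundle.contMDiffWithinAt_totalSpace] at h2
  exact h2.2

lemma contDiffOn_metricMatrix (g : SmoothMetric n M) (p : M) (i j : Fin n) :
    ContDiffOn ℝ ∞ (fun y => metricMatrix g p y i j) (extChartAt (𝓡 n) p).target :=
  contDiffOn_inner g p (EuclideanSpace.single i 1) (EuclideanSpace.single j 1)

omit [IsManifold (𝓡 n) ∞ M] in
lemma chartVec_eq_sum (p : M) (y w : 𝔼) :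
    chartVec (𝓡 n) p y w = ∑ i, w i • coordBasis p i y := by
  have h2 : w = ∑ i, w i • EuclideanSpace.single i (1 : ℝ) := by
    ext j
    simp [Finset.sum_apply, Pi.single_apply]
  let L : 𝔼 →L[ℝ] TangentSpace (𝓡 n) ((extChartAt (𝓡 n) p).symm y) :=
    mfderiv 𝓘(ℝ, 𝔼) (𝓡 n) (extChartAt (𝓡 n) p).symm y
  change L w = ∑ i, w i • L (EuclideanSpace.single i 1)
  conv_lhs => rw [h2, map_sum]
  exact Finset.sum_congr rfl fun i _ => map_smul _ _ _

lemma inner_chartVec (g : SmoothMetric n M) (p : M) (y v w : 𝔼) :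
    g.inner ((extChartAt (𝓡 n) p).symm y) (chartVec (𝓡 n) p y v) (chartVec (𝓡 n) p y w)
      = ∑ i, ∑ j, v i * w j * metricMatrix g p y i j := by
  rw [chartVec_eq_sum p y v, chartVec_eq_sum p y w]
  simp only [map_sum, sum_apply, map_smul, smul_apply, smul_eq_mul, Finset.mul_sum]
  rw [Finset.sum_comm]
  refine Finset.sum_congr rfl fun i _ => Finset.sum_congr rfl fun j _ => ?_
  rw [metricMatrix, Matrix.of_apply]
  ring

lemma posDef_metricMatrix (g : SmoothMetric n M) {p : M} {y : 𝔼}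
    (hy : y ∈ (extChartAt (𝓡 n) p).target) : (metricMatrix g p y).PosDef := by
  refine Matrix.PosDef.of_dotProduct_mulVec_pos ?_ ?_
  · ext i j
    simp only [metricMatrix, Matrix.conjTranspose_apply, Matrix.of_apply, star_trivial]
    exact g.symm _ _ _
  · intro x hx
    set v : 𝔼 := WithLp.toLp 2 x
    have hv : chartVec (𝓡 n) p y v ≠ 0 := by
      intro h
      have h1 := chartRep_chartVec (I := 𝓡 n) hy v
      rw [h, chartRep_zero] at h1
      apply hx
      ext i
      exact (congrArg (fun e : 𝔼 => e i) h1).symm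
    have h2 := g.pos _ _ hv
    rw [inner_chartVec] at h2
    convert! h2 using 1
    simp only [star_trivial, dotProduct, Matrix.mulVec, Finset.mul_sum]
    refine Finset.sum_congr rfl fun i _ => Finset.sum_congr rfl fun j _ => ?_
    simp only [v]
    ring

lemma volDensity_pos (g : SmoothMetric n M) {p : M} {y : 𝔼}
    (hy : y ∈ (extChartAt (𝓡 n) p).target) : 0 < volDensity g p y :=
  Real.sqrt_pos.2 (posDef_metricMatrix g hy).det_pos

lemma volDensity_sq (g : SmoothMetric n M) {p : M} {y : 𝔼}
    (hy : y ∈ (extChartAt (𝓡 n) p).target) : volDensity g p y ^ 2 = (metricMatrix g p y).det :=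
  Real.sq_sqrt (posDef_metricMatrix g hy).det_pos.le

lemma contDiffOn_volDensity (g : SmoothMetric n M) (p : M) :
    ContDiffOn ℝ ∞ (volDensity g p) (extChartAt (𝓡 n) p).target := by
  have h : ContDiffOn ℝ ∞ (fun y => (metricMatrix g p y).det) (extChartAt (𝓡 n) p).target := by
    simp only [Matrix.det_apply']
    refine ContDiffOn.sum fun σ _ => contDiffOn_const.mul ?_
    exact contDiffOn_prod fun i _ => contDiffOn_metricMatrix g p (σ i) i
  exact h.sqrt fun y hy => (posDef_metricMatrix g hy).det_pos.ne'

lemma differentiableAt_volDensity (g : SmoothMetric n M) {p : M}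
    {y : 𝔼} (hy : y ∈ (extChartAt (𝓡 n) p).target) : DifferentiableAt ℝ (volDensity g p) y :=
  ((contDiffOn_volDensity g p).contDiffAt ((isOpen_extChartAt_target p).mem_nhds hy)).differentiableAt
    (by norm_num)

/-- The metric in terms of coordinates of tangent vectors. -/
lemma inner_eq_sum (g : SmoothMetric n M) {p x : M} (hx : x ∈ (extChartAt (𝓡 n) p).source)
    (v w : TangentSpace (𝓡 n) x) :
    g.inner x v w = ∑ i, ∑ j, chartRep (𝓡 n) p x v i * chartRep (𝓡 n) p x w j *
      metricMatrix g p (extChartAt (𝓡 n) p x) i j := by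
  obtain ⟨y, hy, rfl⟩ : ∃ y ∈ (extChartAt (𝓡 n) p).target, (extChartAt (𝓡 n) p).symm y = x :=
    ⟨_, (extChartAt (𝓡 n) p).map_source hx, (extChartAt (𝓡 n) p).left_inv hx⟩
  rw [(extChartAt (𝓡 n) p).right_inv hy, ← inner_chartVec, chartVec_chartRep hy,
    chartVec_chartRep hy]

/-- The change of coordinates from the chart centred at `p` to the chart centred at `q`. -/
def transition (p q : M) (y : 𝔼) : 𝔼 := extChartAt (𝓡 n) q ((extChartAt (𝓡 n) p).symm y)

/-- The coordinates in the chart centred at `p` of the points of the domain of the chart centred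
at `q`. -/
def overlap (n : ℕ) {M : Type*} [TopologicalSpace M] [ChartedSpace (EuclideanSpace ℝ (Fin n)) M]
    (p q : M) : Set (EuclideanSpace ℝ (Fin n)) :=
  (extChartAt (𝓡 n) p).target ∩ (extChartAt (𝓡 n) p).symm ⁻¹' (extChartAt (𝓡 n) q).source

omit [IsManifold (𝓡 n) ∞ M] in
lemma isOpen_overlap (p q : M) : IsOpen (overlap n p q) :=
  (continuousOn_extChartAt_symm p).isOpen_inter_preimage (isOpen_extChartAt_target p)
    (isOpen_extChartAt_source q)

omit [IsManifold (𝓡 n) ∞ M] in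
lemma extChartAt_mem_overlap {p q x : M} (hp : x ∈ (extChartAt (𝓡 n) p).source)
    (hq : x ∈ (extChartAt (𝓡 n) q).source) : extChartAt (𝓡 n) p x ∈ overlap n p q :=
  ⟨(extChartAt (𝓡 n) p).map_source hp, by
    rw [Set.mem_preimage, (extChartAt (𝓡 n) p).left_inv hp]; exact hq⟩

omit [IsManifold (𝓡 n) ∞ M] in
lemma symm_transition {p q : M} {y : 𝔼} (hy : y ∈ overlap n p q) :
    (extChartAt (𝓡 n) q).symm (transition p q y) = (extChartAt (𝓡 n) p).symm y :=
  (extChartAt (𝓡 n) q).left_inv hy.2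

omit [IsManifold (𝓡 n) ∞ M] in
lemma transition_mem_overlap {p q : M} {y : 𝔼} (hy : y ∈ overlap n p q) :
    transition p q y ∈ overlap n q p := by
  refine ⟨(extChartAt (𝓡 n) q).map_source hy.2, ?_⟩
  rw [Set.mem_preimage, symm_transition hy]
  exact (extChartAt (𝓡 n) p).map_target hy.1

omit [IsManifold (𝓡 n) ∞ M] in
lemma transition_transition {p q : M} {y : 𝔼} (hy : y ∈ overlap n p q) :
    transition q p (transition p q y) = y := by
  rw [transition, symm_transition hy]
  exact (extChartAt (𝓡 n) p).right_inv hy.1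

lemma contDiffOn_transition (p q : M) : ContDiffOn ℝ ∞ (transition p q) (overlap n p q) := by
  rw [← contMDiffOn_iff_contDiffOn]
  refine ContMDiffOn.comp (t := (extChartAt (𝓡 n) q).source) ?_
    ((contMDiffOn_extChartAt_symm p).mono Set.inter_subset_left) (fun y hy => hy.2)
  rw [extChartAt_source]
  exact contMDiffOn_extChartAt

lemma chartRep_transition {p q : M} {y : 𝔼} (hy : y ∈ overlap n p q)
    (v : TangentSpace (𝓡 n) ((extChartAt (𝓡 n) p).symm y)) :
    chartRep (𝓡 n) q ((extChartAt (𝓡 n) p).symm y) v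
      = fderiv ℝ (transition p q) y (chartRep (𝓡 n) p ((extChartAt (𝓡 n) p).symm y) v) := by
  have h1 : IsManifold (𝓡 n) 1 M := isManifold_one_of_infty
  have hq : MDifferentiableAt (𝓡 n) 𝓘(ℝ, 𝔼) (extChartAt (𝓡 n) q)
      ((extChartAt (𝓡 n) p).symm y) := by
    apply mdifferentiableAt_extChartAt
    rw [← extChartAt_source (𝓡 n)]
    exact hy.2
  have h2 := hq.hasMFDerivAt.comp y
    ((contMDiffAt_extChartAt_symm hy.1).mdifferentiableAt (by norm_num)).hasMFDerivAt
  let D : 𝔼 →L[ℝ] 𝔼 := (mfderiv (𝓡 n) 𝓘(ℝ, 𝔼) (extChartAt (𝓡 n) q)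
    ((extChartAt (𝓡 n) p).symm y)).comp (mfderiv 𝓘(ℝ, 𝔼) (𝓡 n) (extChartAt (𝓡 n) p).symm y)
  have h3 : HasFDerivAt (transition p q) D y := h2.hasFDerivAt
  rw [h3.fderiv]
  conv_lhs => rw [← chartVec_chartRep hy.1 v]
  rfl

lemma fieldRep_transition (u : (x : M) → TangentSpace (𝓡 n) x) {p q : M} {y : 𝔼}
    (hy : y ∈ overlap n p q) :
    fieldRep u q (transition p q y) = fderiv ℝ (transition p q) y (fieldRep u p y) :=
  (fieldRep_extChartAt u hy.2).trans (chartRep_transition hy _)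

lemma metricMatrix_transition (g : SmoothMetric n M) {p q : M} {y : 𝔼} (hy : y ∈ overlap n p q) :
    metricMatrix g p y = (clmMatrix (fderiv ℝ (transition p q) y)).transpose *
      metricMatrix g q (transition p q y) * clmMatrix (fderiv ℝ (transition p q) y) := by
  ext i j
  rw [metricMatrix, Matrix.of_apply, inner_eq_sum g hy.2]
  simp only [chartRep_transition hy, coordBasis_eq, chartRep_chartVec hy.1, Matrix.mul_apply,
    Matrix.transpose_apply, clmMatrix_apply, Finset.sum_mul]
  rw [Finset.sum_comm]
  refine Finset.sum_congr rfl fun k _ => Finset.sum_congr rfl fun l _ => ?_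
  rw [transition]
  ring

lemma volDensity_sq_transition (g : SmoothMetric n M) {p q : M} {y : 𝔼} (hy : y ∈ overlap n p q) :
    volDensity g p y ^ 2 = (fderiv ℝ (transition p q) y).det ^ 2 *
      volDensity g q (transition p q y) ^ 2 := by
  rw [volDensity_sq g hy.1, volDensity_sq g (transition_mem_overlap hy).1,
    metricMatrix_transition g hy, Matrix.det_mul, Matrix.det_mul, Matrix.det_transpose,
    det_clmMatrix]
  ring

/-- The divergence can be computed in any chart. -/
theorem divergence_eq_chart (g : SmoothMetric n M) {u : (x : M) → TangentSpace (𝓡 n) x}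
    (hu : IsSmoothField u) {p x : M} (hx : x ∈ (extChartAt (𝓡 n) p).source) :
    divergence g u x = densityDiv (volDensity g p) (fieldRep u p) (extChartAt (𝓡 n) p x) := by
  have hxx : x ∈ (extChartAt (𝓡 n) x).source := mem_extChartAt_source x
  have ho := extChartAt_mem_overlap hxx hx
  have hnhds := (isOpen_overlap x p).mem_nhds ho
  have hτ : transition x p (extChartAt (𝓡 n) x x) = extChartAt (𝓡 n) p x := by
    rw [transition, (extChartAt (𝓡 n) x).left_inv hxx]
  rw [divergence_eq_densityDiv, ← hτ]
  refine densityDiv_comp ((contDiffOn_transition x p).contDiffAt hnhds)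
    (differentiableAt_volDensity g ho.1)
    (differentiableAt_volDensity g (transition_mem_overlap ho).1)
    (differentiableAt_fieldRep hu ho.1) (differentiableAt_fieldRep hu (transition_mem_overlap ho).1)
    (volDensity_pos g ho.1).ne' ?_ ?_
  · filter_upwards [hnhds] with z hz
    exact fieldRep_transition u hz
  · filter_upwards [hnhds] with z hz
    exact volDensity_sq_transition g hz

end Coordinates

/-! ### Product rules for the divergence; its smoothness in time and space. -/

section DivergenceCalculus

variable {n : ℕ}

local notation "𝔼" => EuclideanSpace ℝ (Fin n)

lemma densityDiv_add {s : 𝔼 → ℝ} {v w : 𝔼 → 𝔼} {y : 𝔼} (hs : DifferentiableAt ℝ s y)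
    (hv : DifferentiableAt ℝ v y) (hw : DifferentiableAt ℝ w y) (h0 : s y ≠ 0) :
    densityDiv s (fun z => v z + w z) y = densityDiv s v y + densityDiv s w y := by
  rw [densityDiv_eq hs (hv.fun_add hw) h0, densityDiv_eq hs hv h0, densityDiv_eq hs hw h0,
    fderiv_fun_add hv hw, clmMatrix_add, Matrix.trace_add, map_add]
  ring

lemma densityDiv_mul {s f : 𝔼 → ℝ} {v : 𝔼 → 𝔼} {y : 𝔼} (hs : DifferentiableAt ℝ s y)
    (hf : DifferentiableAt ℝ f y) (hv : DifferentiableAt ℝ v y) (h0 : s y ≠ 0) :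
    densityDiv s (fun z => f z • v z) y = f y * densityDiv s v y + fderiv ℝ f y (v y) := by
  have h1 : (fun i => fun z => s z * (f z • v z) i) = fun i => fun z => (f z * s z) * v z i := by
    ext i z
    simp
    ring
  have h2 := sum_partialDeriv_mul (hf.mul hs) hv
  have h3 : densityDiv s (fun z => f z • v z) y
      = (s y)⁻¹ * ∑ i, partialDeriv i (fun z => (f z * s z) * v z i) y := by
    unfold densityDiv
    congr 1
    exact Finset.sum_congr rfl fun i _ => by rw [← congrFun h1 i]
  rw [h3]
  change (s y)⁻¹ * ∑ i, partialDeriv i (fun z => (f * s) z * v z i) y = _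
  rw [h2, densityDiv_eq hs hv h0, fderiv_mul hf hs]
  simp only [Pi.mul_apply, add_apply, smul_apply, smul_eq_mul]
  field_simp
  ring

/-- Expanding by the Leibniz rule leaves only first derivatives of F and s. Derivatives are taken
within S × Ω because S will be [0, T), which is not open; since Ω is open, their spatial part is
still the full derivative of each time slice. -/
lemma contDiffOn_densityDiv {F : ℝ × 𝔼 → 𝔼} {s : 𝔼 → ℝ} {S : Set ℝ} {Ω : Set 𝔼}
    (hS : UniqueDiffOn ℝ S) (hΩ : IsOpen Ω) (hF : ContDiffOn ℝ ∞ F (S ×ˢ Ω))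
    (hs : ContDiffOn ℝ ∞ s Ω) (hs0 : ∀ y ∈ Ω, s y ≠ 0) :
    ContDiffOn ℝ ∞ (fun z : ℝ × 𝔼 => densityDiv s (fun y => F (z.1, y)) z.2) (S ×ˢ Ω) := by
  have hU : UniqueDiffOn ℝ (S ×ˢ Ω) := hS.prod hΩ.uniqueDiffOn
  have hd : ContDiffOn ℝ ∞ (fderivWithin ℝ F (S ×ˢ Ω)) (S ×ˢ Ω) :=
    hF.fderivWithin hU (by simp)
  have hds : ContDiffOn ℝ ∞ (fun z : ℝ × 𝔼 => fderiv ℝ s z.2) (S ×ˢ Ω) :=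
    (hs.fderiv_of_isOpen hΩ (by simp)).comp contDiffOn_snd (fun z hz => hz.2)
  have hs2 : ContDiffOn ℝ ∞ (fun z : ℝ × 𝔼 => s z.2) (S ×ˢ Ω) :=
    hs.comp contDiffOn_snd (fun z hz => hz.2)
  have key : ∀ z ∈ S ×ˢ Ω, HasFDerivAt (fun y => F (z.1, y))
      (fderivWithin ℝ F (S ×ˢ Ω) z ∘L ContinuousLinearMap.inr ℝ ℝ 𝔼) z.2 := by
    rintro ⟨t, y⟩ ⟨ht, hy⟩
    have h1 := ((hF.differentiableOn (by norm_num)) (t, y) ⟨ht, hy⟩).hasFDerivWithinAt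
    have h2 : HasFDerivWithinAt (fun y : 𝔼 => (t, y)) (ContinuousLinearMap.inr ℝ ℝ 𝔼) Ω y :=
      (hasFDerivAt_prodMk_right t y).hasFDerivWithinAt
    exact (h1.comp y h2 (fun y' hy' => ⟨ht, hy'⟩)).hasFDerivAt (hΩ.mem_nhds hy)
  have heq : ∀ z ∈ S ×ˢ Ω, densityDiv s (fun y => F (z.1, y)) z.2
      = ∑ i, fderivWithin ℝ F (S ×ˢ Ω) z (0, EuclideanSpace.single i 1) i
        + (s z.2)⁻¹ * fderiv ℝ s z.2 (F z) := by
    intro z hz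
    rw [densityDiv_eq ((hs.contDiffAt (hΩ.mem_nhds hz.2)).differentiableAt (by norm_num))
      (key z hz).differentiableAt (hs0 _ hz.2), (key z hz).fderiv, trace_clmMatrix]
    rfl
  refine ContDiffOn.congr ?_ heq
  refine ContDiffOn.add (ContDiffOn.sum fun i _ => ?_) ?_
  · exact (EuclideanSpace.proj (𝕜 := ℝ) i : 𝔼 →L[ℝ] ℝ).contDiff.comp_contDiffOn
      (hd.clm_apply contDiffOn_const)
  · exact (hs2.inv fun z hz => hs0 _ hz.2).mul (hds.clm_apply hF)

variable {M : Type*} [TopologicalSpace M] [ChartedSpace (EuclideanSpace ℝ (Fin n)) M]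
  [IsManifold (𝓡 n) ∞ M]

/-- A function on `ℝ × M` is smooth if it is smooth in coordinates on `M`. -/
lemma contMDiffWithinAt_of_chart {F : Type*} [NormedAddCommGroup F] [NormedSpace ℝ F]
    {f : ℝ × M → F} {h : ℝ × 𝔼 → F} {S : Set ℝ} {p : M}
    (hh : ContDiffOn ℝ ∞ h (S ×ˢ (extChartAt (𝓡 n) p).target))
    (heq : ∀ t ∈ S, ∀ x ∈ (extChartAt (𝓡 n) p).source, f (t, x) = h (t, extChartAt (𝓡 n) p x))
    {t : ℝ} {x : M} (ht : t ∈ S) (hx : x ∈ (extChartAt (𝓡 n) p).source) :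
    ContMDiffWithinAt (𝓘(ℝ, ℝ).prod (𝓡 n)) 𝓘(ℝ, F) ∞ f (S ×ˢ Set.univ) (t, x) := by
  have h1 : ContMDiffOn (𝓘(ℝ, ℝ).prod (𝓡 n)) (𝓘(ℝ, ℝ).prod 𝓘(ℝ, 𝔼)) ∞
      (fun z : ℝ × M => (z.1, extChartAt (𝓡 n) p z.2)) (S ×ˢ (extChartAt (𝓡 n) p).source) :=
    contMDiffOn_fst.prodMk
      ((contMDiffOn_extChartAt (x := p)).comp contMDiffOn_snd fun z hz => by
        have h3 := hz.2
        rwa [extChartAt_source] at h3)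
  have h2 : ContMDiffOn (𝓘(ℝ, ℝ).prod 𝓘(ℝ, 𝔼)) 𝓘(ℝ, F) ∞ h
      (S ×ˢ (extChartAt (𝓡 n) p).target) := by
    have h5 := contMDiffOn_iff_contDiffOn.2 hh
    rw [modelWithCornersSelf_prod, ← chartedSpaceSelf_prod] at h5
    exact h5
  have h3 := h2.comp h1 fun z hz => ⟨hz.1, (extChartAt (𝓡 n) p).map_source hz.2⟩
  have h4 : ContMDiffOn (𝓘(ℝ, ℝ).prod (𝓡 n)) 𝓘(ℝ, F) ∞ f
      (S ×ˢ (extChartAt (𝓡 n) p).source) := h3.congr fun z hz => heq z.1 hz.1 z.2 hz.2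
  refine (h4 (t, x) ⟨ht, hx⟩).mono_of_mem_nhdsWithin ?_
  have hsrc : ∀ᶠ z : ℝ × M in 𝓝[S ×ˢ Set.univ] (t, x), z.2 ∈ (extChartAt (𝓡 n) p).source :=
    nhdsWithin_le_nhds (continuous_snd.continuousAt
      ((isOpen_extChartAt_source p).mem_nhds hx))
  filter_upwards [hsrc, self_mem_nhdsWithin] with z hz1 hz2
  exact ⟨hz2.1, hz1⟩

/-- Smoothness of a time-dependent vector field over the set `S` of times. -/
def IsSmoothFamily (S : Set ℝ) (u : ℝ → (x : M) → TangentSpace (𝓡 n) x) : Prop :=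
  ContMDiffOn (𝓘(ℝ, ℝ).prod (𝓡 n)) (𝓡 n).tangent ∞
    (fun q : ℝ × M => (⟨q.2, u q.1 q.2⟩ : TangentBundle (𝓡 n) M)) (S ×ˢ Set.univ)

lemma isSmoothFamily_iff {S : Set ℝ} {u : ℝ → (x : M) → TangentSpace (𝓡 n) x} :
    IsSmoothFamily S u ↔ ∀ p : M, ContDiffOn ℝ ∞ (fun z : ℝ × 𝔼 => fieldRep (u z.1) p z.2)
      (S ×ˢ (extChartAt (𝓡 n) p).target) := by
  constructor
  · intro hu p
    have h1 : ContMDiffOn (𝓘(ℝ, ℝ).prod 𝓘(ℝ, 𝔼)) (𝓘(ℝ, ℝ).prod (𝓡 n)) ∞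
        (fun z : ℝ × 𝔼 => (z.1, (extChartAt (𝓡 n) p).symm z.2))
        (S ×ˢ (extChartAt (𝓡 n) p).target) :=
      contMDiffOn_fst.prodMk ((contMDiffOn_extChartAt_symm p).comp contMDiffOn_snd fun z hz => hz.2)
    have h2 := hu.comp h1 (fun z hz => ⟨hz.1, Set.mem_univ _⟩)
    have h3 : ContMDiffOn (𝓘(ℝ, ℝ).prod 𝓘(ℝ, 𝔼)) 𝓘(ℝ, 𝔼) ∞
        (fun z : ℝ × 𝔼 => fieldRep (u z.1) p z.2) (S ×ˢ (extChartAt (𝓡 n) p).target) := fun z hz =>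
      ((contMDiffWithinAt_tangentBundle_iff (I := 𝓡 n) (n := ⊤) (p := p)
        (b := fun z : ℝ × 𝔼 => (extChartAt (𝓡 n) p).symm z.2)
        (u := fun z => u z.1 ((extChartAt (𝓡 n) p).symm z.2)) (q₀ := z)
        ((extChartAt (𝓡 n) p).map_target hz.2)).1 (h2 z hz)).2
    rw [← contMDiffOn_iff_contDiffOn, modelWithCornersSelf_prod, ← chartedSpaceSelf_prod]
    exact h3
  · rintro hu ⟨t, x⟩ ⟨ht, -⟩
    refine (contMDiffWithinAt_tangentBundle_iff (I := 𝓡 n) (n := ⊤) (p := x)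
      (mem_extChartAt_source x)).2 ⟨contMDiffWithinAt_snd, ?_⟩
    exact contMDiffWithinAt_of_chart (hu x) (fun t _ x' hx' => (fieldRep_extChartAt (u t) hx').symm)
      ht (mem_extChartAt_source x)

lemma IsSmoothFamily.mono {S S' : Set ℝ} {u : ℝ → (x : M) → TangentSpace (𝓡 n) x}
    (hu : IsSmoothFamily S u) (h : S' ⊆ S) : IsSmoothFamily S' u :=
  ContMDiffOn.mono hu (Set.prod_mono_left h)

lemma IsSmoothFamily.isSmoothField {S : Set ℝ} {u : ℝ → (x : M) → TangentSpace (𝓡 n) x}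
    (hu : IsSmoothFamily S u) {t : ℝ} (ht : t ∈ S) : IsSmoothField (u t) := by
  have h1 : ContMDiff (𝓡 n) (𝓘(ℝ, ℝ).prod (𝓡 n)) ∞ (fun x : M => (t, x)) :=
    contMDiff_const.prodMk contMDiff_id
  exact ContMDiffOn.comp_contMDiff hu h1 fun x => ⟨ht, Set.mem_univ _⟩

lemma IsSmoothField.isSmoothFamily {u : (x : M) → TangentSpace (𝓡 n) x} (hu : IsSmoothField u)
    (S : Set ℝ) : IsSmoothFamily S fun _ => u :=
  (ContMDiff.comp hu contMDiff_snd).contMDiffOn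

/-- The divergence of a smooth time-dependent field is smooth in time and space. -/
theorem IsSmoothFamily.contMDiffOn_divergence (g : SmoothMetric n M) {S : Set ℝ}
    (hS : UniqueDiffOn ℝ S) {u : ℝ → (x : M) → TangentSpace (𝓡 n) x} (hu : IsSmoothFamily S u) :
    ContMDiffOn (𝓘(ℝ, ℝ).prod (𝓡 n)) 𝓘(ℝ, ℝ) ∞ (fun z : ℝ × M => divergence g (u z.1) z.2)
      (S ×ˢ Set.univ) := by
  rintro ⟨t, x⟩ ⟨ht, -⟩
  exact contMDiffWithinAt_of_chart (contDiffOn_densityDiv hS (isOpen_extChartAt_target x)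
    (isSmoothFamily_iff.1 hu x) (contDiffOn_volDensity g x) fun y hy => (volDensity_pos g hy).ne')
    (fun t ht x' hx' => divergence_eq_chart g (hu.isSmoothField ht) hx') ht
    (mem_extChartAt_source x)

lemma contMDiff_divergence (g : SmoothMetric n M) {u : (x : M) → TangentSpace (𝓡 n) x}
    (hu : IsSmoothField u) : ContMDiff (𝓡 n) 𝓘(ℝ, ℝ) ∞ (divergence g u) := by
  have h1 : ContMDiff (𝓡 n) (𝓘(ℝ, ℝ).prod (𝓡 n)) ∞ (fun x : M => ((0 : ℝ), x)) :=
    contMDiff_const.prodMk contMDiff_id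
  have h5 : IsSmoothFamily Set.univ (fun _ : ℝ => u) := hu.isSmoothFamily Set.univ
  have h2 := h5.contMDiffOn_divergence g uniqueDiffOn_univ
  have h3 := h2.comp h1.contMDiffOn fun x (_ : x ∈ Set.univ) => ⟨Set.mem_univ _, Set.mem_univ _⟩
  exact contMDiffOn_univ.1 h3

lemma contDiffOn_comp_symm {f : M → ℝ} (hf : ContMDiff (𝓡 n) 𝓘(ℝ, ℝ) ∞ f) (p : M) :
    ContDiffOn ℝ ∞ (fun y => f ((extChartAt (𝓡 n) p).symm y)) (extChartAt (𝓡 n) p).target := by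
  rw [← contMDiffOn_iff_contDiffOn]
  exact hf.comp_contMDiffOn (contMDiffOn_extChartAt_symm p)

lemma dirDeriv_eq_chart {f : M → ℝ} {p x : M} (hf : MDifferentiableAt (𝓡 n) 𝓘(ℝ, ℝ) f x)
    (hx : x ∈ (extChartAt (𝓡 n) p).source) (v : TangentSpace (𝓡 n) x) :
    dirDeriv f x v = fderiv ℝ (fun y => f ((extChartAt (𝓡 n) p).symm y)) (extChartAt (𝓡 n) p x)
      (chartRep (𝓡 n) p x v) := by
  obtain ⟨y, hy, rfl⟩ : ∃ y ∈ (extChartAt (𝓡 n) p).target, (extChartAt (𝓡 n) p).symm y = x :=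
    ⟨_, (extChartAt (𝓡 n) p).map_source hx, (extChartAt (𝓡 n) p).left_inv hx⟩
  rw [(extChartAt (𝓡 n) p).right_inv hy]
  have h2 := hf.hasMFDerivAt.comp y
    ((contMDiffAt_extChartAt_symm hy).mdifferentiableAt (by norm_num)).hasMFDerivAt
  let D : 𝔼 →L[ℝ] ℝ := (mfderiv (𝓡 n) 𝓘(ℝ, ℝ) f ((extChartAt (𝓡 n) p).symm y)).comp
    (mfderiv 𝓘(ℝ, 𝔼) (𝓡 n) (extChartAt (𝓡 n) p).symm y)
  have h3 : HasFDerivAt (fun y => f ((extChartAt (𝓡 n) p).symm y)) D y := h2.hasFDerivAt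
  rw [h3.fderiv]
  conv_lhs => rw [← chartVec_chartRep hy v]
  rfl

lemma isSmoothField_smul {f : M → ℝ} (hf : ContMDiff (𝓡 n) 𝓘(ℝ, ℝ) ∞ f)
    {u : (x : M) → TangentSpace (𝓡 n) x} (hu : IsSmoothField u) :
    IsSmoothField fun x => f x • u x := by
  intro x
  have h1 := ((contMDiffWithinAt_tangentBundle_iff (I := 𝓡 n) (n := ⊤) (p := x) (s := Set.univ)
    (mem_extChartAt_source x)).1 (hu x)).2
  refine (contMDiffWithinAt_tangentBundle_iff (I := 𝓡 n) (n := ⊤) (p := x)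
      (mem_extChartAt_source x)).2 ⟨contMDiffWithinAt_id, ?_⟩
  simp only [chartRep_smul]
  exact (hf x).contMDiffWithinAt.smul h1

lemma isSmoothField_add {u w : (x : M) → TangentSpace (𝓡 n) x} (hu : IsSmoothField u)
    (hw : IsSmoothField w) : IsSmoothField fun x => u x + w x := by
  intro x
  have h1 := ((contMDiffWithinAt_tangentBundle_iff (I := 𝓡 n) (n := ⊤) (p := x) (s := Set.univ)
    (mem_extChartAt_source x)).1 (hu x)).2
  have h2 := ((contMDiffWithinAt_tangentBundle_iff (I := 𝓡 n) (n := ⊤) (p := x) (s := Set.univ)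
    (mem_extChartAt_source x)).1 (hw x)).2
  refine (contMDiffWithinAt_tangentBundle_iff (I := 𝓡 n) (n := ⊤) (p := x)
      (mem_extChartAt_source x)).2 ⟨contMDiffWithinAt_id, ?_⟩
  simp only [chartRep_add]
  exact h1.add h2

lemma isSmoothField_zero : IsSmoothField (fun x : M => (0 : TangentSpace (𝓡 n) x)) := by
  intro x
  refine (contMDiffWithinAt_tangentBundle_iff (I := 𝓡 n) (n := ⊤) (p := x)
      (mem_extChartAt_source x)).2 ⟨contMDiffWithinAt_id, ?_⟩
  simp only [chartRep_zero]
  exact contMDiffWithinAt_const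

lemma divergence_smul (g : SmoothMetric n M) {f : M → ℝ} (hf : ContMDiff (𝓡 n) 𝓘(ℝ, ℝ) ∞ f)
    {u : (x : M) → TangentSpace (𝓡 n) x} (hu : IsSmoothField u) (x : M) :
    divergence g (fun x => f x • u x) x = f x * divergence g u x + dirDeriv f x (u x) := by
  have hy := mem_extChartAt_target (I := 𝓡 n) x
  have h1 : fieldRep (fun x => f x • u x) x
      = fun y => f ((extChartAt (𝓡 n) x).symm y) • fieldRep u x y := by
    ext1 y
    exact chartRep_smul _ _ _ _
  rw [divergence_eq_densityDiv, h1, densityDiv_mul (differentiableAt_volDensity g hy)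
    (((contDiffOn_comp_symm hf x).contDiffAt
      ((isOpen_extChartAt_target x).mem_nhds hy)).differentiableAt (by norm_num))
    (differentiableAt_fieldRep hu hy) (volDensity_pos g hy).ne', ← divergence_eq_densityDiv,
    dirDeriv_eq_chart (hf.mdifferentiableAt (by norm_num)) (mem_extChartAt_source x),
    fieldRep_extChartAt u (mem_extChartAt_source x),
    (extChartAt (𝓡 n) x).left_inv (mem_extChartAt_source x)]

lemma divergence_add (g : SmoothMetric n M) {u w : (x : M) → TangentSpace (𝓡 n) x}
    (hu : IsSmoothField u) (hw : IsSmoothField w) (x : M) :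
    divergence g (fun x => u x + w x) x = divergence g u x + divergence g w x := by
  have hy := mem_extChartAt_target (I := 𝓡 n) x
  have h1 : fieldRep (fun x => u x + w x) x = fun y => fieldRep u x y + fieldRep w x y := by
    ext1 y
    exact chartRep_add _ _ _ _
  rw [divergence_eq_densityDiv, h1, densityDiv_add (differentiableAt_volDensity g hy)
    (differentiableAt_fieldRep hu hy) (differentiableAt_fieldRep hw hy) (volDensity_pos g hy).ne']
  rfl

lemma divergence_const_smul (g : SmoothMetric n M) (c : ℝ) {u : (x : M) → TangentSpace (𝓡 n) x}
    (hu : IsSmoothField u) (x : M) :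
    divergence g (fun x => c • u x) x = c * divergence g u x := by
  rw [divergence_smul g contMDiff_const hu, dirDeriv, mfderiv_const]
  exact add_zero _

lemma divergence_zero (g : SmoothMetric n M) (x : M) :
    divergence g (fun x => (0 : TangentSpace (𝓡 n) x)) x = 0 := by
  have h := divergence_const_smul g 0 (isSmoothField_zero (n := n) (M := M)) x
  rw [zero_mul] at h
  have h2 : (fun x : M => (0 : ℝ) • (0 : TangentSpace (𝓡 n) x)) = fun x => 0 := by
    ext1 x
    exact zero_smul ℝ _
  rwa [h2] at h

lemma isSmoothField_sum {ι : Type*} (t : Finset ι) {u : ι → (x : M) → TangentSpace (𝓡 n) x}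
    (hu : ∀ i ∈ t, IsSmoothField (u i)) : IsSmoothField fun x => ∑ i ∈ t, u i x := by
  classical
  induction t using Finset.induction_on with
  | empty =>
    simp only [Finset.sum_empty]
    exact isSmoothField_zero
  | insert a t ha ih =>
    simp only [Finset.sum_insert ha]
    exact isSmoothField_add (hu a (Finset.mem_insert_self _ _))
      (ih fun i hi => hu i (Finset.mem_insert_of_mem hi))

lemma divergence_sum (g : SmoothMetric n M) {ι : Type*} (t : Finset ι)
    {u : ι → (x : M) → TangentSpace (𝓡 n) x} (hu : ∀ i ∈ t, IsSmoothField (u i)) (x : M) :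
    divergence g (fun x => ∑ i ∈ t, u i x) x = ∑ i ∈ t, divergence g (u i) x := by
  classical
  induction t using Finset.induction_on with
  | empty =>
    simp only [Finset.sum_empty]
    exact divergence_zero g x
  | insert a t ha ih =>
    simp only [Finset.sum_insert ha]
    rw [divergence_add g (hu a (Finset.mem_insert_self _ _))
      (isSmoothField_sum t fun i hi => hu i (Finset.mem_insert_of_mem hi)),
      ih fun i hi => hu i (Finset.mem_insert_of_mem hi)]

end DivergenceCalculus

/-! ### The divergence is controlled by the covariant derivative. -/

section NormBound

open scoped MatrixOrder Matrix.Norms.L2Operator in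

-- Factor G = BᵀB and conjugate to D = (Bᵀ)⁻¹ C Bᵀ, that is, pass to an orthonormal frame. The trace
-- is unchanged and the quadruple sum becomes tr(DDᵀ), the sum of the squares of all entries of D.
-- Cauchy–Schwarz on the diagonal concludes.
lemma sq_trace_le {ι : Type*} [Fintype ι] [DecidableEq ι] {G : Matrix ι ι ℝ} (hG : G.PosDef)
    (C : Matrix ι ι ℝ) :
    C.trace ^ 2 ≤ Fintype.card ι * ∑ i, ∑ j, ∑ k, ∑ l, G⁻¹ i j * G k l * C i k * C j l := by
  obtain ⟨B, hB⟩ : ∃ B : Matrix ι ι ℝ, G = B.transpose * B := by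
    obtain ⟨B, hB⟩ := CStarAlgebra.nonneg_iff_eq_star_mul_self.mp hG.posSemidef.nonneg
    exact ⟨B, by rw [hB, Matrix.star_eq_conjTranspose, Matrix.conjTranspose_eq_transpose_of_trivial]⟩
  have hdet : IsUnit B.det := by
    have h1 := hG.det_pos
    rw [hB, Matrix.det_mul, Matrix.det_transpose] at h1
    exact isUnit_iff_ne_zero.2 fun h => by simp [h] at h1
  have hdetT : IsUnit B.transpose.det := by rwa [Matrix.det_transpose]
  set D := B.transpose⁻¹ * C * B.transpose with hD
  have htr : D.trace = C.trace := by
    rw [hD, Matrix.trace_mul_comm, ← mul_assoc, Matrix.mul_nonsing_inv _ hdetT, one_mul]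
  have hsum : ∑ i, ∑ j, ∑ k, ∑ l, G⁻¹ i j * G k l * C i k * C j l = (D * D.transpose).trace := by
    have h1 : (D * D.transpose).trace = (G⁻¹ * (C * G * C.transpose)).trace := by
      rw [hD, hB, Matrix.mul_inv_rev, Matrix.transpose_mul, Matrix.transpose_mul,
        Matrix.transpose_nonsing_inv, Matrix.transpose_transpose]
      rw [← mul_assoc, ← mul_assoc, Matrix.trace_mul_comm]
      simp only [mul_assoc]
    have h2 : (G⁻¹).transpose = G⁻¹ := by
      rw [hB, Matrix.transpose_nonsing_inv, Matrix.transpose_mul, Matrix.transpose_transpose]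
    rw [h1, ← Matrix.trace_transpose, Matrix.transpose_mul, h2, Matrix.trace_mul_comm]
    simp only [Matrix.trace, Matrix.diag, Matrix.mul_apply, Matrix.transpose_apply,
      Finset.mul_sum, Finset.sum_mul]
    refine Finset.sum_congr rfl fun i _ => Finset.sum_congr rfl fun j _ => ?_
    rw [Finset.sum_comm]
    refine Finset.sum_congr rfl fun k _ => Finset.sum_congr rfl fun l _ => ?_
    ring
  rw [hsum, ← htr, Matrix.trace, Matrix.trace]
  refine (sq_sum_le_card_mul_sum_sq).trans ?_
  rw [Finset.card_univ]
  refine mul_le_mul_of_nonneg_left (Finset.sum_le_sum fun i _ => ?_) (Nat.cast_nonneg _)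
  simp only [Matrix.diag_apply, Matrix.mul_apply, Matrix.transpose_apply, ← pow_two]
  exact Finset.single_le_sum (f := fun j => D i j ^ 2) (fun j _ => sq_nonneg _) (Finset.mem_univ i)

variable {n : ℕ}

local notation "𝔼" => EuclideanSpace ℝ (Fin n)

variable {M : Type*} [TopologicalSpace M] [ChartedSpace (EuclideanSpace ℝ (Fin n)) M]
  [IsManifold (𝓡 n) ∞ M]

lemma metricMatrix_symm (g : SmoothMetric n M) (p : M) (i j : Fin n) :
    (fun z => metricMatrix g p z i j) = fun z => metricMatrix g p z j i := by
  ext z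
  exact g.symm _ _ _

/-- In the contraction the first and third metric derivatives cancel, since g^{il} is symmetric.
What remains is ½ tr(G⁻¹ ∂_j G), the logarithmic derivative of √det G by Jacobi's formula. -/
lemma sum_christoffel (g : SmoothMetric n M) {p : M} {y : 𝔼} (hy : y ∈ (extChartAt (𝓡 n) p).target)
    (j : Fin n) :
    ∑ i, christoffel g p i i j y = (volDensity g p y)⁻¹ * partialDeriv j (volDensity g p) y := by
  have hG := posDef_metricMatrix g hy
  have hs := volDensity_pos g hy
  have hinv : ∀ i l, (metricMatrix g p y)⁻¹ i l = (metricMatrix g p y)⁻¹ l i := fun i l => by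
    have h := hG.isHermitian.inv.apply l i
    simpa using h
  have h1 : ∑ i, christoffel g p i i j y = (1 / 2) * ∑ i, ∑ l, (metricMatrix g p y)⁻¹ i l *
      partialDeriv j (fun z => metricMatrix g p z l i) y := by
    have h2 : ∑ i, ∑ l, (metricMatrix g p y)⁻¹ i l *
        partialDeriv i (fun z => metricMatrix g p z j l) y
        = ∑ i, ∑ l, (metricMatrix g p y)⁻¹ i l *
        partialDeriv l (fun z => metricMatrix g p z i j) y := by
      rw [Finset.sum_comm]
      refine Finset.sum_congr rfl fun i _ => Finset.sum_congr rfl fun l _ => ?_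
      rw [hinv l i, metricMatrix_symm g p j i]
    simp only [christoffel, ← Finset.mul_sum]
    congr 1
    have h3 : ∀ i l, (metricMatrix g p y)⁻¹ i l *
        (partialDeriv i (fun z => metricMatrix g p z j l) y
          + partialDeriv j (fun z => metricMatrix g p z i l) y
          - partialDeriv l (fun z => metricMatrix g p z i j) y)
        = (metricMatrix g p y)⁻¹ i l * partialDeriv i (fun z => metricMatrix g p z j l) y
          + (metricMatrix g p y)⁻¹ i l * partialDeriv j (fun z => metricMatrix g p z l i) y
          - (metricMatrix g p y)⁻¹ i l * partialDeriv l (fun z => metricMatrix g p z i j) y :=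
      fun i l => by rw [metricMatrix_symm g p i l]; ring
    simp only [h3, Finset.sum_sub_distrib, Finset.sum_add_distrib]
    rw [h2]
    ring
  have hdiff : ∀ i l, DifferentiableAt ℝ (fun z => metricMatrix g p z i l) y := fun i l =>
    ((contDiffOn_metricMatrix g p i l).contDiffAt
      ((isOpen_extChartAt_target p).mem_nhds hy)).differentiableAt (by norm_num)
  have hline : HasDerivAt (fun r : ℝ => y + r • (EuclideanSpace.single j (1 : ℝ) : 𝔼))
      (EuclideanSpace.single j 1) 0 := by
    simpa using ((hasDerivAt_id (0 : ℝ)).smul_const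
      (EuclideanSpace.single j (1 : ℝ) : 𝔼)).const_add y
  have hy0 : y + (0 : ℝ) • (EuclideanSpace.single j (1 : ℝ) : 𝔼) = y := by simp
  have hM : ∀ i l, HasDerivAt
      (fun r : ℝ => metricMatrix g p (y + r • (EuclideanSpace.single j (1 : ℝ) : 𝔼)) i l)
      (partialDeriv j (fun z => metricMatrix g p z i l) y) 0 := fun i l => by
    have h := (hdiff i l).hasFDerivAt
    rw [← hy0] at h
    have h' := h.comp_hasDerivAt (0 : ℝ) hline
    rw [hy0] at h'
    exact h'
  have hdet := hasDerivAt_matrix_det (M' := Matrix.of fun i l =>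
    partialDeriv j (fun z => metricMatrix g p z i l) y) hM
  have hvol : HasDerivAt (fun r : ℝ =>
      volDensity g p (y + r • (EuclideanSpace.single j (1 : ℝ) : 𝔼)))
      (partialDeriv j (volDensity g p) y) 0 := by
    have h := (differentiableAt_volDensity g hy).hasFDerivAt
    rw [← hy0] at h
    have h' := h.comp_hasDerivAt (0 : ℝ) hline
    rw [hy0] at h'
    exact h'
  -- Differentiating s² = det G along a coordinate line gives 2 s ∂_j s = det G · tr(G⁻¹ ∂_j G),
  -- with no derivative of the square root.
  have hsq : (fun r : ℝ =>
      volDensity g p (y + r • (EuclideanSpace.single j (1 : ℝ) : 𝔼)) ^ 2) =ᶠ[𝓝 0] fun r =>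
      (metricMatrix g p (y + r • (EuclideanSpace.single j (1 : ℝ) : 𝔼))).det := by
    have hc : Filter.Tendsto (fun r : ℝ => y + r • (EuclideanSpace.single j (1 : ℝ) : 𝔼)) (𝓝 0)
        (𝓝 y) := by
      have := hline.continuousAt.tendsto
      rwa [hy0] at this
    filter_upwards [hc ((isOpen_extChartAt_target p).mem_nhds hy)] with r hr
    exact volDensity_sq g hr
  have huniq := ((hvol.fun_pow 2).congr_of_eventuallyEq hsq.symm).unique hdet
  simp only [hy0] at huniq
  have hadj : (metricMatrix g p y).adjugate
      = (metricMatrix g p y).det • (metricMatrix g p y)⁻¹ := by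
    rw [Matrix.inv_def, smul_smul, Ring.mul_inverse_cancel _
      (isUnit_iff_ne_zero.2 hG.det_pos.ne'), one_smul]
  rw [hadj, ← volDensity_sq g hy, Matrix.smul_mul, Matrix.trace_smul] at huniq
  have htrace : ((metricMatrix g p y)⁻¹ * (Matrix.of fun i l =>
      partialDeriv j (fun z => metricMatrix g p z i l) y)).trace
      = ∑ i, ∑ l, (metricMatrix g p y)⁻¹ i l *
      partialDeriv j (fun z => metricMatrix g p z l i) y := by
    simp [Matrix.trace, Matrix.mul_apply]
  rw [htrace, smul_eq_mul] at huniq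
  rw [h1, eq_inv_mul_iff_mul_eq₀ hs.ne']
  have h4 : volDensity g p y * (volDensity g p y * (1 / 2 * ∑ i, ∑ l, (metricMatrix g p y)⁻¹ i l *
      partialDeriv j (fun z => metricMatrix g p z l i) y))
      = volDensity g p y * partialDeriv j (volDensity g p) y := by
    push_cast at huniq
    linear_combination (-1 / 2) * huniq
  exact mul_left_cancel₀ hs.ne' h4

/-- The divergence is the trace of the covariant derivative. -/
theorem divergence_eq_sum_covComp (g : SmoothMetric n M) {u : (x : M) → TangentSpace (𝓡 n) x}
    (hu : IsSmoothField u) (x : M) :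
    divergence g u x = ∑ i, covComp g u x i i (extChartAt (𝓡 n) x x) := by
  have hy := mem_extChartAt_target (I := 𝓡 n) x
  rw [divergence_eq_densityDiv, densityDiv_eq (differentiableAt_volDensity g hy)
    (differentiableAt_fieldRep hu hy) (volDensity_pos g hy).ne', trace_clmMatrix]
  simp only [covComp, Finset.sum_add_distrib]
  congr 1
  · refine Finset.sum_congr rfl fun i _ => ?_
    have h1 : HasFDerivAt (fun z => fieldRep u x z i)
        ((EuclideanSpace.proj (𝕜 := ℝ) i : 𝔼 →L[ℝ] ℝ) ∘L
          fderiv ℝ (fieldRep u x) (extChartAt (𝓡 n) x x)) (extChartAt (𝓡 n) x x) :=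
      (EuclideanSpace.proj (𝕜 := ℝ) i : 𝔼 →L[ℝ] ℝ).hasFDerivAt.comp _
        (differentiableAt_fieldRep hu hy).hasFDerivAt
    have h2 : coordComp u x i = fun z => fieldRep u x z i := by
      ext z
      exact coordComp_eq u x i z
    rw [partialDeriv, h2, h1.fderiv]
    rfl
  · rw [Finset.sum_comm]
    simp only [← Finset.sum_mul, sum_christoffel g hy, coordComp_eq]
    have h3 : fieldRep u x (extChartAt (𝓡 n) x x) = ∑ j,
        fieldRep u x (extChartAt (𝓡 n) x x) j • (EuclideanSpace.single j (1 : ℝ) : 𝔼) := by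
      have := (EuclideanSpace.basisFun (Fin n) ℝ).sum_repr (fieldRep u x (extChartAt (𝓡 n) x x))
      simpa using this.symm
    conv_lhs => rw [h3]
    rw [map_sum, Finset.mul_sum]
    refine Finset.sum_congr rfl fun j _ => ?_
    rw [map_smul, smul_eq_mul, partialDeriv]
    ring

theorem abs_divergence_le (g : SmoothMetric n M) {u : (x : M) → TangentSpace (𝓡 n) x}
    (hu : IsSmoothField u) (x : M) :
    |divergence g u x| ≤ Real.sqrt n * covNorm g u x := by
  have hy := mem_extChartAt_target (I := 𝓡 n) x
  have h := sq_trace_le (posDef_metricMatrix g hy)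
    (fun i k => covComp g u x i k (extChartAt (𝓡 n) x x))
  rw [Fintype.card_fin] at h
  rw [covNorm, ← Real.sqrt_mul (Nat.cast_nonneg n), divergence_eq_sum_covComp g hu]
  exact Real.abs_le_sqrt h

end NormBound

/-! ### The Riemannian measure: chart formula, finiteness, positivity on open sets. -/

section Volume

open MeasureTheory

variable {n : ℕ}

local notation "𝔼" => EuclideanSpace ℝ (Fin n)

variable {M : Type*} [TopologicalSpace M] [ChartedSpace (EuclideanSpace ℝ (Fin n)) M]
  [IsManifold (𝓡 n) ∞ M]

lemma volDensity_transition (g : SmoothMetric n M) {p q : M} {y : 𝔼} (hy : y ∈ overlap n p q) :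
    |(fderiv ℝ (transition p q) y).det| * volDensity g q (transition p q y) = volDensity g p y := by
  rw [← sq_eq_sq₀ (mul_nonneg (abs_nonneg _)
    (volDensity_pos g (transition_mem_overlap hy).1).le) (volDensity_pos g hy.1).le, mul_pow,
    sq_abs, volDensity_sq_transition g hy]

variable [MeasurableSpace M] [BorelSpace M]

omit [IsManifold (𝓡 n) ∞ M] [MeasurableSpace M] [BorelSpace M] in
lemma measurableSet_target (p : M) : MeasurableSet (extChartAt (𝓡 n) p).target :=
  (isOpen_extChartAt_target p).measurableSet

omit [IsManifold (𝓡 n) ∞ M] in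
lemma measurableSet_source (p : M) : MeasurableSet (extChartAt (𝓡 n) p).source :=
  (isOpen_extChartAt_source p).measurableSet

omit [IsManifold (𝓡 n) ∞ M] in
lemma measurableSet_target_inter (p : M) {A : Set M} (hA : MeasurableSet A) :
    MeasurableSet ((extChartAt (𝓡 n) p).target ∩ (extChartAt (𝓡 n) p).symm ⁻¹' A) := by
  have h1 := (continuousOn_iff_continuous_domRestrict.1
    (continuousOn_extChartAt_symm (I := 𝓡 n) p)).measurable hA
  have h2 := (measurableSet_target (n := n) p).subtype_image h1
  convert! h2 using 1
  ext y
  simp [and_comm]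

lemma aemeasurable_symm (g : SmoothMetric n M) (p : M) :
    AEMeasurable (extChartAt (𝓡 n) p).symm ((volume.restrict (extChartAt (𝓡 n) p).target).withDensity
      fun y => ENNReal.ofReal (volDensity g p y)) :=
  ((continuousOn_extChartAt_symm p).aemeasurable (measurableSet_target p)).mono_ac
    (withDensity_absolutelyContinuous _ _)

lemma chartVolume_apply (g : SmoothMetric n M) (p : M) {A : Set M} (hA : MeasurableSet A) :
    chartVolume g p A = ∫⁻ y in (extChartAt (𝓡 n) p).target ∩ (extChartAt (𝓡 n) p).symm ⁻¹' A,
      ENNReal.ofReal (volDensity g p y) := by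
  rw [chartVolume, Measure.map_apply_of_aemeasurable (aemeasurable_symm g p) hA,
    withDensity_apply', Measure.restrict_restrict' (measurableSet_target p), Set.inter_comm]

/-- Change of variables: the Jacobian of the transition map is exactly the ratio of the two
densities. -/
lemma chartVolume_congr (g : SmoothMetric n M) (p q : M) {A : Set M} (hA : MeasurableSet A)
    (hp : A ⊆ (extChartAt (𝓡 n) p).source) (hq : A ⊆ (extChartAt (𝓡 n) q).source) :
    chartVolume g p A = chartVolume g q A := by
  have hsub : (extChartAt (𝓡 n) p).target ∩ (extChartAt (𝓡 n) p).symm ⁻¹' A ⊆ overlap n p q :=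
    fun y hy => ⟨hy.1, hq hy.2⟩
  have himg : transition p q '' ((extChartAt (𝓡 n) p).target ∩ (extChartAt (𝓡 n) p).symm ⁻¹' A)
      = (extChartAt (𝓡 n) q).target ∩ (extChartAt (𝓡 n) q).symm ⁻¹' A := by
    ext z
    constructor
    · rintro ⟨y, hy, rfl⟩
      refine ⟨(transition_mem_overlap (hsub hy)).1, ?_⟩
      rw [Set.mem_preimage, symm_transition (hsub hy)]
      exact hy.2
    · intro hz
      have hz' : z ∈ overlap n q p := ⟨hz.1, hp hz.2⟩
      refine ⟨transition q p z, ⟨(transition_mem_overlap hz').1, ?_⟩, transition_transition hz'⟩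
      rw [Set.mem_preimage, symm_transition hz']
      exact hz.2
  rw [chartVolume_apply g p hA, chartVolume_apply g q hA, ← himg,
    lintegral_image_eq_lintegral_abs_det_fderiv_mul volume (measurableSet_target_inter p hA)
      (f' := fderiv ℝ (transition p q))]
  · refine setLIntegral_congr_fun (measurableSet_target_inter p hA) fun y hy => ?_
    rw [← ENNReal.ofReal_mul (abs_nonneg _), volDensity_transition g (hsub hy)]
  · intro y hy
    exact (((contDiffOn_transition p q).contDiffAt
      ((isOpen_overlap p q).mem_nhds (hsub hy))).differentiableAt
        (by norm_num)).hasFDerivAt.hasFDerivWithinAt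
  · intro y hy z hz hyz
    rw [← transition_transition (hsub hy), hyz, transition_transition (hsub hz)]

lemma chartVolume_compl_source (g : SmoothMetric n M) (p : M) :
    chartVolume g p (extChartAt (𝓡 n) p).sourceᶜ = 0 := by
  rw [chartVolume_apply g p (measurableSet_source p).compl]
  have : (extChartAt (𝓡 n) p).target ∩ (extChartAt (𝓡 n) p).symm ⁻¹'
      (extChartAt (𝓡 n) p).sourceᶜ = ∅ := by
    ext y
    simp only [Set.mem_inter_iff, Set.mem_preimage, Set.mem_compl_iff, Set.mem_empty_iff_false,
      iff_false, not_and, not_not]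
    exact fun hy => (extChartAt (𝓡 n) p).map_target hy
  rw [this]
  simp

/-- On the domain of a chart the Riemannian volume is given by the density of the chart. -/
theorem riemVolume_apply (g : SmoothMetric n M) (p : M) {A : Set M} (hA : MeasurableSet A)
    (hp : A ⊆ (extChartAt (𝓡 n) p).source) : riemVolume g A = chartVolume g p A := by
  refine le_antisymm ?_ (le_iSup (fun p => chartVolume g p) p A)
  -- ν dominates every chart volume: inside the source of p these agree with `chartVolume g p` on
  -- overlaps, and any set reaching outside has ν-measure ∞. Hence the supremum is at most ν, and ν
  -- reduces to `chartVolume g p` on subsets of the source.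
  let ν : Measure M := chartVolume g p + (⊤ : ℝ≥0∞) •
    (Measure.count.restrict (extChartAt (𝓡 n) p).sourceᶜ)
  have hle : riemVolume g ≤ ν := by
    refine iSup_le fun q => Measure.le_iff.2 fun B hB => ?_
    by_cases hBp : B ⊆ (extChartAt (𝓡 n) p).source
    · rw [← measure_inter_add_sdiff B (measurableSet_source (n := n) q)]
      have h1 : chartVolume g q (B \ (extChartAt (𝓡 n) q).source) = 0 :=
        measure_mono_null (fun x hx => hx.2) (chartVolume_compl_source g q)
      rw [h1, add_zero, chartVolume_congr g q p (hB.inter (measurableSet_source q))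
        Set.inter_subset_right (Set.inter_subset_left.trans hBp)]
      exact (measure_mono Set.inter_subset_left).trans
        (Measure.le_iff'.1 (Measure.le_add_right le_rfl) B)
    · have h2 : Measure.count (B ∩ (extChartAt (𝓡 n) p).sourceᶜ) ≠ 0 := by
        rw [Ne, Measure.count_eq_zero_iff]
        intro h
        exact hBp (Set.inter_compl_nonempty_iff.not_left.1
          (Set.not_nonempty_iff_eq_empty.2 h))
      have h3 : ν B = ⊤ := by
        rw [Measure.add_apply, Measure.smul_apply, Measure.restrict_apply hB, smul_eq_mul,
          ENNReal.top_mul h2, add_top]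
      rw [h3]
      exact le_top
  refine (Measure.le_iff'.1 hle A).trans ?_
  have h4 : A ∩ (extChartAt (𝓡 n) p).sourceᶜ = ∅ :=
    Set.disjoint_iff_inter_eq_empty.1 (Set.disjoint_compl_right_iff_subset.2 hp)
  rw [Measure.add_apply, Measure.smul_apply, Measure.restrict_apply hA, h4]
  simp

lemma riemVolume_restrict (g : SmoothMetric n M) (p : M) :
    (riemVolume g).restrict (extChartAt (𝓡 n) p).source = chartVolume g p := by
  ext A hA
  rw [Measure.restrict_apply hA, riemVolume_apply g p (hA.inter (measurableSet_source p))
    Set.inter_subset_right, ← measure_inter_add_sdiff A (measurableSet_source (n := n) p)]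
  have h1 : chartVolume g p (A \ (extChartAt (𝓡 n) p).source) = 0 :=
    measure_mono_null (fun x hx => hx.2) (chartVolume_compl_source g p)
  rw [h1, add_zero]

lemma isFiniteMeasure_riemVolume [CompactSpace M] (g : SmoothMetric n M) :
    IsFiniteMeasure (riemVolume g) := by
  have h : IsLocallyFiniteMeasure (riemVolume g) := by
    refine ⟨fun x => ?_⟩
    obtain ⟨r, hr, hrt⟩ := Metric.nhds_basis_closedBall.mem_iff.1
      (extChartAt_target_mem_nhds (I := 𝓡 n) x)
    refine ⟨(extChartAt (𝓡 n) x).source ∩ extChartAt (𝓡 n) x ⁻¹'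
      Metric.ball (extChartAt (𝓡 n) x x) r, ?_, ?_⟩
    · exact ((continuousOn_extChartAt x).isOpen_inter_preimage (isOpen_extChartAt_source x)
        Metric.isOpen_ball).mem_nhds ⟨mem_extChartAt_source x, Metric.mem_ball_self hr⟩
    · have hmeas : MeasurableSet ((extChartAt (𝓡 n) x).source ∩ extChartAt (𝓡 n) x ⁻¹'
          Metric.ball (extChartAt (𝓡 n) x x) r) :=
        ((continuousOn_extChartAt x).isOpen_inter_preimage (isOpen_extChartAt_source x)
          Metric.isOpen_ball).measurableSet
      rw [riemVolume_apply g x hmeas Set.inter_subset_left, chartVolume_apply g x hmeas]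
      obtain ⟨C, hC⟩ := (isCompact_closedBall (extChartAt (𝓡 n) x x) r).exists_bound_of_continuousOn
        ((contDiffOn_volDensity g x).continuousOn.mono hrt)
      have hsub : (extChartAt (𝓡 n) x).target ∩ (extChartAt (𝓡 n) x).symm ⁻¹'
          ((extChartAt (𝓡 n) x).source ∩ extChartAt (𝓡 n) x ⁻¹'
            Metric.ball (extChartAt (𝓡 n) x x) r) ⊆ Metric.closedBall (extChartAt (𝓡 n) x x) r := by
        rintro y ⟨hy, -, hy2⟩
        rw [Set.mem_preimage, (extChartAt (𝓡 n) x).right_inv hy] at hy2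
        exact Metric.ball_subset_closedBall hy2
      refine (lintegral_mono_set hsub).trans_lt ?_
      refine (setLIntegral_mono' (g := fun _ => ENNReal.ofReal C) measurableSet_closedBall
        fun y hy => ENNReal.ofReal_le_ofReal ((le_abs_self _).trans (hC y hy))).trans_lt ?_
      rw [setLIntegral_const]
      exact ENNReal.mul_lt_top ENNReal.ofReal_lt_top measure_closedBall_lt_top
  exact inferInstance

lemma isOpenPosMeasure_riemVolume (g : SmoothMetric n M) :
    (riemVolume g).IsOpenPosMeasure := by
  refine ⟨fun U hU ⟨x, hx⟩ h0 => ?_⟩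
  have hV : IsOpen (U ∩ (extChartAt (𝓡 n) x).source) := hU.inter (isOpen_extChartAt_source x)
  have h1 : riemVolume g (U ∩ (extChartAt (𝓡 n) x).source) = 0 :=
    measure_mono_null Set.inter_subset_left h0
  rw [riemVolume_apply g x hV.measurableSet Set.inter_subset_right,
    chartVolume_apply g x hV.measurableSet] at h1
  have hW : IsOpen ((extChartAt (𝓡 n) x).target ∩ (extChartAt (𝓡 n) x).symm ⁻¹'
      (U ∩ (extChartAt (𝓡 n) x).source)) :=
    (continuousOn_extChartAt_symm x).isOpen_inter_preimage (isOpen_extChartAt_target x) hV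
  have hne : ((extChartAt (𝓡 n) x).target ∩ (extChartAt (𝓡 n) x).symm ⁻¹'
      (U ∩ (extChartAt (𝓡 n) x).source)).Nonempty :=
    ⟨extChartAt (𝓡 n) x x, mem_extChartAt_target x, by
      rw [Set.mem_preimage, (extChartAt (𝓡 n) x).left_inv (mem_extChartAt_source x)]
      exact ⟨hx, mem_extChartAt_source x⟩⟩
  rw [lintegral_eq_zero_iff' (((contDiffOn_volDensity g x).continuousOn.mono
    Set.inter_subset_left).aemeasurable hW.measurableSet).ennreal_ofReal,
    Filter.EventuallyEq, ae_restrict_iff' hW.measurableSet] at h1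
  refine (hW.measure_pos volume hne).ne' (measure_mono_null (fun y hy => ?_) (ae_iff.1 h1))
  exact fun h => (ENNReal.ofReal_pos.2 (volDensity_pos g hy.1)).ne' (h hy)

/-- Integrals of functions supported in the domain of a chart are computed in coordinates. -/
theorem integral_riemVolume_eq (g : SmoothMetric n M) (p : M) {f : M → ℝ} (hf : Continuous f)
    (h0 : ∀ x ∉ (extChartAt (𝓡 n) p).source, f x = 0) :
    ∫ x, f x ∂(riemVolume g) = ∫ y in (extChartAt (𝓡 n) p).target,
      volDensity g p y * f ((extChartAt (𝓡 n) p).symm y) := by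
  rw [← setIntegral_eq_integral_of_forall_compl_eq_zero h0, riemVolume_restrict, chartVolume,
    integral_map (aemeasurable_symm g p) hf.aestronglyMeasurable,
    integral_withDensity_eq_integral_toReal_smul₀]
  · refine setIntegral_congr_fun (measurableSet_target p) fun y hy => ?_
    simp only [smul_eq_mul]
    rw [ENNReal.toReal_ofReal (volDensity_pos g hy).le]
  · exact ((contDiffOn_volDensity g p).continuousOn.aemeasurable
      (measurableSet_target p)).ennreal_ofReal
  · exact Filter.Eventually.of_forall fun y => ENNReal.ofReal_lt_top

end Volume

/-! ### The divergence theorem, by a partition of unity. -/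

section DivergenceTheorem

open MeasureTheory

variable {n : ℕ}

local notation "𝔼" => EuclideanSpace ℝ (Fin n)

lemma contDiff_of_eq_zero_off {E F : Type*} [NormedAddCommGroup E] [NormedSpace ℝ E]
    [NormedAddCommGroup F] [NormedSpace ℝ F] {f : E → F} {Ω K : Set E} (hΩ : IsOpen Ω)
    (hK : IsClosed K) (hKΩ : K ⊆ Ω) (hf : ContDiffOn ℝ ∞ f Ω) (h0 : ∀ y ∉ K, f y = 0) :
    ContDiff ℝ ∞ f := by
  refine contDiff_iff_contDiffAt.2 fun y => ?_
  by_cases hy : y ∈ Ω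
  · exact hf.contDiffAt (hΩ.mem_nhds hy)
  · refine (contDiffAt_const (c := (0 : F))).congr_of_eventuallyEq ?_
    filter_upwards [hK.isOpen_compl.mem_nhds fun h => hy (hKΩ h)] with z hz using h0 z hz

lemma integral_fderiv_eq_zero {f : 𝔼 → ℝ} (hf : ContDiff ℝ 1 f) (hc : HasCompactSupport f)
    (v : 𝔼) : ∫ y, fderiv ℝ f y v = 0 := by
  have hi : Integrable (fun y => fderiv ℝ f y v) := by
    refine ((hf.continuous_fderiv (by norm_num)).clm_apply
      continuous_const).integrable_of_hasCompactSupport ?_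
    exact hc.fderiv_apply (𝕜 := ℝ) v
  have h := integral_mul_fderiv_eq_neg_fderiv_mul_of_integrable (𝕜 := ℝ) (μ := volume)
    (f := fun _ : 𝔼 => (1 : ℝ)) (g := f) (v := v) (by simp) (by simpa using hi)
    (by simpa using hf.continuous.integrable_of_hasCompactSupport hc)
    (fun x _ => differentiableAt_const _) (fun x _ => hf.differentiable (by norm_num) x)
  simpa using h

variable {M : Type*} [TopologicalSpace M] [ChartedSpace (EuclideanSpace ℝ (Fin n)) M]
  [IsManifold (𝓡 n) ∞ M]

lemma exists_smooth_partition [T2Space M] [CompactSpace M] (U : M → Set M)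
    (hU : ∀ x, IsOpen (U x)) (hxU : ∀ x, x ∈ U x) :
    ∃ (t : Finset M) (f : M → M → ℝ), (∀ p, ContMDiff (𝓡 n) 𝓘(ℝ, ℝ) ∞ (f p)) ∧
      (∀ p, tsupport (f p) ⊆ U p) ∧ ∀ x, ∑ p ∈ t, f p x = 1 := by
  obtain ⟨f, hf⟩ := SmoothPartitionOfUnity.exists_isSubordinate (𝓡 n) isClosed_univ U hU
    (fun x _ => Set.mem_iUnion.2 ⟨x, hxU x⟩)
  have hfin := f.locallyFinite.finite_nonempty_of_compact
  refine ⟨hfin.toFinset, fun p => f p, fun p => (f p).contMDiff, hf, fun x => ?_⟩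
  rw [← f.sum_eq_one (Set.mem_univ x)]
  refine (finsum_eq_sum_of_support_subset _ fun p hp => ?_).symm
  rw [Set.Finite.coe_toFinset]
  exact ⟨x, hp⟩

/-- The vector field with coordinates `V` in the chart centred at `p`, extended by zero. -/
def chartField (p : M) (V : 𝔼 → 𝔼) (x : M) : TangentSpace (𝓡 n) x :=
  ((extChartAt (𝓡 n) p).source.indicator (fun z => (chartVec (𝓡 n) p (extChartAt (𝓡 n) p z)
    (V (extChartAt (𝓡 n) p z)) : 𝔼)) x : 𝔼)

omit [IsManifold (𝓡 n) ∞ M] in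
lemma chartField_eq_zero {p x : M} {V : 𝔼 → 𝔼}
    (hx : x ∈ (extChartAt (𝓡 n) p).source → V (extChartAt (𝓡 n) p x) = 0) :
    chartField p V x = 0 := by
  by_cases h : x ∈ (extChartAt (𝓡 n) p).source
  · refine (Set.indicator_of_mem h _).trans ?_
    rw [hx h]
    exact map_zero (mfderiv 𝓘(ℝ, 𝔼) (𝓡 n) (extChartAt (𝓡 n) p).symm (extChartAt (𝓡 n) p x))
  · exact Set.indicator_of_notMem h _

lemma fieldRep_chartField {p : M} {V : 𝔼 → 𝔼} {y : 𝔼} (hy : y ∈ (extChartAt (𝓡 n) p).target) :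
    fieldRep (chartField p V) p y = V y := by
  have h1 : (chartField p V ((extChartAt (𝓡 n) p).symm y) : 𝔼) = (chartVec (𝓡 n) p y (V y) : 𝔼) := by
    refine (Set.indicator_of_mem ((extChartAt (𝓡 n) p).map_target hy) _).trans ?_
    exact congrArg (fun z => (chartVec (𝓡 n) p z (V z) : 𝔼)) ((extChartAt (𝓡 n) p).right_inv hy)
  exact (congrArg (chartRep (𝓡 n) p ((extChartAt (𝓡 n) p).symm y)) h1).trans
    (chartRep_chartVec hy (V y))

lemma isSmoothField_chartField [T2Space M] {p : M} {V : 𝔼 → 𝔼} {K : Set 𝔼} (hK : IsCompact K)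
    (hKt : K ⊆ (extChartAt (𝓡 n) p).target) (hV : ContDiffOn ℝ ∞ V (extChartAt (𝓡 n) p).target)
    (h0 : ∀ y ∉ K, V y = 0) : IsSmoothField (chartField p V) := by
  intro x
  by_cases hx : x ∈ (extChartAt (𝓡 n) p).source
  · refine (contMDiffWithinAt_tangentBundle_iff (I := 𝓡 n) (n := ⊤) (p := p) hx).2
      ⟨contMDiffWithinAt_id, ?_⟩
    have h1 : ContMDiffAt (𝓡 n) 𝓘(ℝ, 𝔼) ∞ (fun x => V (extChartAt (𝓡 n) p x)) x := by
      refine ContMDiffAt.comp x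
        (hV.contMDiffOn.contMDiffAt ((isOpen_extChartAt_target p).mem_nhds
          ((extChartAt (𝓡 n) p).map_source hx))) ?_
      refine contMDiffOn_extChartAt.contMDiffAt ?_
      rw [← extChartAt_source (𝓡 n)]
      exact (isOpen_extChartAt_source p).mem_nhds hx
    refine (h1.congr_of_eventuallyEq ?_).contMDiffWithinAt
    filter_upwards [(isOpen_extChartAt_source p).mem_nhds hx] with z hz
    rw [← fieldRep_chartField (V := V) ((extChartAt (𝓡 n) p).map_source hz),
      fieldRep_extChartAt _ hz]
  · have hc : IsClosed ((extChartAt (𝓡 n) p).symm '' K) :=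
      (hK.image_of_continuousOn ((continuousOn_extChartAt_symm p).mono hKt)).isClosed
    have hxK : x ∉ (extChartAt (𝓡 n) p).symm '' K := by
      rintro ⟨y, hy, rfl⟩
      exact hx ((extChartAt (𝓡 n) p).map_target (hKt hy))
    refine (isSmoothField_zero x).congr_of_eventuallyEq ?_
    filter_upwards [hc.isOpen_compl.mem_nhds hxK] with z hz
    rw [chartField_eq_zero fun hzs => h0 _ fun h =>
      hz ⟨_, h, (extChartAt (𝓡 n) p).left_inv hzs⟩]

lemma divergence_eq_zero_of_eventually (g : SmoothMetric n M)
    {u : (x : M) → TangentSpace (𝓡 n) x} {x : M} (hu : ∀ᶠ z in 𝓝 x, u z = 0) :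
    divergence g u x = 0 := by
  have h1 : fieldRep u x =ᶠ[𝓝 (extChartAt (𝓡 n) x x)] fun _ => 0 := by
    have h2 : Filter.Tendsto (extChartAt (𝓡 n) x).symm (𝓝 (extChartAt (𝓡 n) x x)) (𝓝 x) := by
      have := continuousAt_extChartAt_symm (I := 𝓡 n) x
      rwa [ContinuousAt, extChartAt_to_inv] at this
    filter_upwards [h2.eventually hu] with y hy
    rw [fieldRep, hy, chartRep_zero]
  rw [divergence_eq_densityDiv, densityDiv]
  have h3 : ∀ i, partialDeriv i (fun z => volDensity g x z * fieldRep u x z i)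
      (extChartAt (𝓡 n) x x) = 0 := by
    intro i
    have h4 : (fun z => volDensity g x z * fieldRep u x z i)
        =ᶠ[𝓝 (extChartAt (𝓡 n) x x)] fun _ => (0 : ℝ) := by
      filter_upwards [h1] with y hy
      rw [hy]
      simp
    rw [partialDeriv, h4.fderiv_eq]
    simp
  rw [Finset.sum_eq_zero fun i _ => h3 i, mul_zero]

variable [MeasurableSpace M] [BorelSpace M]

/-- In the chart, √g div u is the Euclidean divergence of the field √g u, which is smooth with
compact support after extension by zero; each partial derivative then integrates to zero. -/
lemma integral_divergence_of_support [T2Space M] (g : SmoothMetric n M)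
    {u : (x : M) → TangentSpace (𝓡 n) x} (hu : IsSmoothField u) {p : M} {K : Set M}
    (hK : IsCompact K) (hKp : K ⊆ (extChartAt (𝓡 n) p).source) (h0 : ∀ x ∉ K, u x = 0) :
    ∫ x, divergence g u x ∂(riemVolume g) = 0 := by
  set K' := extChartAt (𝓡 n) p '' K with hK'
  have hKc : IsCompact K' := hK.image_of_continuousOn ((continuousOn_extChartAt p).mono hKp)
  have hKt : K' ⊆ (extChartAt (𝓡 n) p).target := by
    rintro _ ⟨x, hx, rfl⟩
    exact (extChartAt (𝓡 n) p).map_source (hKp hx)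
  have hΩ := isOpen_extChartAt_target (I := 𝓡 n) p
  have hdiv0 : ∀ x ∉ K, divergence g u x = 0 := fun x hx =>
    divergence_eq_zero_of_eventually g (by
      filter_upwards [hK.isClosed.isOpen_compl.mem_nhds hx] with z hz using h0 z hz)
  have hrep0 : ∀ y ∈ (extChartAt (𝓡 n) p).target, y ∉ K' → fieldRep u p y = 0 := by
    intro y hy hyK
    rw [fieldRep, h0 _ fun h => hyK ⟨_, h, (extChartAt (𝓡 n) p).right_inv hy⟩, chartRep_zero]
  rw [integral_riemVolume_eq g p (contMDiff_divergence g hu).continuous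
    fun x hx => hdiv0 x fun h => hx (hKp h)]
  let W : Fin n → 𝔼 → ℝ := fun i => (extChartAt (𝓡 n) p).target.indicator
    fun y => volDensity g p y * fieldRep u p y i
  have hW0 : ∀ i, ∀ y ∉ K', W i y = 0 := by
    intro i y hy
    by_cases hyt : y ∈ (extChartAt (𝓡 n) p).target
    · simp only [W]
      rw [Set.indicator_of_mem hyt, hrep0 y hyt hy]
      simp
    · exact Set.indicator_of_notMem hyt _
  have hW : ∀ i, ContDiff ℝ ∞ (W i) := fun i => by
    refine contDiff_of_eq_zero_off hΩ hKc.isClosed hKt ?_ (hW0 i)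
    refine ContDiffOn.congr ?_ fun y hy => Set.indicator_of_mem hy _
    exact (contDiffOn_volDensity g p).mul ((EuclideanSpace.proj (𝕜 := ℝ) i :
      𝔼 →L[ℝ] ℝ).contDiff.comp_contDiffOn (contDiffOn_fieldRep hu p))
  have hWc : ∀ i, HasCompactSupport (W i) := fun i => HasCompactSupport.intro hKc (hW0 i)
  have h1 : ∀ y ∈ (extChartAt (𝓡 n) p).target,
      volDensity g p y * divergence g u ((extChartAt (𝓡 n) p).symm y)
      = ∑ i, fderiv ℝ (W i) y (EuclideanSpace.single i 1) := by
    intro y hy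
    rw [divergence_eq_chart g hu ((extChartAt (𝓡 n) p).map_target hy),
      (extChartAt (𝓡 n) p).right_inv hy, densityDiv, mul_inv_cancel_left₀ (volDensity_pos g hy).ne']
    refine Finset.sum_congr rfl fun i _ => ?_
    have h3 : (fun z => volDensity g p z * fieldRep u p z i) =ᶠ[𝓝 y] W i := by
      filter_upwards [hΩ.mem_nhds hy] with z hz
      exact (Set.indicator_of_mem hz (fun y => volDensity g p y * fieldRep u p y i)).symm
    rw [partialDeriv, h3.fderiv_eq]
  rw [setIntegral_congr_fun (measurableSet_target p) h1,
    setIntegral_eq_integral_of_forall_compl_eq_zero]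
  · rw [integral_finsetSum]
    · exact Finset.sum_eq_zero fun i _ =>
        integral_fderiv_eq_zero ((hW i).of_le (by norm_cast)) (hWc i) _
    · intro i _
      exact (((hW i).continuous_fderiv (by norm_num)).clm_apply
        continuous_const).integrable_of_hasCompactSupport ((hWc i).fderiv_apply (𝕜 := ℝ) _)
  · intro y hy
    refine Finset.sum_eq_zero fun i _ => ?_
    have h2 : W i =ᶠ[𝓝 y] fun _ => (0 : ℝ) := by
      filter_upwards [hKc.isClosed.isOpen_compl.mem_nhds fun h => hy (hKt h)] with z hz
      exact hW0 i z hz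
    rw [h2.fderiv_eq]
    simp

/-- The divergence theorem on a closed manifold. -/
theorem integral_divergence [T2Space M] [CompactSpace M] (g : SmoothMetric n M)
    {u : (x : M) → TangentSpace (𝓡 n) x} (hu : IsSmoothField u) :
    ∫ x, divergence g u x ∂(riemVolume g) = 0 := by
  have hfin := isFiniteMeasure_riemVolume g
  obtain ⟨t, f, hf, hft, hsum⟩ := exists_smooth_partition (n := n)
    (fun p : M => (extChartAt (𝓡 n) p).source) (fun p => isOpen_extChartAt_source p)
    (fun p => mem_extChartAt_source p)
  have hs : ∀ p, IsSmoothField fun x => f p x • u x := fun p => isSmoothField_smul (hf p) hu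
  have h1 : u = fun x => ∑ p ∈ t, f p x • u x := by
    ext1 x
    rw [← Finset.sum_smul, hsum, one_smul]
  have h2 : ∀ x, divergence g u x = ∑ p ∈ t, divergence g (fun x => f p x • u x) x := fun x => by
    conv_lhs => rw [h1]
    exact divergence_sum g t (fun p _ => hs p) x
  simp only [h2]
  rw [integral_finsetSum]
  · refine Finset.sum_eq_zero fun p _ => integral_divergence_of_support g (hs p)
      (isClosed_tsupport (f p)).isCompact (hft p) fun x hx => ?_
    rw [image_eq_zero_of_notMem_tsupport hx, zero_smul]
  · intro p _
    exact (contMDiff_divergence g (hs p)).continuous.integrable_of_hasCompactSupport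
      (HasCompactSupport.of_compactSpace _)

end DivergenceTheorem

/-! ### Primitives of mean-zero functions supported in a cube. -/

section Box

open MeasureTheory

/-- The integral is `volterra`, evaluated at 1, of the superposition by H of the curve s ↦ (x, s),
which is affine in x. So smoothness follows from that of superposition. E lies in `Type` because E ×
ℝ and ℝ must share a universe there. -/
lemma contDiff_integral_unit {E : Type} [NormedAddCommGroup E] [NormedSpace ℝ E] {H : E × ℝ → ℝ}
    (hH : ContDiff ℝ ∞ H) : ContDiff ℝ ∞ fun x => ∫ s in (0 : ℝ)..1, H (x, s) := by
  let v : C(E × ℝ, ℝ) := ⟨H, hH.continuous⟩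
  let ι : C(Set.Icc (0 : ℝ) 1, E × ℝ) := ⟨fun s => (0, (s : ℝ)), by fun_prop⟩
  let L : E →L[ℝ] C(Set.Icc (0 : ℝ) 1, E × ℝ) :=
    (ContinuousLinearMap.const ℝ (Set.Icc (0 : ℝ) 1)) ∘L ContinuousLinearMap.inl ℝ E ℝ
  let A : E → C(Set.Icc (0 : ℝ) 1, E × ℝ) := fun x => L x + ι
  have hA : ContDiff ℝ ∞ A := (ContinuousLinearMap.contDiff _).add contDiff_const
  have h1 : ContDiff ℝ ∞ fun x => ContinuousMap.evalCLM ℝ (⟨1, by simp⟩ : Set.Icc (0 : ℝ) 1)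
      (volterra ℝ (superposition (Set.Icc (0 : ℝ) 1) v (A x))) :=
    (ContinuousLinearMap.contDiff _).comp ((ContinuousLinearMap.contDiff _).comp
      ((contDiff_superposition v hH).comp hA))
  convert! h1 using 2 with x
  change _ = ∫ s in (0 : ℝ)..1, extendUnit (superposition (Set.Icc (0 : ℝ) 1) v (A x)) s
  refine intervalIntegral.integral_congr fun s hs => ?_
  rw [Set.uIcc_of_le zero_le_one] at hs
  rw [extendUnit_apply _ hs]
  change H (x, s) = H ((x, (0 : ℝ)) + ((0 : E), s))
  simp

/-- An integral with smooth upper limit of a function depending smoothly on a parameter is smooth. -/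
lemma contDiff_integral_to {E : Type} [NormedAddCommGroup E] [NormedSpace ℝ E] {H : E × ℝ → ℝ}
    (hH : ContDiff ℝ ∞ H) {b : E → ℝ} (hb : ContDiff ℝ ∞ b) (a : ℝ) :
    ContDiff ℝ ∞ fun x => ∫ s in a..b x, H (x, s) := by
  have h1 : ContDiff ℝ ∞ fun z : E × ℝ => H (z.1, a + (b z.1 - a) * z.2) := by
    fun_prop
  have h2 := (hb.sub (contDiff_const (c := a))).mul (contDiff_integral_unit h1)
  convert! h2 using 1
  ext x
  change _ = (b x - a) * ∫ s in (0 : ℝ)..1, H (x, a + (b x - a) * s)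
  rw [intervalIntegral.mul_integral_comp_add_mul (f := fun s => H (x, s))]
  simp

variable {n : ℕ}

local notation "𝔼" => EuclideanSpace ℝ (Fin n)

lemma partialDeriv_of_line {f : 𝔼 → ℝ} {x : 𝔼} {k : Fin n} {c : ℝ} (hf : DifferentiableAt ℝ f x)
    (h : HasDerivAt (fun r : ℝ => f (x + r • EuclideanSpace.single k (1 : ℝ))) c 0) :
    partialDeriv k f x = c := by
  have := hf.lineDeriv_eq_fderiv (v := EuclideanSpace.single k (1 : ℝ))
  rw [partialDeriv, ← this]
  exact h.deriv

lemma add_smul_single_apply (x : 𝔼) (r : ℝ) (k i : Fin n) :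
    (x + r • (EuclideanSpace.single k (1 : ℝ) : 𝔼)) i = if i = k then x k + r else x i := by
  split_ifs with h
  · subst h
    simp
  · simp [h]

/-- The result of replacing the `k`-th coordinate. -/
def setCoord (x : 𝔼) (k : Fin n) (s : ℝ) : 𝔼 := x + (s - x k) • EuclideanSpace.single k (1 : ℝ)

lemma setCoord_apply (x : 𝔼) (k : Fin n) (s : ℝ) (i : Fin n) :
    setCoord x k s i = if i = k then s else x i := by
  rw [setCoord, add_smul_single_apply]
  simp

lemma setCoord_self (x : 𝔼) (k : Fin n) : setCoord x k (x k) = x := by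
  simp [setCoord]

lemma setCoord_add_same (x : 𝔼) (k : Fin n) (r s : ℝ) :
    setCoord (x + r • EuclideanSpace.single k (1 : ℝ)) k s = setCoord x k s := by
  ext i
  simp only [setCoord_apply, add_smul_single_apply]
  split_ifs <;> rfl

lemma setCoord_add_ne (x : 𝔼) {k i : Fin n} (h : k ≠ i) (r s : ℝ) :
    setCoord (x + r • EuclideanSpace.single i (1 : ℝ)) k s
      = setCoord x k s + r • EuclideanSpace.single i (1 : ℝ) := by
  ext j
  simp only [setCoord_apply, add_smul_single_apply]
  split_ifs <;> simp_all

lemma contDiff_setCoord (k : Fin n) : ContDiff ℝ ∞ fun z : 𝔼 × ℝ => setCoord z.1 k z.2 := by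
  have h : ContDiff ℝ ∞ fun z : 𝔼 × ℝ => z.1 k :=
    (EuclideanSpace.proj (𝕜 := ℝ) k : 𝔼 →L[ℝ] ℝ).contDiff.comp contDiff_fst
  unfold setCoord
  fun_prop

lemma contDiff_coord (k : Fin n) : ContDiff ℝ ∞ fun x : 𝔼 => x k :=
  (EuclideanSpace.proj (𝕜 := ℝ) k : 𝔼 →L[ℝ] ℝ).contDiff

/-- Fubini-type induction: modulo divergences of fields supported in the cube, a function supported
in the cube is a product of bumps in some of the coordinates and a function of the others. -/
lemma exists_partial_primitive {a : ℝ} {θ : ℝ → ℝ} (hθ : ContDiff ℝ ∞ θ)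
    (hθ0 : ∀ s, a < |s| → θ s = 0) (hθ1 : ∫ s in (-a)..a, θ s = 1) {F : 𝔼 → ℝ}
    (hF : ContDiff ℝ ∞ F) (hF0 : ∀ x, (∃ i, a < |x i|) → F x = 0) (S : Finset (Fin n)) :
    ∃ (V : 𝔼 → 𝔼) (Q : 𝔼 → ℝ), ContDiff ℝ ∞ V ∧ ContDiff ℝ ∞ Q ∧
      (∀ x, (∃ i, a < |x i|) → V x = 0) ∧
      (∀ i ∈ S, ∀ (x : 𝔼) (r : ℝ), Q (x + r • EuclideanSpace.single i (1 : ℝ)) = Q x) ∧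
      (∀ x, (∃ i ∉ S, a < |x i|) → Q x = 0) ∧
      ∀ x, F x = ∑ i, partialDeriv i (fun y => V y i) x + (∏ i ∈ S, θ (x i)) * Q x := by
  classical
  induction S using Finset.induction_on with
  | empty =>
    refine ⟨fun _ => 0, F, contDiff_const, hF, fun _ _ => rfl, by simp, fun x ⟨i, _, hi⟩ =>
      hF0 x ⟨i, hi⟩, fun x => ?_⟩
    simp [partialDeriv]
  | insert k S hk ih =>
    obtain ⟨V, Q, hV, hQ, hV0, hQi, hQ0, hFV⟩ := ih
    have hH : ContDiff ℝ ∞ fun z : 𝔼 × ℝ => Q (setCoord z.1 k z.2) := hQ.comp (contDiff_setCoord k)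
    -- The k-th coordinate is integrated out. The difference h = Q - θ Q' has zero integral along
    -- each k-line, so its primitive from -a vanishes again beyond a and can serve as a field
    -- component supported in the cube.
    set Q' : 𝔼 → ℝ := fun x => ∫ s in (-a)..a, Q (setCoord x k s) with hQ'def
    have hQ' : ContDiff ℝ ∞ Q' := contDiff_integral_to hH contDiff_const (-a)
    have hQ'k : ∀ (x : 𝔼) (r : ℝ), Q' (x + r • EuclideanSpace.single k (1 : ℝ)) = Q' x := fun x r => by
      simp only [hQ'def, setCoord_add_same]
    have hQ'0 : ∀ x, (∃ i ∉ insert k S, a < |x i|) → Q' x = 0 := by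
      rintro x ⟨i, hi, hxi⟩
      rw [Finset.mem_insert, not_or] at hi
      have : ∀ s, Q (setCoord x k s) = 0 := fun s => hQ0 _ ⟨i, hi.2, by
        rwa [setCoord_apply, if_neg hi.1]⟩
      simp [hQ'def, this]
    set h : 𝔼 → ℝ → ℝ := fun x s => Q (setCoord x k s) - θ s * Q' x with hhdef
    have hh : ContDiff ℝ ∞ fun z : 𝔼 × ℝ => h z.1 z.2 := by
      have := hQ'.comp (contDiff_fst (E := 𝔼) (F := ℝ))
      exact hH.sub ((hθ.comp contDiff_snd).mul this)
    have hhc : ∀ x, Continuous (h x) := fun x =>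
      hh.continuous.comp (continuous_const.prodMk continuous_id)
    have hhk : ∀ (x : 𝔼) (r s : ℝ), h (x + r • EuclideanSpace.single k (1 : ℝ)) s = h x s := fun x r s => by
      simp only [hhdef, setCoord_add_same, hQ'k]
    have hhs : ∀ x s, a < |s| → h x s = 0 := fun x s hs => by
      simp only [hhdef]
      rw [hQ0 _ ⟨k, hk, by rwa [setCoord_apply, if_pos rfl]⟩, hθ0 s hs]
      ring
    have hhI : ∀ x, ∫ s in (-a)..a, h x s = 0 := fun x => by
      simp only [hhdef]
      rw [intervalIntegral.integral_sub, intervalIntegral.integral_mul_const, hθ1, one_mul]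
      · exact sub_self _
      · exact (hH.continuous.comp (continuous_const.prodMk continuous_id)).intervalIntegrable _ _
      · exact (hθ.continuous.mul continuous_const).intervalIntegrable _ _
    set Θ : 𝔼 → ℝ := fun x => ∏ i ∈ S, θ (x i) with hΘdef
    have hΘ : ContDiff ℝ ∞ Θ := contDiff_prod fun i _ => hθ.comp (contDiff_coord i)
    have hΘk : ∀ (x : 𝔼) (r : ℝ), Θ (x + r • EuclideanSpace.single k (1 : ℝ)) = Θ x := fun x r => by
      refine Finset.prod_congr rfl fun i hi => ?_
      have hik : i ≠ k := fun hik => hk (hik ▸ hi)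
      rw [add_smul_single_apply, if_neg hik]
    -- Θ does not depend on the k-th coordinate, so ∂_k W = Θ (Q - θ Q'): the divergence of W e_k
    -- accounts for replacing ΘQ by Θ θ(x_k) Q'.
    set W : 𝔼 → ℝ := fun x => Θ x * ∫ s in (-a)..(x k), h x s with hWdef
    have hW : ContDiff ℝ ∞ W := hΘ.mul (contDiff_integral_to hh (contDiff_coord k) (-a))
    have hWk : ∀ x, partialDeriv k W x = Θ x * (Q x - θ (x k) * Q' x) := by
      intro x
      refine partialDeriv_of_line (hW.differentiable (by norm_num) x) ?_
      have h1 : ∀ r : ℝ, W (x + r • EuclideanSpace.single k (1 : ℝ))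
          = Θ x * ∫ s in (-a)..(x k + r), h x s := fun r => by
        simp only [hWdef, hΘk, hhk, add_smul_single_apply, if_true]
      simp only [h1]
      refine HasDerivAt.const_mul _ ?_
      have h2 : HasDerivAt (fun r => ∫ s in (-a)..r, h x s) (h x (x k + 0)) (x k + 0) :=
        ((hhc x).integral_hasStrictDerivAt _ _).hasDerivAt
      have h3 := h2.comp_const_add (x k) 0
      simpa [hhdef, setCoord_self] using h3
    have hW0 : ∀ x, (∃ i, a < |x i|) → W x = 0 := by
      rintro x ⟨i, hi⟩
      by_cases hiS : i ∈ S
      · simp only [hWdef, hΘdef]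
        rw [Finset.prod_eq_zero hiS (hθ0 _ hi), zero_mul]
      · suffices hI : ∫ s in (-a)..(x k), h x s = 0 by simp only [hWdef, hI, mul_zero]
        by_cases hik : i = k
        · subst hik
          rcases lt_abs.1 hi with hlt | hlt
          · rw [← intervalIntegral.integral_add_adjacent_intervals
              ((hhc x).intervalIntegrable (-a) a) ((hhc x).intervalIntegrable a (x i)), hhI,
              zero_add]
            refine intervalIntegral.integral_zero_ae (Filter.Eventually.of_forall fun s hs => ?_)
            rw [Set.uIoc_of_le hlt.le] at hs
            exact hhs x s (hs.1.trans_le (le_abs_self s))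
          · refine intervalIntegral.integral_zero_ae ?_
            -- For x_k < -a the integrand vanishes on the interval from x_k to -a except possibly at
            -- the endpoint -a, a null set.
            have hne : ∀ᵐ s : ℝ, s ≠ -a := by simp [ae_iff]
            filter_upwards [hne] with s hsa hs
            rw [Set.uIoc_of_ge (by linarith)] at hs
            refine hhs x s (lt_abs.2 (Or.inr ?_))
            have := lt_of_le_of_ne hs.2 hsa
            linarith
        · have : ∀ s, h x s = 0 := fun s => by
            simp only [hhdef]
            rw [hQ0 _ ⟨i, hiS, by rwa [setCoord_apply, if_neg hik]⟩, hQ'0 x ⟨i, by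
              simp [hik, hiS], hi⟩]
            ring
          simp [this]
    refine ⟨fun x => V x + W x • EuclideanSpace.single k (1 : ℝ), Q',
      hV.add (hW.smul contDiff_const), hQ', ?_, ?_, hQ'0, ?_⟩
    · intro x hx
      simp only [hV0 x hx, hW0 x hx, zero_smul, add_zero]
    · intro i hi x r
      rcases Finset.mem_insert.1 hi with rfl | hiS
      · exact hQ'k x r
      · have hki : k ≠ i := fun h => hk (h ▸ hiS)
        simp only [hQ'def, setCoord_add_ne x hki, hQi i hiS]
    · intro x
      have hVi : ∀ i, DifferentiableAt ℝ (fun y => V y i) x := fun i =>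
        ((contDiff_coord i).comp hV).differentiable (by norm_num) x
      have h1 : ∀ i, partialDeriv i
          (fun y => (V y + W y • (EuclideanSpace.single k (1 : ℝ) : 𝔼)) i) x
          = partialDeriv i (fun y => V y i) x + if i = k then partialDeriv k W x else 0 := by
        intro i
        simp only [add_smul_single_apply]
        split_ifs with hik
        · subst hik
          rw [partialDeriv, fderiv_fun_add (hVi i) (hW.differentiable (by norm_num) x)]
          rfl
        · rw [add_zero]
      rw [Finset.sum_congr rfl fun i _ => h1 i, Finset.sum_add_distrib,
        Finset.sum_ite_eq' Finset.univ k, if_pos (Finset.mem_univ k), hWk,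
        Finset.prod_insert hk, hFV x]
      ring

lemma isCompact_cube (z : 𝔼) (a : ℝ) : IsCompact {x : 𝔼 | ∀ i, |x i - z i| ≤ a} := by
  have h1 : {x : 𝔼 | ∀ i, |x i - z i| ≤ a} = (EuclideanSpace.equiv (Fin n) ℝ) ⁻¹'
      (Set.univ.pi fun i => Set.Icc (z i - a) (z i + a)) := by
    ext x
    simp only [Set.mem_ofPred_eq, Set.mem_preimage, Set.mem_univ_pi, Set.mem_Icc, abs_le]
    refine forall_congr' fun i => ?_
    change _ ↔ z i - a ≤ x i ∧ x i ≤ z i + a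
    constructor <;> rintro ⟨h1, h2⟩ <;> constructor <;> linarith
  rw [h1]
  exact (EuclideanSpace.equiv (Fin n) ℝ).toHomeomorph.isCompact_preimage.2
    (isCompact_univ_pi fun i => isCompact_Icc)

lemma exists_bump_of_interval {a : ℝ} (ha : 0 < a) : ∃ θ : ℝ → ℝ, ContDiff ℝ ∞ θ ∧
    (∀ s, a < |s| → θ s = 0) ∧ (∀ s, 0 ≤ θ s) ∧ 0 < θ 0 ∧ ∫ s in (-a)..a, θ s = 1 := by
  let f : ContDiffBump (0 : ℝ) := ⟨a / 2, a, by positivity, by linarith⟩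
  have hsupp : Function.support (f.normed volume) = Set.Ioo (-a) a := by
    rw [f.support_normed_eq, Real.ball_eq_Ioo]
    simp [f]
  refine ⟨f.normed volume, f.contDiff_normed, fun s hs => ?_, fun s => f.nonneg_normed s, ?_, ?_⟩
  · by_contra h
    have : s ∈ Set.Ioo (-a) a := hsupp ▸ h
    exact absurd (abs_lt.2 this) (not_lt.2 hs.le)
  · refine lt_of_le_of_ne (f.nonneg_normed 0) fun h => ?_
    have : (0 : ℝ) ∈ Function.support (f.normed volume) := hsupp ▸ ⟨by linarith, ha⟩
    exact this h.symm
  · rw [intervalIntegral.integral_eq_integral_of_support_subset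
      (hsupp ▸ Set.Ioo_subset_Ioc_self), f.integral_normed]

/-- A smooth function with zero integral supported in a cube is the divergence of a smooth field
supported in the cube. -/
theorem exists_primitive_cube_zero {a : ℝ} (ha : 0 < a) {F : 𝔼 → ℝ} (hF : ContDiff ℝ ∞ F)
    (hF0 : ∀ x, (∃ i, a < |x i|) → F x = 0) (hI : ∫ x, F x = 0) :
    ∃ V : 𝔼 → 𝔼, ContDiff ℝ ∞ V ∧ (∀ x, (∃ i, a < |x i|) → V x = 0) ∧
      ∀ x, F x = ∑ i, partialDeriv i (fun y => V y i) x := by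
  obtain ⟨θ, hθ, hθ0, hθn, hθp, hθ1⟩ := exists_bump_of_interval ha
  obtain ⟨V, Q, hV, hQ, hV0, hQi, -, hFV⟩ :=
    exists_partial_primitive hθ hθ0 hθ1 hF hF0 Finset.univ
  have hcube : ∀ {G : 𝔼 → ℝ}, (∀ x, (∃ i, a < |x i|) → G x = 0) → HasCompactSupport G := by
    intro G hG
    refine HasCompactSupport.intro (isCompact_cube 0 a) fun x hx => hG x ?_
    simpa using hx
  have hVi : ∀ i, ContDiff ℝ ∞ fun y => V y i := fun i => (contDiff_coord i).comp hV
  have hVc : ∀ i, HasCompactSupport fun y => V y i := fun i => hcube fun x hx => by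
    rw [hV0 x hx]; rfl
  -- With every coordinate integrated out, Q is constant. Integrating the decomposition then kills
  -- the divergences and leaves Q(0) ∫Θ = ∫F = 0, so Q = 0.
  have hQc : ∀ x, Q x = Q 0 := by
    intro x
    have h1 : ∀ S : Finset (Fin n), Q (∑ i ∈ S, x i • EuclideanSpace.single i (1 : ℝ)) = Q 0 := by
      intro S
      induction S using Finset.induction_on with
      | empty => simp
      | insert k S hk ih =>
        rw [Finset.sum_insert hk, add_comm, hQi k (Finset.mem_univ k), ih]
    have h2 := (EuclideanSpace.basisFun (Fin n) ℝ).sum_repr x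
    simp only [EuclideanSpace.basisFun_apply, EuclideanSpace.basisFun_repr] at h2
    rw [← h1 Finset.univ, h2]
  set Θ : 𝔼 → ℝ := fun x => ∏ i, θ (x i) with hΘdef
  have hΘ : ContDiff ℝ ∞ Θ := contDiff_prod fun i _ => hθ.comp (contDiff_coord i)
  have hΘc : HasCompactSupport Θ := hcube fun x ⟨i, hi⟩ =>
    Finset.prod_eq_zero (Finset.mem_univ i) (hθ0 _ hi)
  have hpos : 0 < ∫ x, Θ x := by
    refine hΘ.continuous.integral_pos_of_hasCompactSupport_nonneg_nonzero hΘc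
      (fun x => Finset.prod_nonneg fun i _ => hθn _) (x := 0) ?_
    exact (Finset.prod_pos fun i _ => hθp).ne'
  have hc : Q 0 = 0 := by
    have h1 : ∫ x, F x = Q 0 * ∫ x, Θ x := by
      have h2 : ∀ x, F x = ∑ i, partialDeriv i (fun y => V y i) x + Q 0 * Θ x := fun x => by
        rw [hFV x, hQc x, mul_comm]
      have h3 : ∀ i, Integrable fun x => partialDeriv i (fun y => V y i) x := fun i =>
        (((hVi i).continuous_fderiv (by norm_num)).clm_apply
          continuous_const).integrable_of_hasCompactSupport ((hVc i).fderiv_apply (𝕜 := ℝ) _)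
      simp only [h2]
      rw [integral_add (integrable_finsetSum _ fun i _ => h3 i)
        ((hΘ.continuous.integrable_of_hasCompactSupport hΘc).const_mul _),
        integral_finsetSum _ fun i _ => h3 i, integral_const_mul,
        Finset.sum_eq_zero (f := fun i => ∫ x, partialDeriv i (fun y => V y i) x) fun i _ =>
          integral_fderiv_eq_zero ((hVi i).of_le (by norm_cast)) (hVc i) _, zero_add]
    rw [hI] at h1
    exact (mul_eq_zero.1 h1.symm).resolve_right hpos.ne'
  exact ⟨V, hV, hV0, fun x => by rw [hFV x, hQc x, hc, mul_zero, add_zero]⟩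

theorem exists_primitive_cube (z : 𝔼) {a : ℝ} (ha : 0 < a) {F : 𝔼 → ℝ} (hF : ContDiff ℝ ∞ F)
    (hF0 : ∀ x, (∃ i, a < |x i - z i|) → F x = 0) (hI : ∫ x, F x = 0) :
    ∃ V : 𝔼 → 𝔼, ContDiff ℝ ∞ V ∧ (∀ x, (∃ i, a < |x i - z i|) → V x = 0) ∧
      ∀ x, F x = ∑ i, partialDeriv i (fun y => V y i) x := by
  obtain ⟨V, hV, hV0, hFV⟩ := exists_primitive_cube_zero ha
    (hF.comp (contDiff_id.add (contDiff_const (c := z))))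
    (fun x ⟨i, hi⟩ => hF0 _ ⟨i, by simpa using hi⟩)
    (by rw [← hI]; exact integral_add_right_eq_self F z)
  refine ⟨fun x => V (x - z), hV.comp (contDiff_id.sub contDiff_const), fun x ⟨i, hi⟩ =>
    hV0 _ ⟨i, by simpa using hi⟩, fun x => ?_⟩
  have h1 := hFV (x - z)
  simp only [Function.comp, id, sub_add_cancel] at h1
  rw [h1]
  refine Finset.sum_congr rfl fun i _ => ?_
  rw [partialDeriv, partialDeriv]
  rw [fderiv_comp_sub (f := fun y => V y i) z]

end Box

/-! ### Every smooth mean-zero function is a divergence. -/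

section Surjectivity

open MeasureTheory

variable {n : ℕ}

local notation "𝔼" => EuclideanSpace ℝ (Fin n)

variable {M : Type*} [TopologicalSpace M] [ChartedSpace (EuclideanSpace ℝ (Fin n)) M]
  [IsManifold (𝓡 n) ∞ M]

/-- `q` is the divergence of a smooth vector field. -/
def IsDivergence (g : SmoothMetric n M) (q : M → ℝ) : Prop :=
  ∃ v : (x : M) → TangentSpace (𝓡 n) x, IsSmoothField v ∧ ∀ x, divergence g v x = q x

lemma IsDivergence.add {g : SmoothMetric n M} {q r : M → ℝ} (hq : IsDivergence g q)
    (hr : IsDivergence g r) : IsDivergence g fun x => q x + r x := by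
  obtain ⟨v, hv, hvq⟩ := hq
  obtain ⟨w, hw, hwr⟩ := hr
  exact ⟨_, isSmoothField_add hv hw, fun x => by rw [divergence_add g hv hw, hvq, hwr]⟩

lemma IsDivergence.const_mul {g : SmoothMetric n M} {q : M → ℝ} (hq : IsDivergence g q) (c : ℝ) :
    IsDivergence g fun x => c * q x := by
  obtain ⟨v, hv, hvq⟩ := hq
  exact ⟨_, isSmoothField_smul contMDiff_const hv, fun x => by
    rw [divergence_const_smul g c hv, hvq]⟩

lemma IsDivergence.sum {g : SmoothMetric n M} {ι : Type*} {t : Finset ι} {q : ι → M → ℝ}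
    (hq : ∀ i ∈ t, IsDivergence g (q i)) : IsDivergence g fun x => ∑ i ∈ t, q i x := by
  have h : ∀ i, ∃ v : (x : M) → TangentSpace (𝓡 n) x, i ∈ t → IsSmoothField v ∧
      ∀ x, divergence g v x = q i x := fun i => by
    by_cases hi : i ∈ t
    · obtain ⟨v, hv⟩ := hq i hi
      exact ⟨v, fun _ => hv⟩
    · exact ⟨fun _ => 0, fun h => absurd h hi⟩
  choose v hv using h
  refine ⟨_, isSmoothField_sum t fun i hi => (hv i hi).1, fun x => ?_⟩
  rw [divergence_sum g t fun i hi => (hv i hi).1]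
  exact Finset.sum_congr rfl fun i hi => (hv i hi).2 x

variable [T2Space M] [MeasurableSpace M] [BorelSpace M]

/-- In the chart the equation is div_euclid(√g v) = √g q. The right side has zero Lebesgue integral
and lies in the cube, so a Euclidean primitive V supported there exists and v = V/√g extends by
zero. -/
lemma isDivergence_of_cube (g : SmoothMetric n M) {p : M} {z : 𝔼} {a : ℝ} (ha : 0 < a)
    (hcube : {y : 𝔼 | ∀ i, |y i - z i| ≤ a} ⊆ (extChartAt (𝓡 n) p).target) {q : M → ℝ}
    (hq : ContMDiff (𝓡 n) 𝓘(ℝ, ℝ) ∞ q)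
    (hq0 : ∀ x ∉ (extChartAt (𝓡 n) p).symm '' {y : 𝔼 | ∀ i, |y i - z i| ≤ a}, q x = 0)
    (hI : ∫ x, q x ∂(riemVolume g) = 0) : IsDivergence g q := by
  set K : Set 𝔼 := {y : 𝔼 | ∀ i, |y i - z i| ≤ a} with hKdef
  have hK : IsCompact K := isCompact_cube z a
  have hKM : IsCompact ((extChartAt (𝓡 n) p).symm '' K) :=
    hK.image_of_continuousOn ((continuousOn_extChartAt_symm p).mono hcube)
  have hKs : (extChartAt (𝓡 n) p).symm '' K ⊆ (extChartAt (𝓡 n) p).source := by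
    rintro _ ⟨y, hy, rfl⟩
    exact (extChartAt (𝓡 n) p).map_target (hcube hy)
  have hΩ := isOpen_extChartAt_target (I := 𝓡 n) p
  have hnotK : ∀ y : 𝔼, y ∉ K ↔ ∃ i, a < |y i - z i| := fun y => by simp [hKdef]
  set F : 𝔼 → ℝ := (extChartAt (𝓡 n) p).target.indicator
    fun y => volDensity g p y * q ((extChartAt (𝓡 n) p).symm y) with hFdef
  have hFt : ∀ y ∈ (extChartAt (𝓡 n) p).target,
      F y = volDensity g p y * q ((extChartAt (𝓡 n) p).symm y) :=
    fun y hy => Set.indicator_of_mem hy _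
  have hF0 : ∀ y ∉ K, F y = 0 := by
    intro y hy
    by_cases hyt : y ∈ (extChartAt (𝓡 n) p).target
    · rw [hFt y hyt, hq0, mul_zero]
      rintro ⟨y', hy', h⟩
      exact hy ((extChartAt (𝓡 n) p).symm.injOn (hcube hy') hyt h ▸ hy')
    · exact Set.indicator_of_notMem hyt _
  have hF : ContDiff ℝ ∞ F :=
    contDiff_of_eq_zero_off hΩ hK.isClosed hcube
      (((contDiffOn_volDensity g p).mul (contDiffOn_comp_symm hq p)).congr hFt) hF0
  have hFI : ∫ y, F y = 0 := by
    rw [← hI, integral_riemVolume_eq g p hq.continuous fun x hx => hq0 x fun h => hx (hKs h),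
      hFdef, integral_indicator (measurableSet_target p)]
  obtain ⟨V, hV, hV0, hFV⟩ := exists_primitive_cube z ha hF
    (fun y hy => hF0 y ((hnotK y).2 hy)) hFI
  set v := chartField p fun y => (volDensity g p y)⁻¹ • V y with hv
  have hvs : IsSmoothField v := by
    refine isSmoothField_chartField hK hcube ?_ fun y hy => by
      rw [hV0 y ((hnotK y).1 hy), smul_zero]
    exact ((contDiffOn_volDensity g p).inv fun y hy => (volDensity_pos g hy).ne').smul
      hV.contDiffOn
  refine ⟨v, hvs, fun x => ?_⟩
  by_cases hx : x ∈ (extChartAt (𝓡 n) p).source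
  · obtain ⟨y, hy, rfl⟩ : ∃ y ∈ (extChartAt (𝓡 n) p).target, (extChartAt (𝓡 n) p).symm y = x :=
      ⟨_, (extChartAt (𝓡 n) p).map_source hx, (extChartAt (𝓡 n) p).left_inv hx⟩
    rw [divergence_eq_chart g hvs hx, (extChartAt (𝓡 n) p).right_inv hy, densityDiv]
    have h1 : ∀ i, partialDeriv i (fun y => volDensity g p y * fieldRep v p y i) y
        = partialDeriv i (fun y => V y i) y := by
      intro i
      have h2 : (fun y => volDensity g p y * fieldRep v p y i) =ᶠ[𝓝 y] fun y => V y i := by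
        filter_upwards [hΩ.mem_nhds hy] with y' hy'
        rw [hv, fieldRep_chartField hy', PiLp.smul_apply, smul_eq_mul,
          mul_inv_cancel_left₀ (volDensity_pos g hy').ne']
      rw [partialDeriv, partialDeriv, h2.fderiv_eq]
    rw [Finset.sum_congr rfl fun i _ => h1 i, ← hFV, hFt y hy,
      inv_mul_cancel_left₀ (volDensity_pos g hy).ne']
  · have hxK : x ∉ (extChartAt (𝓡 n) p).symm '' K := fun h => hx (hKs h)
    rw [hq0 x hxK]
    refine divergence_eq_zero_of_eventually g ?_
    filter_upwards [hKM.isClosed.isOpen_compl.mem_nhds hxK] with x' hx'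
    refine chartField_eq_zero fun hs => ?_
    rw [hV0, smul_zero]
    exact (hnotK _).1 fun h => hx' ⟨_, h, (extChartAt (𝓡 n) p).left_inv hs⟩

lemma exists_nhd_isDivergence (g : SmoothMetric n M) (p : M) :
    ∃ B : Set M, IsOpen B ∧ p ∈ B ∧ ∀ q : M → ℝ, ContMDiff (𝓡 n) 𝓘(ℝ, ℝ) ∞ q → tsupport q ⊆ B →
      ∫ x, q x ∂(riemVolume g) = 0 → IsDivergence g q := by
  set z := extChartAt (𝓡 n) p p with hz
  obtain ⟨a, ha, hcube⟩ : ∃ a > 0,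
      {y : 𝔼 | ∀ i, |y i - z i| ≤ a} ⊆ (extChartAt (𝓡 n) p).target := by
    have h1 : (EuclideanSpace.equiv (Fin n) ℝ).symm ⁻¹' (extChartAt (𝓡 n) p).target
        ∈ 𝓝 (EuclideanSpace.equiv (Fin n) ℝ z) := by
      refine (EuclideanSpace.equiv (Fin n) ℝ).symm.continuous.continuousAt.preimage_mem_nhds ?_
      rw [ContinuousLinearEquiv.symm_apply_apply]
      exact extChartAt_target_mem_nhds p
    obtain ⟨a, ha, h⟩ := Metric.nhds_basis_closedBall.mem_iff.1 h1
    refine ⟨a, ha, fun y hy => ?_⟩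
    have h2 : EuclideanSpace.equiv (Fin n) ℝ y
        ∈ Metric.closedBall (EuclideanSpace.equiv (Fin n) ℝ z) a := by
      rw [Metric.mem_closedBall, dist_pi_le_iff ha.le]
      exact fun i => hy i
    simpa using h h2
  have hO : IsOpen {y : 𝔼 | ∀ i, |y i - z i| < a} := by
    simp only [Set.ofPred_forall]
    refine isOpen_iInter_of_finite fun i => ?_
    exact isOpen_lt (((contDiff_coord i).continuous.sub continuous_const).abs) continuous_const
  refine ⟨(extChartAt (𝓡 n) p).source ∩ extChartAt (𝓡 n) p ⁻¹' {y : 𝔼 | ∀ i, |y i - z i| < a},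
    (continuousOn_extChartAt p).isOpen_inter_preimage (isOpen_extChartAt_source p) hO,
    ⟨mem_extChartAt_source p, fun i => by rw [← hz, sub_self, abs_zero]; exact ha⟩, fun q hq hqB hI => ?_⟩
  refine isDivergence_of_cube g ha hcube hq (fun x hx => ?_) hI
  by_contra hqx
  obtain ⟨hxs, hx2⟩ := hqB (subset_tsupport q hqx)
  exact hx ⟨_, fun i => (hx2 i).le, (extChartAt (𝓡 n) p).left_inv hxs⟩

lemma exists_bump_integral_one [CompactSpace M] (g : SmoothMetric n M) {U : Set M} (hU : IsOpen U)
    {x : M} (hx : x ∈ U) : ∃ b : M → ℝ, ContMDiff (𝓡 n) 𝓘(ℝ, ℝ) ∞ b ∧ tsupport b ⊆ U ∧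
      ∫ z, b z ∂(riemVolume g) = 1 := by
  have hfin := isFiniteMeasure_riemVolume g
  have hpos := isOpenPosMeasure_riemVolume g
  obtain ⟨f, -, hf⟩ := (SmoothBumpFunction.nhds_basis_tsupport (I := 𝓡 n) x).mem_iff.1
    (hU.mem_nhds hx)
  have hI : 0 < ∫ z, f z ∂(riemVolume g) := by
    refine f.contMDiff.continuous.integral_pos_of_hasCompactSupport_nonneg_nonzero
      (HasCompactSupport.of_compactSpace _) (fun z => f.nonneg) (x := x) ?_
    rw [f.eq_one]
    exact one_ne_zero
  refine ⟨fun z => (∫ z, f z ∂(riemVolume g))⁻¹ * f z, contMDiff_const.mul f.contMDiff,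
    (closure_mono fun z hz => ?_).trans hf, ?_⟩
  · exact right_ne_zero_of_mul hz
  · rw [integral_const_mul, inv_mul_cancel₀ hI.ne']

/-- On a closed connected manifold, every smooth function with zero mean is the divergence of a
smooth vector field. -/
theorem isDivergence_of_integral_eq_zero [CompactSpace M] [ConnectedSpace M]
    (g : SmoothMetric n M) {q : M → ℝ} (hq : ContMDiff (𝓡 n) 𝓘(ℝ, ℝ) ∞ q)
    (hI : ∫ x, q x ∂(riemVolume g) = 0) : IsDivergence g q := by
  have hfin := isFiniteMeasure_riemVolume g
  have hint : ∀ {r : M → ℝ}, ContMDiff (𝓡 n) 𝓘(ℝ, ℝ) ∞ r → Integrable r (riemVolume g) :=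
    fun hr => hr.continuous.integrable_of_hasCompactSupport (HasCompactSupport.of_compactSpace _)
  choose B hB hBx hBdiv using exists_nhd_isDivergence g
  obtain ⟨x₀⟩ : Nonempty M := inferInstance
  obtain ⟨b₀, hb₀, hb₀s, hb₀I⟩ := exists_bump_integral_one g (hB x₀) (hBx x₀)
  -- Subtracting the right multiple of a bump of integral 1 makes the mean zero while keeping the
  -- support in B p. Modulo divergences, r is its mass times b.
  have htransport : ∀ {p : M} {b : M → ℝ}, ContMDiff (𝓡 n) 𝓘(ℝ, ℝ) ∞ b → tsupport b ⊆ B p →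
      ∫ x, b x ∂(riemVolume g) = 1 → ∀ r : M → ℝ, ContMDiff (𝓡 n) 𝓘(ℝ, ℝ) ∞ r →
      tsupport r ⊆ B p →
      IsDivergence g fun x => r x + -(∫ x, r x ∂(riemVolume g)) * b x := by
    intro p b hb hbs hbI r hr hrs
    refine hBdiv p _ (hr.add (contMDiff_const.mul hb)) ?_ ?_
    · refine (tsupport_add _ _).trans (Set.union_subset hrs ?_)
      exact (tsupport_mul_subset_right).trans hbs
    · rw [integral_add (hint hr) ((hint hb).const_mul _), integral_const_mul, hbI]
      ring
  -- Points near which any function is, modulo divergences, its mass times the fixed bump b₀. The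
  -- set is open by construction. For closedness, a bump b in the overlap of U and B x relays the
  -- mass: r to (∫r) b, then to (∫r) b₀.
  let good : Set M := {x | ∃ U : Set M, IsOpen U ∧ x ∈ U ∧ ∀ r : M → ℝ,
    ContMDiff (𝓡 n) 𝓘(ℝ, ℝ) ∞ r → tsupport r ⊆ U →
      IsDivergence g fun x => r x + -(∫ x, r x ∂(riemVolume g)) * b₀ x}
  have hopen : IsOpen good := isOpen_iff_mem_nhds.2 fun x ⟨U, hU, hx, h⟩ =>
    Filter.mem_of_superset (hU.mem_nhds hx) fun y hy => ⟨U, hU, hy, h⟩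
  have hclosed : IsClosed good := by
    refine isClosed_of_closure_subset fun x hx => ?_
    obtain ⟨y, hyB, U, hU, hyU, h⟩ := mem_closure_iff.1 hx (B x) (hB x) (hBx x)
    obtain ⟨b, hb, hbs, hbI⟩ := exists_bump_integral_one g (hU.inter (hB x)) ⟨hyU, hyB⟩
    refine ⟨B x, hB x, hBx x, fun r hr hrs => ?_⟩
    have h1 := htransport hb (hbs.trans Set.inter_subset_right) hbI r hr hrs
    have h2 := (h b hb (hbs.trans Set.inter_subset_left)).const_mul (∫ x, r x ∂(riemVolume g))
    have h3 := h1.add h2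
    rw [hbI] at h3
    convert! h3 using 2
    ring
  have huniv : good = Set.univ :=
    IsClopen.eq_univ ⟨hclosed, hopen⟩ ⟨x₀, B x₀, hB x₀, hBx x₀, htransport hb₀ hb₀s hb₀I⟩
  have hall : ∀ x, x ∈ good := fun x => huniv ▸ Set.mem_univ x
  choose U hU hxU hdiv using hall
  obtain ⟨t, f, hf, hfU, hsum⟩ := exists_smooth_partition (n := n) U hU hxU
  have h1 : ∀ p ∈ t, IsDivergence g fun x => f p x * q x
      + -(∫ x, f p x * q x ∂(riemVolume g)) * b₀ x := fun p _ =>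
    hdiv p (fun x => f p x * q x) ((hf p).mul hq) ((tsupport_mul_subset_left).trans (hfU p))
  have h2 := IsDivergence.sum h1
  convert! h2 using 2 with x
  -- The masses of the pieces f_p q add up to ∫q = 0, so the multiples of b₀ cancel in the sum over
  -- the partition of unity.
  have h3 : ∑ p ∈ t, ∫ x, f p x * q x ∂(riemVolume g) = 0 := by
    have h4 : ∀ p ∈ t, Integrable (fun x => f p x * q x) (riemVolume g) :=
      fun p _ => hint ((hf p).mul hq)
    rw [← integral_finsetSum _ h4, ← hI]
    refine integral_congr_ae (Filter.Eventually.of_forall fun x => ?_)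
    simp only
    rw [← Finset.sum_mul, hsum, one_mul]
  rw [Finset.sum_add_distrib, ← Finset.sum_mul, ← Finset.sum_mul, hsum, Finset.sum_neg_distrib, h3]
  ring

end Surjectivity

/-! ### Differentiation of integrals in time, and conservation of energy. -/

section TimeDerivative

open MeasureTheory

variable {n : ℕ}

local notation "𝔼" => EuclideanSpace ℝ (Fin n)

variable {M : Type*} [TopologicalSpace M] [ChartedSpace (EuclideanSpace ℝ (Fin n)) M]
  [IsManifold (𝓡 n) ∞ M]

/-- Smoothness over `S × M` of a function on `ℝ × M`. -/
abbrev SmoothOver (n : ℕ) {M : Type*} [TopologicalSpace M]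
    [ChartedSpace (EuclideanSpace ℝ (Fin n)) M] (S : Set ℝ) (f : ℝ × M → ℝ) : Prop :=
  ContMDiffOn (𝓘(ℝ, ℝ).prod (𝓡 n)) 𝓘(ℝ, ℝ) ∞ f (S ×ˢ Set.univ)

lemma SmoothOver.contDiffOn_chart {f : ℝ × M → ℝ} {S : Set ℝ} (hf : SmoothOver n S f) (p : M) :
    ContDiffOn ℝ ∞ (fun z : ℝ × 𝔼 => f (z.1, (extChartAt (𝓡 n) p).symm z.2))
      (S ×ˢ (extChartAt (𝓡 n) p).target) := by
  have h1 : ContMDiffOn (𝓘(ℝ, ℝ).prod 𝓘(ℝ, 𝔼)) (𝓘(ℝ, ℝ).prod (𝓡 n)) ∞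
      (fun z : ℝ × 𝔼 => (z.1, (extChartAt (𝓡 n) p).symm z.2))
      (S ×ˢ (extChartAt (𝓡 n) p).target) :=
    contMDiffOn_fst.prodMk ((contMDiffOn_extChartAt_symm p).comp contMDiffOn_snd fun z hz => hz.2)
  have h2 := ContMDiffOn.comp hf h1 (fun z hz => ⟨hz.1, Set.mem_univ _⟩)
  rw [← contMDiffOn_iff_contDiffOn, modelWithCornersSelf_prod, ← chartedSpaceSelf_prod]
  exact h2

lemma SmoothOver.hasDerivWithinAt_chart {f : ℝ × M → ℝ} {S : Set ℝ} (hf : SmoothOver n S f)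
    {p : M} {t : ℝ} (ht : t ∈ S) {y : 𝔼} (hy : y ∈ (extChartAt (𝓡 n) p).target) :
    HasDerivWithinAt (fun s => f (s, (extChartAt (𝓡 n) p).symm y))
      (fderivWithin ℝ (fun z : ℝ × 𝔼 => f (z.1, (extChartAt (𝓡 n) p).symm z.2))
        (S ×ˢ (extChartAt (𝓡 n) p).target) (t, y) (1, 0)) S t := by
  have h1 := ((hf.contDiffOn_chart p).differentiableOn (by norm_num) (t, y)
    ⟨ht, hy⟩).hasFDerivWithinAt
  have h2 : HasDerivWithinAt (fun s : ℝ => (s, y)) ((1 : ℝ), (0 : 𝔼)) S t :=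
    ((hasDerivAt_id t).prodMk (hasDerivAt_const t y)).hasDerivWithinAt
  exact HasFDerivWithinAt.comp_hasDerivWithinAt (f := fun s : ℝ => (s, y)) t h1 h2
    fun s hs => ⟨hs, hy⟩

lemma SmoothOver.hasDerivWithinAt {f : ℝ × M → ℝ} {S : Set ℝ} (hf : SmoothOver n S f)
    {t : ℝ} (ht : t ∈ S) (x : M) :
    HasDerivWithinAt (fun s => f (s, x)) (derivWithin (fun s => f (s, x)) S t) S t := by
  have h := hf.hasDerivWithinAt_chart ht (mem_extChartAt_target (I := 𝓡 n) x)
  rw [extChartAt_to_inv] at h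
  exact h.differentiableWithinAt.hasDerivWithinAt

lemma SmoothOver.derivWithin {f : ℝ × M → ℝ} {S : Set ℝ} (hf : SmoothOver n S f)
    (hS : UniqueDiffOn ℝ S) :
    SmoothOver n S fun z => derivWithin (fun s => f (s, z.2)) S z.1 := by
  rintro ⟨t, x⟩ ⟨ht, -⟩
  have hd : ContDiffOn ℝ ∞ (fun z : ℝ × 𝔼 => fderivWithin ℝ
      (fun z : ℝ × 𝔼 => f (z.1, (extChartAt (𝓡 n) x).symm z.2))
        (S ×ˢ (extChartAt (𝓡 n) x).target) z (1, 0)) (S ×ˢ (extChartAt (𝓡 n) x).target) :=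
    ((hf.contDiffOn_chart x).fderivWithin (hS.prod (isOpen_extChartAt_target x).uniqueDiffOn)
      (by simp)).clm_apply contDiffOn_const
  refine contMDiffWithinAt_of_chart hd (fun t ht x' hx' => ?_) ht (mem_extChartAt_source x)
  have h := (hf.hasDerivWithinAt_chart ht ((extChartAt (𝓡 n) x).map_source hx')).derivWithin
    (hS t ht)
  rwa [(extChartAt (𝓡 n) x).left_inv hx'] at h

variable [CompactSpace M] [T2Space M] [MeasurableSpace M] [BorelSpace M]

omit [IsManifold (𝓡 n) ∞ M] [CompactSpace M] [T2Space M] [MeasurableSpace M] [BorelSpace M] in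
lemma SmoothOver.continuous_slice {f : ℝ × M → ℝ} {S : Set ℝ} (hf : SmoothOver n S f) {t : ℝ}
    (ht : t ∈ S) : Continuous fun x => f (t, x) :=
  ContinuousOn.comp_continuous (ContMDiffOn.continuousOn hf) (by fun_prop)
    fun x => ⟨ht, Set.mem_univ _⟩

omit [T2Space M] in
lemma SmoothOver.hasDerivAt_integral (g : SmoothMetric n M) {f : ℝ × M → ℝ} {S : Set ℝ}
    (hf : SmoothOver n S f) (hS : UniqueDiffOn ℝ S) {t : ℝ} (ht : S ∈ 𝓝 t) :
    HasDerivAt (fun s => ∫ x, f (s, x) ∂(riemVolume g))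
      (∫ x, _root_.derivWithin (fun s => f (s, x)) S t ∂(riemVolume g)) t := by
  have hfin := isFiniteMeasure_riemVolume g
  have hd := hf.derivWithin hS
  obtain ⟨ε, hε, hεS⟩ := Metric.nhds_basis_closedBall.mem_iff.1 (interior_mem_nhds.2 ht)
  have hball : Metric.closedBall t ε ⊆ S := hεS.trans interior_subset
  obtain ⟨C, hC⟩ := ((isCompact_closedBall t ε).prod
    (isCompact_univ (X := M))).exists_bound_of_continuousOn
      ((ContMDiffOn.continuousOn hd).mono (Set.prod_mono_left hball))
  have hint : ∀ {h : M → ℝ}, Continuous h → Integrable h (riemVolume g) := fun hh =>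
    hh.integrable_of_hasCompactSupport (HasCompactSupport.of_compactSpace _)
  have htS : t ∈ S := mem_of_mem_nhds ht
  refine (hasDerivAt_integral_of_dominated_loc_of_deriv_le (bound := fun _ => C)
    (F := fun s x => f (s, x)) (F' := fun s x => _root_.derivWithin (fun s => f (s, x)) S s)
    (Metric.closedBall_mem_nhds t hε) ?_ (hint (hf.continuous_slice htS))
    (hd.continuous_slice htS).aestronglyMeasurable ?_ (integrable_const C) ?_).2
  · filter_upwards [ht] with s hs using (hf.continuous_slice hs).aestronglyMeasurable
  · exact Filter.Eventually.of_forall fun x s hs => hC (s, x) ⟨hs, Set.mem_univ _⟩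
  · exact Filter.Eventually.of_forall fun x s hs => (hf.hasDerivWithinAt (hball hs) x).hasDerivAt
      (mem_interior_iff_mem_nhds.1 (hεS hs))

omit [T2Space M] in
-- The mean value theorem on [0, t]: a two-sided derivative of the integral is needed only at
-- interior times, and at 0 continuity suffices.
lemma SmoothOver.integral_eq_of_derivWithin (g : SmoothMetric n M) {f : ℝ × M → ℝ} {T : ℝ}
    (hf : SmoothOver n (Set.Ico 0 T) f)
    (h0 : ∀ t ∈ Set.Ico 0 T,
      ∫ x, _root_.derivWithin (fun s => f (s, x)) (Set.Ico 0 T) t ∂(riemVolume g) = 0)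
    {t : ℝ} (ht : t ∈ Set.Ico 0 T) :
    ∫ x, f (t, x) ∂(riemVolume g) = ∫ x, f (0, x) ∂(riemVolume g) := by
  have hfin := isFiniteMeasure_riemVolume g
  rcases ht.1.eq_or_lt with rfl | h0t
  · rfl
  have hc : ContinuousOn (fun s => ∫ x, f (s, x) ∂(riemVolume g)) (Set.Icc 0 t) :=
    continuousOn_integral_of_compact_support (f := fun s x => f (s, x)) (k := Set.univ)
      isCompact_univ ((ContMDiffOn.continuousOn hf).mono
        (Set.prod_mono_left fun s hs => ⟨hs.1, hs.2.trans_lt ht.2⟩))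
      fun _ x _ hx => absurd (Set.mem_univ x) hx
  have hd : ∀ s ∈ Set.Ioo 0 t, HasDerivAt (fun s => ∫ x, f (s, x) ∂(riemVolume g)) 0 s := by
    intro s hs
    have hsT : Set.Ico 0 T ∈ 𝓝 s := Ico_mem_nhds hs.1 (hs.2.trans ht.2)
    have h := hf.hasDerivAt_integral g (uniqueDiffOn_Ico 0 T) hsT
    rwa [h0 s (mem_of_mem_nhds hsT)] at h
  obtain ⟨c, hc, hslope⟩ := exists_hasDerivAt_eq_slope _ (fun _ => 0) h0t hc hd
  have := (div_eq_zero_iff.1 hslope.symm).resolve_right (by linarith)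
  linarith

/-- The energy `∫ ρ²` is constant as soon as `ρ_t + u · ∇ρ + ρ²/2` is constant in space. -/
theorem integral_sq_divergence_eq (g : SmoothMetric n M) {T : ℝ}
    {u : ℝ → (x : M) → TangentSpace (𝓡 n) x} (hu : IsSmoothFamily (Set.Ico 0 T) u) {c : ℝ → ℝ}
    (heq : ∀ t ∈ Set.Ico 0 T, ∀ x : M,
      derivWithin (fun s => divergence g (u s) x) (Set.Ico 0 T) t
        + dirDeriv (divergence g (u t)) x (u t x) + (1 / 2) * divergence g (u t) x ^ 2 = c t)
    {t : ℝ} (ht : t ∈ Set.Ico 0 T) :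
    ∫ x, divergence g (u t) x ^ 2 ∂(riemVolume g)
      = ∫ x, divergence g (u 0) x ^ 2 ∂(riemVolume g) := by
  have hfin := isFiniteMeasure_riemVolume g
  have hρ : SmoothOver n (Set.Ico 0 T) fun z : ℝ × M => divergence g (u z.1) z.2 :=
    hu.contMDiffOn_divergence g (uniqueDiffOn_Ico 0 T)
  have hρ2 : SmoothOver n (Set.Ico 0 T) fun z : ℝ × M => divergence g (u z.1) z.2 ^ 2 :=
    ContMDiffOn.pow hρ 2
  refine hρ2.integral_eq_of_derivWithin g (fun t ht => ?_) ht
  have hut := hu.isSmoothField ht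
  have hdiv := contMDiff_divergence g hut
  have hdiv2 : ContMDiff (𝓡 n) 𝓘(ℝ, ℝ) ∞ fun x => divergence g (u t) x ^ 2 := hdiv.pow 2
  have hsm := isSmoothField_smul hdiv2 hut
  -- Since div(ρ²u) = ρ³ + 2ρ u·∇ρ, the equation gives (ρ²)_t = 2cρ - div(ρ²u). Both terms integrate
  -- to zero: c is constant in space, and ρ itself is a divergence.
  have h1 : ∀ x, derivWithin (fun s => divergence g (u s) x ^ 2) (Set.Ico 0 T) t
      = 2 * c t * divergence g (u t) x
        - divergence g (fun x => divergence g (u t) x ^ 2 • u t x) x := by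
    intro x
    have h2 := ((hρ.hasDerivWithinAt ht x).fun_pow 2).derivWithin (uniqueDiffOn_Ico 0 T t ht)
    have h3 : dirDeriv (fun x => divergence g (u t) x ^ 2) x (u t x)
        = 2 * divergence g (u t) x * dirDeriv (divergence g (u t)) x (u t x) := by
      have hx := mem_extChartAt_source (I := 𝓡 n) x
      rw [dirDeriv_eq_chart (hdiv2.mdifferentiableAt (by norm_num)) hx,
        dirDeriv_eq_chart (hdiv.mdifferentiableAt (by norm_num)) hx]
      have h4 := (((contDiffOn_comp_symm hdiv x).contDiffAt ((isOpen_extChartAt_target x).mem_nhds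
        (mem_extChartAt_target x))).differentiableAt (by norm_num)).hasFDerivAt.pow 2
      rw [h4.fderiv]
      simp only [smul_apply, smul_eq_mul, extChartAt_to_inv]
      norm_num
    rw [divergence_smul g hdiv2 hut, h3, h2, ← heq t ht x]
    push_cast
    ring
  have hint : ∀ {h : M → ℝ}, Continuous h → Integrable h (riemVolume g) := fun hh =>
    hh.integrable_of_hasCompactSupport (HasCompactSupport.of_compactSpace _)
  simp only [h1]
  rw [integral_sub ((hint hdiv.continuous).const_mul _)
    (hint (contMDiff_divergence g hsm).continuous), integral_const_mul, integral_divergence g hut,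
    integral_divergence g hsm]
  simp

end TimeDerivative

/-! ### Evolution of the spatial minimum. -/

section Comparison

/-- Let m(s) be the minimum of F(s, ·) and x a minimizer at time s. For later z, m(z) - m(s) ≤ F(z,
x) - F(s, x), so the right Dini derivatives of m are at most 0 and m does not increase. No
differentiability of m and no continuous choice of minimizers are needed. -/
lemma exists_le_of_hasDerivWithinAt_min {X : Type*} [TopologicalSpace X] [CompactSpace X]
    [Nonempty X] {F : ℝ × X → ℝ} {T : ℝ} (hF : ContinuousOn F (Set.Ico 0 T ×ˢ Set.univ))
    (hd : ∀ t ∈ Set.Ico 0 T, ∀ x, (∀ y, F (t, x) ≤ F (t, y)) →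
      HasDerivWithinAt (fun s => F (s, x)) 0 (Set.Ici t) t) {t : ℝ} (ht : t ∈ Set.Ico 0 T) :
    ∃ x, ∀ y, F (t, x) ≤ F (0, y) := by
  have hslice : ∀ s ∈ Set.Ico 0 T, Continuous fun x => F (s, x) := fun s hs =>
    hF.comp_continuous (by fun_prop) fun x => ⟨hs, Set.mem_univ _⟩
  have hmin : ∀ s ∈ Set.Ico 0 T, ∃ x, ∀ y, F (s, x) ≤ F (s, y) := fun s hs => by
    obtain ⟨x, -, hx⟩ := isCompact_univ.exists_isMinOn Set.univ_nonempty (hslice s hs).continuousOn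
    exact ⟨x, fun y => hx (Set.mem_univ y)⟩
  set m : ℝ → ℝ := fun s => sInf ((fun x => F (s, x)) '' Set.univ) with hm
  have hmle : ∀ s ∈ Set.Ico 0 T, ∀ x, m s ≤ F (s, x) := fun s hs x =>
    csInf_le (isCompact_univ.image (hslice s hs)).bddBelow ⟨x, Set.mem_univ x, rfl⟩
  have hmeq : ∀ s ∈ Set.Ico 0 T, ∀ x, (∀ y, F (s, x) ≤ F (s, y)) → m s = F (s, x) :=
    fun s hs x hx => le_antisymm (hmle s hs x)
      (le_csInf (Set.univ_nonempty.image _) (by rintro _ ⟨y, -, rfl⟩; exact hx y))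
  have hsub : Set.Icc 0 t ⊆ Set.Ico 0 T := fun s hs => ⟨hs.1, hs.2.trans_lt ht.2⟩
  have hmc : ContinuousOn m (Set.Icc 0 t) := by
    rw [continuousOn_iff_continuous_domRestrict]
    refine IsCompact.continuous_sInf (f := fun (s : Set.Icc 0 t) x => F (s, x)) isCompact_univ ?_
    exact hF.comp_continuous (f := fun z : Set.Icc 0 t × X => ((z.1 : ℝ), z.2)) (by fun_prop)
      fun z => ⟨hsub z.1.2, Set.mem_univ _⟩
  have hkey := image_le_of_liminf_slope_right_le_deriv_boundary hmc (B := fun _ => m 0)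
    (B' := fun _ => 0) le_rfl continuousOn_const (fun s _ => hasDerivWithinAt_const _ _ _) (by
      intro s hs r hr
      have hsT := hsub (Set.Ico_subset_Icc_self hs)
      obtain ⟨x, hx⟩ := hmin s hsT
      have h1 := (hd s hsT x hx).mono Set.Ioi_subset_Ici_self
      rw [hasDerivWithinAt_iff_tendsto_slope' Set.self_notMem_Ioi] at h1
      have h2 := h1.eventually (gt_mem_nhds hr)
      have h3 : ∀ᶠ z in 𝓝[>] s, z ∈ Set.Ico 0 T := by
        filter_upwards [Ioo_mem_nhdsGT hsT.2] with z hz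
        exact ⟨hsT.1.trans hz.1.le, hz.2⟩
      refine Filter.Eventually.frequently ?_
      filter_upwards [h2, h3, self_mem_nhdsWithin] with z hz hzT hzs
      refine lt_of_le_of_lt ?_ hz
      rw [slope_def_field, slope_def_field, hmeq s hsT x hx]
      exact div_le_div_of_nonneg_right (by linarith [hmle z hzT x])
        (sub_nonneg.2 (le_of_lt hzs)))
  obtain ⟨x, hx⟩ := hmin t ht
  refine ⟨x, fun y => ?_⟩
  rw [← hmeq t ht x hx]
  exact (hkey ⟨ht.1, le_rfl⟩).trans (hmle 0 ⟨le_rfl, ht.1.trans_lt ht.2⟩ y)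

variable {n : ℕ}

local notation "𝔼" => EuclideanSpace ℝ (Fin n)

variable {M : Type*} [TopologicalSpace M] [ChartedSpace (EuclideanSpace ℝ (Fin n)) M]
  [IsManifold (𝓡 n) ∞ M]

lemma dirDeriv_eq_zero_of_min {f : M → ℝ} (hf : ContMDiff (𝓡 n) 𝓘(ℝ, ℝ) ∞ f) {x : M}
    (hx : ∀ y, f x ≤ f y) (v : TangentSpace (𝓡 n) x) : dirDeriv f x v = 0 := by
  rw [dirDeriv_eq_chart (hf.mdifferentiableAt (by norm_num)) (mem_extChartAt_source x)]
  have h : IsLocalMin (fun y => f ((extChartAt (𝓡 n) x).symm y)) (extChartAt (𝓡 n) x x) :=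
    Filter.Eventually.of_forall fun y => by
      simp only [extChartAt_to_inv]
      exact hx _
  rw [h.fderiv_eq_zero]
  rfl

variable [CompactSpace M]

/-- Along the minimum of `ρ`, `arctan (ρ / 2κ)` decreases at least at the rate `κ`. -/
theorem exists_arctan_divergence_le [Nonempty M] (g : SmoothMetric n M) {T κ : ℝ} (hκ : 0 < κ)
    {u : ℝ → (x : M) → TangentSpace (𝓡 n) x} (hu : IsSmoothFamily (Set.Ico 0 T) u)
    (heq : ∀ t ∈ Set.Ico 0 T, ∀ x : M,
      derivWithin (fun s => divergence g (u s) x) (Set.Ico 0 T) t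
        + dirDeriv (divergence g (u t)) x (u t x) + (1 / 2) * divergence g (u t) x ^ 2
      = -2 * κ ^ 2) {t : ℝ} (ht : t ∈ Set.Ico 0 T) :
    ∃ x, ∀ y, Real.arctan (divergence g (u t) x / (2 * κ)) + κ * t
      ≤ Real.arctan (divergence g (u 0) y / (2 * κ)) := by
  have hρ : SmoothOver n (Set.Ico 0 T) fun z : ℝ × M => divergence g (u z.1) z.2 :=
    hu.contMDiffOn_divergence g (uniqueDiffOn_Ico 0 T)
  -- At a minimum of ρ the transport term drops out, and ρ_t = -(4κ² + ρ²)/2 means exactly that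
  -- arctan(ρ/2κ) has time derivative -κ. Adding κt makes the comparison function stationary there.
  have h := exists_le_of_hasDerivWithinAt_min (X := M) (T := T)
    (F := fun z => Real.arctan (divergence g (u z.1) z.2 / (2 * κ)) + κ * z.1) ?_ ?_ ht
  · simpa using h
  · exact (Real.continuous_arctan.comp_continuousOn
      ((ContMDiffOn.continuousOn hρ).div_const _)).add (by fun_prop)
  · intro t ht x hx
    have hmin : ∀ y, divergence g (u t) x ≤ divergence g (u t) y := fun y => by
      have := Real.arctan_strictMono.le_iff_le.1 (add_le_add_iff_right _ |>.1 (hx y))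
      exact (div_le_div_iff_of_pos_right (by positivity)).1 this
    have h1 := heq t ht x
    rw [dirDeriv_eq_zero_of_min (contMDiff_divergence g (hu.isSmoothField ht)) hmin] at h1
    have h2 : HasDerivWithinAt (fun s => divergence g (u s) x)
        (-2 * κ ^ 2 - (1 / 2) * divergence g (u t) x ^ 2) (Set.Ici t) t := by
      have h3 := (hρ.hasDerivWithinAt ht x).mono_of_mem_nhdsWithin (s := Set.Ici t) (by
        filter_upwards [Ico_mem_nhdsGE ht.2] with s hs using ⟨ht.1.trans hs.1, hs.2⟩)
      convert! h3 using 1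
      linarith
    have h4 := ((h2.div_const (2 * κ)).arctan).add
      ((hasDerivWithinAt_id t (Set.Ici t)).const_mul κ)
    convert! h4 using 1
    field_simp
    ring

end Comparison

/-! ### Maximality of T_max and blow-up of the C¹ norm. -/

section BlowUp

open MeasureTheory

variable {n : ℕ} {M : Type*} [TopologicalSpace M] [ChartedSpace (EuclideanSpace ℝ (Fin n)) M]
  [IsManifold (𝓡 n) ∞ M] [T2Space M] [CompactSpace M] [ConnectedSpace M] [MeasurableSpace M]
  [BorelSpace M]

omit [T2Space M] in
lemma riemVolume_real_univ_pos (g : SmoothMetric n M) : 0 < (riemVolume g).real Set.univ := by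
  have hfin := isFiniteMeasure_riemVolume g
  have hpos := isOpenPosMeasure_riemVolume g
  exact ENNReal.toReal_pos (isOpen_univ.measure_pos _ Set.univ_nonempty).ne' (measure_ne_top _ _)

omit [T2Space M] in
lemma kappa_sq (g : SmoothMetric n M) (u₀ : (x : M) → TangentSpace (𝓡 n) x) :
    ∫ x, divergence g u₀ x ^ 2 ∂(riemVolume g)
      = 4 * (riemVolume g).real Set.univ * kappa g u₀ ^ 2 := by
  have h := riemVolume_real_univ_pos g
  rw [kappa, Real.sq_sqrt (mul_nonneg (by positivity) (integral_nonneg fun x => sq_nonneg _))]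
  field_simp

omit [T2Space M] in
lemma kappa_pos (g : SmoothMetric n M) {u₀ : (x : M) → TangentSpace (𝓡 n) x}
    (hu₀ : IsSmoothField u₀) (hdiv : ∃ x, divergence g u₀ x ≠ 0) : 0 < kappa g u₀ := by
  have hfin := isFiniteMeasure_riemVolume g
  have hpos := isOpenPosMeasure_riemVolume g
  obtain ⟨x, hx⟩ := hdiv
  have h := riemVolume_real_univ_pos g
  have hI : 0 < ∫ x, divergence g u₀ x ^ 2 ∂(riemVolume g) :=
    ((contMDiff_divergence g hu₀).continuous.pow
      2).integral_pos_of_hasCompactSupport_nonneg_nonzero (HasCompactSupport.of_compactSpace _)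
      (fun x => sq_nonneg _) (x := x) (pow_ne_zero 2 hx)
  exact Real.sqrt_pos.2 (mul_pos (one_div_pos.2 (mul_pos four_pos h)) hI)

omit [T2Space M] [CompactSpace M] [ConnectedSpace M] [BorelSpace M] in
lemma maxTime_pos (g : SmoothMetric n M) {u₀ : (x : M) → TangentSpace (𝓡 n) x}
    (hκ : 0 < kappa g u₀) : 0 < maxTime g u₀ := by
  have h := Real.neg_pi_div_two_lt_arctan (1 / (2 * kappa g u₀) * ⨅ x : M, divergence g u₀ x)
  have h2 : maxTime g u₀ = 1 / kappa g u₀ * (Real.pi / 2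
      + Real.arctan (1 / (2 * kappa g u₀) * ⨅ x : M, divergence g u₀ x)) := by
    rw [maxTime]
    field_simp
  rw [h2]
  exact mul_pos (by positivity) (by linarith)

omit [T2Space M] [CompactSpace M] [ConnectedSpace M] [BorelSpace M] in
lemma kappa_mul_maxTime (g : SmoothMetric n M) {u₀ : (x : M) → TangentSpace (𝓡 n) x}
    (hκ : 0 < kappa g u₀) : kappa g u₀ * maxTime g u₀ = Real.pi / 2
      + Real.arctan ((⨅ x : M, divergence g u₀ x) / (2 * kappa g u₀)) := by
  rw [maxTime]
  field_simp

omit [T2Space M] [MeasurableSpace M] [BorelSpace M] in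
lemma exists_divergence_eq_iInf (g : SmoothMetric n M) {u₀ : (x : M) → TangentSpace (𝓡 n) x}
    (hu₀ : IsSmoothField u₀) : ∃ x, divergence g u₀ x = ⨅ x : M, divergence g u₀ x := by
  obtain ⟨x, -, hx⟩ := isCompact_univ.exists_isMinOn (Set.univ_nonempty (α := M))
    (contMDiff_divergence g hu₀).continuous.continuousOn
  refine ⟨x, le_antisymm (le_ciInf fun y => hx (Set.mem_univ y)) (ciInf_le ?_ x)⟩
  exact ⟨divergence g u₀ x, by rintro _ ⟨y, rfl⟩; exact hx (Set.mem_univ y)⟩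

/-- The non-local term of the equation is constant along a solution. -/
lemma IsSolution.local_equation {g : SmoothMetric n M} {u₀ : (x : M) → TangentSpace (𝓡 n) x}
    {T : ℝ} {u : ℝ → (x : M) → TangentSpace (𝓡 n) x} (hu : IsSolution g T u)
    (h0 : ∀ x, divergence g (u 0) x = divergence g u₀ x) {t : ℝ} (ht : t ∈ Set.Ico 0 T) (x : M) :
    derivWithin (fun s => divergence g (u s) x) (Set.Ico 0 T) t
        + dirDeriv (divergence g (u t)) x (u t x) + (1 / 2) * divergence g (u t) x ^ 2
      = -2 * kappa g u₀ ^ 2 := by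
  have hμ := riemVolume_real_univ_pos g
  have h1 := integral_sq_divergence_eq g hu.smooth hu.equation ht
  simp only [h0] at h1
  rw [hu.equation t ht x, h1, kappa_sq g u₀]
  field_simp
  ring

/-- Rewrites the comparison estimate through κ T_max = π/2 + arctan(inf ρ₀ / 2κ). The bound reaches
-π/2, a value arctan never takes, exactly at t = T_max. -/
lemma IsSolution.exists_arctan_le {g : SmoothMetric n M}
    {u₀ : (x : M) → TangentSpace (𝓡 n) x} (hu₀ : IsSmoothField u₀) (hκ : 0 < kappa g u₀)
    {T : ℝ} {u : ℝ → (x : M) → TangentSpace (𝓡 n) x} (hu : IsSolution g T u)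
    (h0 : ∀ x, divergence g (u 0) x = divergence g u₀ x) {t : ℝ} (ht : t ∈ Set.Ico 0 T) :
    ∃ x, Real.arctan (divergence g (u t) x / (2 * kappa g u₀))
      ≤ kappa g u₀ * (maxTime g u₀ - t) - Real.pi / 2 := by
  obtain ⟨x, hx⟩ := exists_arctan_divergence_le g hκ hu.smooth
    (fun t ht x => hu.local_equation h0 ht x) ht
  obtain ⟨y, hy⟩ := exists_divergence_eq_iInf g hu₀
  refine ⟨x, ?_⟩
  have h1 := hx y
  rw [h0, hy] at h1
  rw [mul_sub, kappa_mul_maxTime g hκ]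
  linarith

lemma IsSolution.le_maxTime {g : SmoothMetric n M} {u₀ : (x : M) → TangentSpace (𝓡 n) x}
    (hu₀ : IsSmoothField u₀) (hκ : 0 < kappa g u₀) {T : ℝ}
    {u : ℝ → (x : M) → TangentSpace (𝓡 n) x} (hu : IsSolution g T u)
    (h0 : ∀ x, divergence g (u 0) x = divergence g u₀ x) : T ≤ maxTime g u₀ := by
  by_contra! hlt
  obtain ⟨x, hx⟩ := hu.exists_arctan_le hu₀ hκ h0 ⟨(maxTime_pos g hκ).le, hlt⟩
  have := Real.neg_pi_div_two_lt_arctan (divergence g (u (maxTime g u₀)) x / (2 * kappa g u₀))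
  rw [sub_self, mul_zero] at hx
  linarith

omit [T2Space M] [CompactSpace M] [ConnectedSpace M] [MeasurableSpace M] [BorelSpace M] in
lemma ofReal_abs_divergence_le (g : SmoothMetric n M) {u : (x : M) → TangentSpace (𝓡 n) x}
    (hu : IsSmoothField u) (x : M) :
    ENNReal.ofReal |divergence g u x| ≤ ENNReal.ofReal (Real.sqrt n) * normC1 g u := by
  refine (ENNReal.ofReal_le_ofReal (abs_divergence_le g hu x)).trans ?_
  rw [ENNReal.ofReal_mul (Real.sqrt_nonneg _)]
  gcongr
  exact (le_iSup (fun x => ENNReal.ofReal (covNorm g u x)) x).trans le_add_self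

lemma IsSolution.tendsto_normC1 {g : SmoothMetric n M} {u₀ : (x : M) → TangentSpace (𝓡 n) x}
    (hu₀ : IsSmoothField u₀) (hκ : 0 < kappa g u₀)
    {u : ℝ → (x : M) → TangentSpace (𝓡 n) x} (hu : IsSolution g (maxTime g u₀) u)
    (h0 : ∀ x, divergence g (u 0) x = divergence g u₀ x) :
    Filter.Tendsto (fun t => normC1 g (u t)) (𝓝[<] (maxTime g u₀)) (𝓝 ⊤) := by
  have hT := maxTime_pos g hκ
  rw [ENNReal.tendsto_nhds_top_iff_nnreal]
  intro C
  -- The threshold is chosen so that arctan(ρ/2κ) < arctan A forces ρ < -(√n C + 1), and then √n C <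
  -- |ρ| ≤ √n ‖u‖_{C¹}.
  set A : ℝ := -(Real.sqrt n * C + 1) / (2 * kappa g u₀) with hA
  have h1 : Filter.Tendsto (fun t => kappa g u₀ * (maxTime g u₀ - t) - Real.pi / 2)
      (𝓝[<] (maxTime g u₀)) (𝓝 (-(Real.pi / 2))) := by
    have h2 : Continuous fun t => kappa g u₀ * (maxTime g u₀ - t) - Real.pi / 2 := by fun_prop
    have h3 := (h2.tendsto (maxTime g u₀)).mono_left
      (nhdsWithin_le_nhds (s := Set.Iio (maxTime g u₀)))
    simpa using h3
  have h4 : -(Real.pi / 2) < Real.arctan A := Real.neg_pi_div_two_lt_arctan A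
  filter_upwards [h1.eventually (gt_mem_nhds h4), Ioo_mem_nhdsLT hT] with t ht htT
  have htI : t ∈ Set.Ico 0 (maxTime g u₀) := ⟨htT.1.le, htT.2⟩
  obtain ⟨x, hx⟩ := hu.exists_arctan_le hu₀ hκ h0 htI
  have h5 := Real.arctan_strictMono.lt_iff_lt.1 (hx.trans_lt ht)
  rw [hA, div_lt_div_iff_of_pos_right (by positivity)] at h5
  have h6 : Real.sqrt n * C < |divergence g (u t) x| := by
    have := neg_abs_le (divergence g (u t) x)
    linarith
  have h7 := (ENNReal.ofReal_lt_ofReal_iff_of_nonneg (by positivity)).2 h6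
  rw [ENNReal.ofReal_mul (Real.sqrt_nonneg _), ENNReal.ofReal_coe_nnreal] at h7
  have h8 := h7.trans_le (ofReal_abs_divergence_le g
    (IsSmoothFamily.isSmoothField hu.smooth htI) x)
  exact lt_of_mul_lt_mul_left' h8

end BlowUp

/-! ### The variational equation and Liouville's theorem in Euclidean space. -/

section Liouville

variable {n : ℕ}

local notation "𝔼" => EuclideanSpace ℝ (Fin n)

lemma hasFDerivAt_slice {F : Type*} [NormedAddCommGroup F] [NormedSpace ℝ F] {f : ℝ × 𝔼 → F}
    {t : ℝ} {y : 𝔼} (hf : DifferentiableAt ℝ f (t, y)) :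
    HasFDerivAt (fun z => f (t, z)) (fderiv ℝ f (t, y) ∘L ContinuousLinearMap.inr ℝ ℝ 𝔼) y :=
  hf.hasFDerivAt.comp y (hasFDerivAt_prodMk_right t y)

lemma hasDerivAt_slice {F : Type*} [NormedAddCommGroup F] [NormedSpace ℝ F] {f : ℝ × 𝔼 → F}
    {t : ℝ} {y : 𝔼} (hf : DifferentiableAt ℝ f (t, y)) :
    HasDerivAt (fun s => f (s, y)) (fderiv ℝ f (t, y) (1, 0)) t :=
  hf.hasFDerivAt.comp_hasDerivAt t ((hasDerivAt_id t).prodMk (hasDerivAt_const t y))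

/-- The variational equation: the spatial derivative of a flow solves the linearized equation. -/
lemma hasDerivAt_fderiv_flow {τ W : ℝ × 𝔼 → 𝔼} {t : ℝ} {y : 𝔼} (hτ : ContDiffAt ℝ ∞ τ (t, y))
    (hW : DifferentiableAt ℝ W (t, τ (t, y)))
    (hflow : ∀ᶠ z in 𝓝 (t, y), fderiv ℝ τ z (1, 0) = W (z.1, τ z)) :
    HasDerivAt (fun s => fderiv ℝ (fun z => τ (s, z)) y)
      (fderiv ℝ (fun z => W (t, z)) (τ (t, y)) ∘L fderiv ℝ (fun z => τ (t, z)) y) t := by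
  have h2 : ContDiffAt ℝ 2 τ (t, y) := hτ.of_le (by norm_cast)
  have hdτ : DifferentiableAt ℝ τ (t, y) := hτ.differentiableAt (by norm_num)
  have hD : DifferentiableAt ℝ (fderiv ℝ τ) (t, y) :=
    (h2.fderiv_right (m := 1) (by norm_num)).differentiableAt (by norm_num)
  have hsymm : IsSymmSndFDerivAt ℝ τ (t, y) := h2.isSymmSndFDerivAt (by simp)
  have hA : (fun s => fderiv ℝ (fun z => τ (s, z)) y) =ᶠ[𝓝 t]
      fun s => fderiv ℝ τ (s, y) ∘L ContinuousLinearMap.inr ℝ ℝ 𝔼 := by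
    have hc : Filter.Tendsto (fun s : ℝ => (s, y)) (𝓝 t) (𝓝 (t, y)) :=
      (Continuous.prodMk_left y).tendsto t
    filter_upwards [hc.eventually (h2.eventually (by simp))] with s hs
    exact (hasFDerivAt_slice (hs.differentiableAt (by norm_num))).fderiv
  refine HasDerivAt.congr_of_eventuallyEq ?_ hA
  have h3 : HasDerivAt (fun s => fderiv ℝ τ (s, y) ∘L ContinuousLinearMap.inr ℝ ℝ 𝔼)
      (fderiv ℝ (fderiv ℝ τ) (t, y) (1, 0) ∘L ContinuousLinearMap.inr ℝ ℝ 𝔼) t := by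
    have h4 := (hasDerivAt_slice hD).clm_comp
      (hasDerivAt_const t (ContinuousLinearMap.inr ℝ ℝ 𝔼))
    simpa using h4
  convert! h3 using 1
  rw [(hasFDerivAt_slice hdτ).fderiv, (hasFDerivAt_slice hW).fderiv]
  have h5 : HasFDerivAt (fun z : ℝ × 𝔼 => W (z.1, τ z)) (fderiv ℝ W (t, τ (t, y)) ∘L
      (ContinuousLinearMap.fst ℝ ℝ 𝔼).prod (fderiv ℝ τ (t, y))) (t, y) :=
    HasFDerivAt.comp (g := W) (t, y) hW.hasFDerivAt (hasFDerivAt_fst.prodMk hdτ.hasFDerivAt)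
  -- The flow equation ∂_t τ = W(t, τ) is differentiated in all variables and evaluated on a spatial
  -- vector (0, v). Symmetry of D²τ then turns D_y ∂_t τ into ∂_t D_y τ.
  have h6 := (hD.hasFDerivAt.clm_apply (hasFDerivAt_const ((1 : ℝ), (0 : 𝔼)) (t, y))).unique
    (h5.congr_of_eventuallyEq hflow)
  ext1 v
  have h7 := DFunLike.congr_fun h6 ((0 : ℝ), v)
  have h8 := hsymm.eq (1, 0) (0, v)
  simp at h7
  simp [h7, h8]

/-- Liouville's theorem: the density transported by a flow is constant if it satisfies the
continuity equation. -/
theorem hasDerivAt_density_flow {τ W : ℝ × 𝔼 → 𝔼} {σ : ℝ × 𝔼 → ℝ} {t : ℝ} {y : 𝔼}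
    (hτ : ContDiffAt ℝ ∞ τ (t, y)) (hW : DifferentiableAt ℝ W (t, τ (t, y)))
    (hσ : DifferentiableAt ℝ σ (t, τ (t, y)))
    (hflow : ∀ᶠ z in 𝓝 (t, y), fderiv ℝ τ z (1, 0) = W (z.1, τ z))
    (hcont : fderiv ℝ σ (t, τ (t, y)) (1, 0)
      + ∑ i, partialDeriv i (fun z => σ (t, z) * W (t, z) i) (τ (t, y)) = 0) :
    HasDerivAt (fun s => σ (s, τ (s, y)) * (fderiv ℝ (fun z => τ (s, z)) y).det) 0 t := by
  have hdτ : DifferentiableAt ℝ τ (t, y) := hτ.differentiableAt (by norm_num)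
  have h1 := hasDerivAt_det_left (hasDerivAt_fderiv_flow hτ hW hflow)
  have h2 : HasDerivAt (fun s => σ (s, τ (s, y)))
      (fderiv ℝ σ (t, τ (t, y)) (1, W (t, τ (t, y)))) t := by
    have h3 := hasDerivAt_slice hdτ
    rw [hflow.self_of_nhds] at h3
    exact HasFDerivAt.comp_hasDerivAt (f := fun s => (s, τ (s, y))) t hσ.hasFDerivAt
      ((hasDerivAt_id t).prodMk h3)
  have hσz := hasFDerivAt_slice hσ
  rw [sum_partialDeriv_mul (s := fun z => σ (t, z)) (v := fun z => W (t, z))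
    hσz.differentiableAt (hasFDerivAt_slice hW).differentiableAt, hσz.fderiv] at hcont
  have h4 : fderiv ℝ σ (t, τ (t, y)) (1, W (t, τ (t, y)))
      = fderiv ℝ σ (t, τ (t, y)) (1, 0) + fderiv ℝ σ (t, τ (t, y)) (0, W (t, τ (t, y))) := by
    rw [← map_add]
    simp
  have hcont' : fderiv ℝ σ (t, τ (t, y)) (1, 0) + (σ (t, τ (t, y)) *
      (clmMatrix (fderiv ℝ (fun z => W (t, z)) (τ (t, y)))).trace
      + fderiv ℝ σ (t, τ (t, y)) (0, W (t, τ (t, y)))) = 0 := hcont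
  refine (h2.mul h1).congr_deriv ?_
  rw [h4]
  -- The trace of DW from the determinant and the derivative of σ along W together form the
  -- divergence term of the continuity equation.
  linear_combination (fderiv ℝ (fun z => τ (t, z)) y).det * hcont'

end Liouville

/-! ### Coordinate expressions of a flow. -/

section FlowInCharts

variable {n : ℕ}

local notation "𝔼" => EuclideanSpace ℝ (Fin n)

variable {M : Type*} [TopologicalSpace M] [ChartedSpace (EuclideanSpace ℝ (Fin n)) M]

/-- The map `η` from `ℝ × M` to `M` in the charts centred at `p` and `q`. -/
def flowRep (η : ℝ × M → M) (p q : M) (z : ℝ × 𝔼) : 𝔼 :=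
  extChartAt (𝓡 n) q (η (z.1, (extChartAt (𝓡 n) p).symm z.2))

variable [IsManifold (𝓡 n) ∞ M] {η : ℝ × M → M} {a b : ℝ}

lemma eventually_flow_mem_source
    (hη : ContMDiffOn (𝓘(ℝ, ℝ).prod (𝓡 n)) (𝓡 n) ∞ η (Set.Ioo a b ×ˢ Set.univ)) {p q : M} {t : ℝ}
    (ht : t ∈ Set.Ioo a b) {y : 𝔼} (hy : y ∈ (extChartAt (𝓡 n) p).target)
    (hq : η (t, (extChartAt (𝓡 n) p).symm y) ∈ (extChartAt (𝓡 n) q).source) :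
    ∀ᶠ z : ℝ × 𝔼 in 𝓝 (t, y), z.1 ∈ Set.Ioo a b ∧ z.2 ∈ (extChartAt (𝓡 n) p).target ∧
      η (z.1, (extChartAt (𝓡 n) p).symm z.2) ∈ (extChartAt (𝓡 n) q).source := by
  have h1 : ContinuousAt η (t, (extChartAt (𝓡 n) p).symm y) :=
    hη.continuousOn.continuousAt (prod_mem_nhds (isOpen_Ioo.mem_nhds ht) Filter.univ_mem)
  have h2 : ContinuousAt (fun z : ℝ × 𝔼 => (z.1, (extChartAt (𝓡 n) p).symm z.2)) (t, y) :=
    continuousAt_fst.prodMk (ContinuousAt.comp (f := Prod.snd) (x := (t, y))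
      (contMDiffAt_extChartAt_symm hy).continuousAt continuousAt_snd)
  have h3 : ContinuousAt (fun z : ℝ × 𝔼 => η (z.1, (extChartAt (𝓡 n) p).symm z.2)) (t, y) :=
    ContinuousAt.comp (f := fun z : ℝ × 𝔼 => (z.1, (extChartAt (𝓡 n) p).symm z.2)) h1 h2
  filter_upwards [continuousAt_fst.preimage_mem_nhds (isOpen_Ioo.mem_nhds ht),
    continuousAt_snd.preimage_mem_nhds ((isOpen_extChartAt_target p).mem_nhds hy),
    h3.preimage_mem_nhds ((isOpen_extChartAt_source q).mem_nhds hq)] with z hz1 hz2 hz3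
  exact ⟨hz1, hz2, hz3⟩

lemma contDiffAt_flowRep
    (hη : ContMDiffOn (𝓘(ℝ, ℝ).prod (𝓡 n)) (𝓡 n) ∞ η (Set.Ioo a b ×ˢ Set.univ)) {p q : M} {t : ℝ}
    (ht : t ∈ Set.Ioo a b) {y : 𝔼} (hy : y ∈ (extChartAt (𝓡 n) p).target)
    (hq : η (t, (extChartAt (𝓡 n) p).symm y) ∈ (extChartAt (𝓡 n) q).source) :
    ContDiffAt ℝ ∞ (flowRep η p q) (t, y) := by
  have h1 : ContMDiffAt (𝓘(ℝ, ℝ).prod (𝓡 n)) (𝓡 n) ∞ η (t, (extChartAt (𝓡 n) p).symm y) :=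
    hη.contMDiffAt (prod_mem_nhds (isOpen_Ioo.mem_nhds ht) Filter.univ_mem)
  have h2 : ContMDiffAt (𝓘(ℝ, ℝ).prod 𝓘(ℝ, 𝔼)) (𝓘(ℝ, ℝ).prod (𝓡 n)) ∞
      (fun z : ℝ × 𝔼 => (z.1, (extChartAt (𝓡 n) p).symm z.2)) (t, y) :=
    contMDiffAt_fst.prodMk ((contMDiffAt_extChartAt_symm hy).comp (t, y) contMDiffAt_snd)
  have h3 : ContMDiffAt (𝓡 n) 𝓘(ℝ, 𝔼) ∞ (extChartAt (𝓡 n) q)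
      (η (t, (extChartAt (𝓡 n) p).symm y)) := by
    refine contMDiffOn_extChartAt.contMDiffAt ?_
    rw [← extChartAt_source (𝓡 n)]
    exact (isOpen_extChartAt_source q).mem_nhds hq
  have h4 : ContMDiffAt (𝓘(ℝ, ℝ).prod 𝓘(ℝ, 𝔼)) 𝓘(ℝ, 𝔼) ∞ (flowRep η p q) (t, y) :=
    ContMDiffAt.comp (t, y) h3 (ContMDiffAt.comp (t, y) h1 h2)
  rw [← contMDiffAt_iff_contDiffAt, modelWithCornersSelf_prod, ← chartedSpaceSelf_prod]
  exact h4

/-- The flow equation in charts. -/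
lemma fderiv_flowRep_time
    (hη : ContMDiffOn (𝓘(ℝ, ℝ).prod (𝓡 n)) (𝓡 n) ∞ η (Set.Ioo a b ×ˢ Set.univ))
    {w : ℝ → (x : M) → TangentSpace (𝓡 n) x} {p q : M} {t : ℝ}
    (ht : t ∈ Set.Ioo a b) {y : 𝔼} (hy : y ∈ (extChartAt (𝓡 n) p).target)
    (hq : η (t, (extChartAt (𝓡 n) p).symm y) ∈ (extChartAt (𝓡 n) q).source)
    (hw : IsCurveAt w (fun s => η (s, (extChartAt (𝓡 n) p).symm y)) t) :
    fderiv ℝ (flowRep η p q) (t, y) (1, 0) = fieldRep (w t) q (flowRep η p q (t, y)) := by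
  have h1 : IsManifold (𝓡 n) 1 M := isManifold_one_of_infty
  have hdq : MDifferentiableAt (𝓡 n) 𝓘(ℝ, 𝔼) (extChartAt (𝓡 n) q)
      (η (t, (extChartAt (𝓡 n) p).symm y)) := by
    apply mdifferentiableAt_extChartAt
    rw [← extChartAt_source (𝓡 n)]
    exact hq
  let D : ℝ →L[ℝ] 𝔼 := (mfderiv (𝓡 n) 𝓘(ℝ, 𝔼) (extChartAt (𝓡 n) q)
    (η (t, (extChartAt (𝓡 n) p).symm y))).comp
      ((1 : ℝ →L[ℝ] ℝ).smulRight (w t (η (t, (extChartAt (𝓡 n) p).symm y))))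
  have hD : HasFDerivAt (fun s => flowRep η p q (s, y)) D t :=
    (hdq.hasMFDerivAt.comp t hw).hasFDerivAt
  have h2 : HasDerivAt (fun s => flowRep η p q (s, y)) (D 1) t := hD.hasDerivAt
  have h3 := hasDerivAt_slice ((contDiffAt_flowRep hη ht hy hq).differentiableAt (by norm_num))
  refine (h3.unique h2).trans ?_
  rw [flowRep, fieldRep_extChartAt _ hq]
  change mfderiv (𝓡 n) 𝓘(ℝ, 𝔼) (extChartAt (𝓡 n) q) _ ((1 : ℝ) • w t _) = _
  rw [one_smul]
  rfl

/-- The spatial derivative of the flow in charts. -/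
lemma chartRep_mfderiv_flow
    (hη : ContMDiffOn (𝓘(ℝ, ℝ).prod (𝓡 n)) (𝓡 n) ∞ η (Set.Ioo a b ×ˢ Set.univ)) {p q : M} {t : ℝ}
    (ht : t ∈ Set.Ioo a b) {y : 𝔼} (hy : y ∈ (extChartAt (𝓡 n) p).target)
    (hq : η (t, (extChartAt (𝓡 n) p).symm y) ∈ (extChartAt (𝓡 n) q).source)
    (v : TangentSpace (𝓡 n) ((extChartAt (𝓡 n) p).symm y)) :
    chartRep (𝓡 n) q (η (t, (extChartAt (𝓡 n) p).symm y))
      (mfderiv (𝓡 n) (𝓡 n) (fun x => η (t, x)) ((extChartAt (𝓡 n) p).symm y) v)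
      = fderiv ℝ (fun z => flowRep η p q (t, z)) y
        (chartRep (𝓡 n) p ((extChartAt (𝓡 n) p).symm y) v) := by
  have h1 : IsManifold (𝓡 n) 1 M := isManifold_one_of_infty
  have hdq : MDifferentiableAt (𝓡 n) 𝓘(ℝ, 𝔼) (extChartAt (𝓡 n) q)
      (η (t, (extChartAt (𝓡 n) p).symm y)) := by
    apply mdifferentiableAt_extChartAt
    rw [← extChartAt_source (𝓡 n)]
    exact hq
  have hηt : MDifferentiableAt (𝓡 n) (𝓡 n) (fun x => η (t, x)) ((extChartAt (𝓡 n) p).symm y) := by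
    have h2 : ContMDiffAt (𝓘(ℝ, ℝ).prod (𝓡 n)) (𝓡 n) ∞ η (t, (extChartAt (𝓡 n) p).symm y) :=
      hη.contMDiffAt (prod_mem_nhds (isOpen_Ioo.mem_nhds ht) Filter.univ_mem)
    have h3 : ContMDiffAt (𝓡 n) (𝓡 n) ∞ (fun x => η (t, x)) ((extChartAt (𝓡 n) p).symm y) :=
      ContMDiffAt.comp (f := fun x : M => (t, x)) _ h2 (contMDiffAt_const.prodMk contMDiffAt_id)
    exact h3.mdifferentiableAt (by norm_num)
  have h4 := hdq.hasMFDerivAt.comp y (HasMFDerivAt.comp y hηt.hasMFDerivAt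
    ((contMDiffAt_extChartAt_symm hy).mdifferentiableAt (by norm_num)).hasMFDerivAt)
  let D : 𝔼 →L[ℝ] 𝔼 := (mfderiv (𝓡 n) 𝓘(ℝ, 𝔼) (extChartAt (𝓡 n) q)
    (η (t, (extChartAt (𝓡 n) p).symm y))).comp
      ((mfderiv (𝓡 n) (𝓡 n) (fun x => η (t, x)) ((extChartAt (𝓡 n) p).symm y)).comp
        (mfderiv 𝓘(ℝ, 𝔼) (𝓡 n) (extChartAt (𝓡 n) p).symm y))
  have hD : HasFDerivAt (fun z => flowRep η p q (t, z)) D y := h4.hasFDerivAt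
  have h5 := hD.unique (hasFDerivAt_slice
    ((contDiffAt_flowRep hη ht hy hq).differentiableAt (by norm_num)))
  rw [(hasFDerivAt_slice ((contDiffAt_flowRep hη ht hy hq).differentiableAt (by norm_num))).fderiv,
    ← h5]
  conv_lhs => rw [← chartVec_chartRep hy v]
  rfl

end FlowInCharts

/-! ### The transported density and the velocity of the inverse flow. -/

section Transport

variable {n : ℕ}

local notation "𝔼" => EuclideanSpace ℝ (Fin n)

variable {M : Type*} [TopologicalSpace M] [ChartedSpace (EuclideanSpace ℝ (Fin n)) M]
  [IsManifold (𝓡 n) ∞ M]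

/-- `η` is the flow of the time-dependent field `w` over the interval `(a, b)`. -/
structure IsFlow (w : ℝ → (x : M) → TangentSpace (𝓡 n) x) (η : ℝ × M → M) (a b : ℝ) : Prop where
  field : IsSmoothFamily (Set.Ioo a b) w
  smooth : ContMDiffOn (𝓘(ℝ, ℝ).prod (𝓡 n)) (𝓡 n) ∞ η (Set.Ioo a b ×ˢ Set.univ)
  zero : ∀ x, η (0, x) = x
  curve : ∀ x, ∀ t ∈ Set.Ioo a b, IsCurveAt w (fun s => η (s, x)) t

/-- `J` is a positive solution of the continuity equation `∂_t J + div (J w) = 0` with initial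
value `1`. -/
structure IsDensity (g : SmoothMetric n M) (w : ℝ → (x : M) → TangentSpace (𝓡 n) x)
    (J : ℝ × M → ℝ) (a b : ℝ) : Prop where
  smooth : SmoothOver n (Set.Ioo a b) J
  pos : ∀ t ∈ Set.Ioo a b, ∀ x, 0 < J (t, x)
  zero : ∀ x, J (0, x) = 1
  continuity : ∀ t ∈ Set.Ioo a b, ∀ x, derivWithin (fun s => J (s, x)) (Set.Ioo a b) t
    + divergence g (fun x => J (t, x) • w t x) x = 0

variable {g : SmoothMetric n M} {w : ℝ → (x : M) → TangentSpace (𝓡 n) x} {η : ℝ × M → M}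
  {J : ℝ × M → ℝ} {a b : ℝ}

lemma IsFlow.fderiv_time (h : IsFlow w η a b) {p q : M} {t : ℝ} (ht : t ∈ Set.Ioo a b) {y : 𝔼}
    (hy : y ∈ (extChartAt (𝓡 n) p).target)
    (hq : η (t, (extChartAt (𝓡 n) p).symm y) ∈ (extChartAt (𝓡 n) q).source) :
    ∀ᶠ z in 𝓝 (t, y), fderiv ℝ (flowRep η p q) z (1, 0)
      = fieldRep (w z.1) q (flowRep η p q z) := by
  filter_upwards [eventually_flow_mem_source h.smooth ht hy hq] with z hz
  exact fderiv_flowRep_time h.smooth hz.1 hz.2.1 hz.2.2 (h.curve _ _ hz.1)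

omit [IsManifold (𝓡 n) ∞ M] in
lemma prod_target_mem_nhds {q : M} {t : ℝ} (ht : t ∈ Set.Ioo a b) {z : 𝔼}
    (hz : z ∈ (extChartAt (𝓡 n) q).target) :
    Set.Ioo a b ×ˢ (extChartAt (𝓡 n) q).target ∈ 𝓝 (t, z) :=
  prod_mem_nhds (isOpen_Ioo.mem_nhds ht) ((isOpen_extChartAt_target q).mem_nhds hz)

lemma SmoothOver.differentiableAt_chart {f : ℝ × M → ℝ} (hf : SmoothOver n (Set.Ioo a b) f)
    {q : M} {t : ℝ} (ht : t ∈ Set.Ioo a b) {z : 𝔼} (hz : z ∈ (extChartAt (𝓡 n) q).target) :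
    DifferentiableAt ℝ (fun z : ℝ × 𝔼 => f (z.1, (extChartAt (𝓡 n) q).symm z.2)) (t, z) :=
  ((hf.contDiffOn_chart q).contDiffAt (prod_target_mem_nhds ht hz)).differentiableAt (by norm_num)

lemma IsSmoothFamily.differentiableAt_chart (hw : IsSmoothFamily (Set.Ioo a b) w) {q : M} {t : ℝ}
    (ht : t ∈ Set.Ioo a b) {z : 𝔼} (hz : z ∈ (extChartAt (𝓡 n) q).target) :
    DifferentiableAt ℝ (fun z : ℝ × 𝔼 => fieldRep (w z.1) q z.2) (t, z) :=
  ((isSmoothFamily_iff.1 hw q).contDiffAt (prod_target_mem_nhds ht hz)).differentiableAt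
    (by norm_num)

omit [IsManifold (𝓡 n) ∞ M] in
lemma SmoothOver.contMDiff_slice {f : ℝ × M → ℝ} {S : Set ℝ} (hf : SmoothOver n S f) {t : ℝ}
    (ht : t ∈ S) : ContMDiff (𝓡 n) 𝓘(ℝ, ℝ) ∞ fun x => f (t, x) :=
  ContMDiffOn.comp_contMDiff (f := fun x : M => (t, x)) hf (contMDiff_const.prodMk contMDiff_id)
    fun _ => ⟨ht, Set.mem_univ _⟩

/-- The Jacobian of the flow in the charts centred at `p` and `q`, weighted with `J`. -/
def weightedJacobian (g : SmoothMetric n M) (η : ℝ × M → M) (J : ℝ × M → ℝ) (p q : M) (t : ℝ)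
    (y : 𝔼) : ℝ :=
  J (t, η (t, (extChartAt (𝓡 n) p).symm y)) * volDensity g q (flowRep η p q (t, y)) *
    (fderiv ℝ (fun z => flowRep η p q (t, z)) y).det

/-- Changing the target chart multiplies the Jacobian by the determinant of the transition map, and
the density changes by the inverse factor up to sign. Squaring removes the sign, so the quantity is
independent of q. -/
lemma weightedJacobian_sq_congr (h : IsFlow w η a b) {p q q' : M} {t : ℝ}
    (ht : t ∈ Set.Ioo a b) {y : 𝔼} (hy : y ∈ (extChartAt (𝓡 n) p).target)
    (hq : η (t, (extChartAt (𝓡 n) p).symm y) ∈ (extChartAt (𝓡 n) q).source)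
    (hq' : η (t, (extChartAt (𝓡 n) p).symm y) ∈ (extChartAt (𝓡 n) q').source) :
    weightedJacobian g η J p q t y ^ 2 = weightedJacobian g η J p q' t y ^ 2 := by
  have ho : flowRep η p q (t, y) ∈ overlap n q q' := extChartAt_mem_overlap hq hq'
  have hT : flowRep η p q' (t, y) = transition q q' (flowRep η p q (t, y)) := by
    rw [flowRep, flowRep, transition, (extChartAt (𝓡 n) q).left_inv hq]
  have hc : Filter.Tendsto (fun z : 𝔼 => (t, z)) (𝓝 y) (𝓝 (t, y)) :=
    (Continuous.prodMk_right t).tendsto y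
  have heq : (fun z => flowRep η p q' (t, z)) =ᶠ[𝓝 y]
      fun z => transition q q' (flowRep η p q (t, z)) := by
    filter_upwards [hc.eventually (eventually_flow_mem_source h.smooth ht hy hq)] with z hz
    rw [flowRep, flowRep, transition, (extChartAt (𝓡 n) q).left_inv hz.2.2]
  have hd := hasFDerivAt_slice
    ((contDiffAt_flowRep h.smooth ht hy hq).differentiableAt (by norm_num))
  have hdT := (((contDiffOn_transition q q').contDiffAt
    ((isOpen_overlap q q').mem_nhds ho)).differentiableAt (by norm_num)).hasFDerivAt
  have hcomp : fderiv ℝ (fun z => flowRep η p q' (t, z)) y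
      = fderiv ℝ (transition q q') (flowRep η p q (t, y)) ∘L
        fderiv ℝ (fun z => flowRep η p q (t, z)) y := by
    rw [heq.fderiv_eq, hd.fderiv]
    exact (HasFDerivAt.comp y hdT hd).fderiv
  have hdet : (fderiv ℝ (fun z => flowRep η p q' (t, z)) y).det
      = (fderiv ℝ (transition q q') (flowRep η p q (t, y))).det *
        (fderiv ℝ (fun z => flowRep η p q (t, z)) y).det := by
    rw [hcomp, ← det_clmMatrix, clmMatrix_comp, Matrix.det_mul, det_clmMatrix, det_clmMatrix]
  simp only [weightedJacobian, mul_pow]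
  rw [volDensity_sq_transition g ho, hdet, hT]
  ring

/-- In the chart at q the product J√g satisfies the Euclidean continuity equation for the components
of w, so Liouville's theorem applies to the coordinate flow. -/
lemma hasDerivAt_weightedJacobian (h : IsFlow w η a b) (hJ : IsDensity g w J a b) {p q : M} {t : ℝ}
    (ht : t ∈ Set.Ioo a b) {y : 𝔼} (hy : y ∈ (extChartAt (𝓡 n) p).target)
    (hq : η (t, (extChartAt (𝓡 n) p).symm y) ∈ (extChartAt (𝓡 n) q).source) :
    HasDerivAt (fun s => weightedJacobian g η J p q s y) 0 t := by
  have hz : flowRep η p q (t, y) ∈ (extChartAt (𝓡 n) q).target :=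
    (extChartAt (𝓡 n) q).map_source hq
  have hsm : IsSmoothField fun x => J (t, x) • w t x :=
    isSmoothField_smul (hJ.smooth.contMDiff_slice ht) (h.field.isSmoothField ht)
  have hJd := hJ.smooth.differentiableAt_chart ht hz
  have hsd : DifferentiableAt ℝ (fun z : ℝ × 𝔼 => volDensity g q z.2)
      (t, flowRep η p q (t, y)) :=
    DifferentiableAt.comp (f := Prod.snd) _ (differentiableAt_volDensity g hz)
      differentiableAt_snd
  have hmain := hasDerivAt_density_flow (τ := flowRep η p q) (t := t) (y := y)
    (W := fun z => fieldRep (w z.1) q z.2)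
    (σ := fun z => J (z.1, (extChartAt (𝓡 n) q).symm z.2) * volDensity g q z.2)
    (contDiffAt_flowRep h.smooth ht hy hq) (h.field.differentiableAt_chart ht hz)
    (hJd.mul hsd) (h.fderiv_time ht hy hq) ?_
  · refine hmain.congr_of_eventuallyEq ?_
    have hc : Filter.Tendsto (fun s : ℝ => (s, y)) (𝓝 t) (𝓝 (t, y)) :=
      (Continuous.prodMk_left y).tendsto t
    filter_upwards [hc.eventually (eventually_flow_mem_source h.smooth ht hy hq)] with s hs
    simp only [weightedJacobian]
    rw [flowRep, (extChartAt (𝓡 n) q).left_inv hs.2.2]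
  · have h1 : fderiv ℝ (fun z : ℝ × 𝔼 => J (z.1, (extChartAt (𝓡 n) q).symm z.2) *
        volDensity g q z.2) (t, flowRep η p q (t, y)) (1, 0)
        = derivWithin (fun s => J (s, (extChartAt (𝓡 n) q).symm (flowRep η p q (t, y))))
          (Set.Ioo a b) t * volDensity g q (flowRep η p q (t, y)) := by
      have h2 := hasDerivAt_slice (hJd.mul hsd)
      have h3 := ((hJ.smooth.hasDerivWithinAt ht ((extChartAt (𝓡 n) q).symm
        (flowRep η p q (t, y)))).hasDerivAt (isOpen_Ioo.mem_nhds ht)).mul_const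
          (volDensity g q (flowRep η p q (t, y)))
      exact h2.unique h3
    have h4 : ∑ i, partialDeriv i (fun z => J (t, (extChartAt (𝓡 n) q).symm z) * volDensity g q z *
        fieldRep (w t) q z i) (flowRep η p q (t, y))
        = volDensity g q (flowRep η p q (t, y)) * divergence g (fun x => J (t, x) • w t x)
          ((extChartAt (𝓡 n) q).symm (flowRep η p q (t, y))) := by
      rw [divergence_eq_chart g hsm ((extChartAt (𝓡 n) q).map_target hz),
        (extChartAt (𝓡 n) q).right_inv hz, densityDiv, mul_inv_cancel_left₀ (volDensity_pos g hz).ne']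
      refine Finset.sum_congr rfl fun i _ => ?_
      congr 1
      ext1 z
      rw [fieldRep, fieldRep, chartRep_smul, PiLp.smul_apply, smul_eq_mul]
      ring
    rw [h1]
    simp only [h4]
    have h5 := hJ.continuity t ht ((extChartAt (𝓡 n) q).symm (flowRep η p q (t, y)))
    linear_combination volDensity g q (flowRep η p q (t, y)) * h5

/-- The weighted Jacobian determinant of the flow is constant. -/
theorem weightedJacobian_sq (h : IsFlow w η a b) (hJ : IsDensity g w J a b)
    (h0 : (0 : ℝ) ∈ Set.Ioo a b) {p q : M} {t : ℝ}
    (ht : t ∈ Set.Ioo a b) {y : 𝔼} (hy : y ∈ (extChartAt (𝓡 n) p).target)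
    (hq : η (t, (extChartAt (𝓡 n) p).symm y) ∈ (extChartAt (𝓡 n) q).source) :
    weightedJacobian g η J p q t y ^ 2 = volDensity g p y ^ 2 := by
  -- The target chart moves with the orbit, as no single chart need contain it. Independence of the
  -- chart lets it be frozen near each time, so H has zero derivative throughout; at time 0 the flow
  -- is the identity and J = 1, which gives √g squared.
  set H : ℝ → ℝ := fun s =>
    weightedJacobian g η J p (η (s, (extChartAt (𝓡 n) p).symm y)) s y ^ 2 with hH
  have hd : ∀ s ∈ Set.Ioo a b, HasDerivAt H 0 s := by
    intro s hs
    have hsq := mem_extChartAt_source (I := 𝓡 n) (η (s, (extChartAt (𝓡 n) p).symm y))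
    have h1 := (hasDerivAt_weightedJacobian h hJ hs hy hsq).fun_pow 2
    rw [mul_zero] at h1
    refine h1.congr_of_eventuallyEq ?_
    have hc : Filter.Tendsto (fun s : ℝ => (s, y)) (𝓝 s) (𝓝 (s, y)) :=
      (Continuous.prodMk_left y).tendsto s
    filter_upwards [hc.eventually (eventually_flow_mem_source h.smooth hs hy hsq)] with r hr
    exact weightedJacobian_sq_congr h hr.1 hr.2.1 (mem_extChartAt_source _) hr.2.2
  have hconst : H t = H 0 := isOpen_Ioo.is_const_of_deriv_eq_zero isPreconnected_Ioo
    (fun s hs => (hd s hs).differentiableAt.differentiableWithinAt)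
    (fun s hs => (hd s hs).deriv) ht h0
  have hp : η (0, (extChartAt (𝓡 n) p).symm y) ∈ (extChartAt (𝓡 n) p).source := by
    rw [h.zero]
    exact (extChartAt (𝓡 n) p).map_target hy
  rw [weightedJacobian_sq_congr h ht hy hq (mem_extChartAt_source _)]
  refine hconst.trans ?_
  simp only [hH]
  rw [weightedJacobian_sq_congr h h0 hy (mem_extChartAt_source _) hp]
  have h1 : (fun z => flowRep η p p (0, z)) =ᶠ[𝓝 y] id := by
    filter_upwards [(isOpen_extChartAt_target p).mem_nhds hy] with z hz
    rw [flowRep, h.zero, (extChartAt (𝓡 n) p).right_inv hz, id]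
  have h2 : flowRep η p p (0, y) = y := h1.self_of_nhds
  rw [weightedJacobian, h1.fderiv_eq, fderiv_id, h2, hJ.zero, ← det_clmMatrix, clmMatrix_id,
    Matrix.det_one]
  ring

lemma det_flowRep_ne_zero (h : IsFlow w η a b) (hJ : IsDensity g w J a b)
    (h0 : (0 : ℝ) ∈ Set.Ioo a b) {p q : M} {t : ℝ}
    (ht : t ∈ Set.Ioo a b) {y : 𝔼} (hy : y ∈ (extChartAt (𝓡 n) p).target)
    (hq : η (t, (extChartAt (𝓡 n) p).symm y) ∈ (extChartAt (𝓡 n) q).source) :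
    (fderiv ℝ (fun z => flowRep η p q (t, z)) y).det ≠ 0 := by
  intro hdet
  have h1 := weightedJacobian_sq h hJ h0 ht hy hq
  rw [weightedJacobian, hdet, mul_zero, zero_pow two_ne_zero] at h1
  exact (pow_pos (volDensity_pos g hy) 2).ne h1

lemma isInvertible_fderiv_flowRep (h : IsFlow w η a b) (hJ : IsDensity g w J a b)
    (h0 : (0 : ℝ) ∈ Set.Ioo a b) {p q : M} {t : ℝ}
    (ht : t ∈ Set.Ioo a b) {y : 𝔼} (hy : y ∈ (extChartAt (𝓡 n) p).target)
    (hq : η (t, (extChartAt (𝓡 n) p).symm y) ∈ (extChartAt (𝓡 n) q).source) :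
    (fderiv ℝ (fun z => flowRep η p q (t, z)) y).IsInvertible :=
  ⟨ContinuousLinearMap.toContinuousLinearEquivOfDetNeZero _
    (det_flowRep_ne_zero h hJ h0 ht hy hq), by ext; rfl⟩

/-- The field `u` with `dη_t (u_t) = - w_t ∘ η_t`, which is the velocity of the inverse flow. -/
structure IsInverseVelocity (w : ℝ → (x : M) → TangentSpace (𝓡 n) x) (η : ℝ × M → M) (a b : ℝ)
    (u : ℝ → (x : M) → TangentSpace (𝓡 n) x) : Prop where
  eq : ∀ t ∈ Set.Ioo a b, ∀ x,
    mfderiv (𝓡 n) (𝓡 n) (fun x => η (t, x)) x (u t x) = -w t (η (t, x))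

lemma chartRep_injective {q x : M} (hx : x ∈ (extChartAt (𝓡 n) q).source) :
    Function.Injective (chartRep (𝓡 n) q x) := by
  obtain ⟨y, hy, rfl⟩ : ∃ y ∈ (extChartAt (𝓡 n) q).target, (extChartAt (𝓡 n) q).symm y = x :=
    ⟨_, (extChartAt (𝓡 n) q).map_source hx, (extChartAt (𝓡 n) q).left_inv hx⟩
  intro v v' hv
  rw [← chartVec_chartRep hy v, hv, chartVec_chartRep hy v']

omit [IsManifold (𝓡 n) ∞ M] in
lemma chartRep_neg (q x : M) (v : TangentSpace (𝓡 n) x) :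
    chartRep (𝓡 n) q x (-v) = -chartRep (𝓡 n) q x v :=
  map_neg (mfderiv (𝓡 n) 𝓘(ℝ, 𝔼) (extChartAt (𝓡 n) q) x) v

/-- The weighted Jacobian identity makes dη_t invertible at each point, so the linear equation for u
can be solved pointwise. Outside (a, b) the value 0 is a mere placeholder. -/
lemma exists_isInverseVelocity (h : IsFlow w η a b) (hJ : IsDensity g w J a b)
    (h0 : (0 : ℝ) ∈ Set.Ioo a b) :
    ∃ u : ℝ → (x : M) → TangentSpace (𝓡 n) x, IsInverseVelocity w η a b u := by
  have hchart : ∀ t ∈ Set.Ioo a b, ∀ p : M, ∀ y ∈ (extChartAt (𝓡 n) p).target,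
      ∃ v : TangentSpace (𝓡 n) ((extChartAt (𝓡 n) p).symm y),
        mfderiv (𝓡 n) (𝓡 n) (fun x => η (t, x)) ((extChartAt (𝓡 n) p).symm y) v
          = -w t (η (t, (extChartAt (𝓡 n) p).symm y)) := by
    intro t ht p y hy
    have hq := mem_extChartAt_source (I := 𝓡 n) (η (t, (extChartAt (𝓡 n) p).symm y))
    set q := η (t, (extChartAt (𝓡 n) p).symm y)
    obtain ⟨e, he⟩ := isInvertible_fderiv_flowRep h hJ h0 ht hy hq
    refine ⟨chartVec (𝓡 n) p y (e.symm (chartRep (𝓡 n) q q (-w t q))), chartRep_injective hq ?_⟩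
    rw [chartRep_mfderiv_flow h.smooth ht hy hq, chartRep_chartVec hy, ← he]
    exact e.apply_symm_apply _
  have key : ∀ t, ∀ x : M, ∃ v : TangentSpace (𝓡 n) x, t ∈ Set.Ioo a b →
      mfderiv (𝓡 n) (𝓡 n) (fun x => η (t, x)) x v = -w t (η (t, x)) := by
    intro t x
    by_cases ht : t ∈ Set.Ioo a b
    · have h1 := hchart t ht x _ (mem_extChartAt_target x)
      rw [extChartAt_to_inv] at h1
      exact h1.imp fun v hv _ => hv
    · exact ⟨0, fun h => absurd h ht⟩
  choose u hu using key
  exact ⟨u, ⟨fun t ht x => hu t x ht⟩⟩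

variable {u : ℝ → (x : M) → TangentSpace (𝓡 n) x}

lemma IsInverseVelocity.eq_chart (hu : IsInverseVelocity w η a b u) (h : IsFlow w η a b)
    {p q : M} {t : ℝ} (ht : t ∈ Set.Ioo a b) {y : 𝔼} (hy : y ∈ (extChartAt (𝓡 n) p).target)
    (hq : η (t, (extChartAt (𝓡 n) p).symm y) ∈ (extChartAt (𝓡 n) q).source) :
    fderiv ℝ (fun z => flowRep η p q (t, z)) y (fieldRep (u t) p y)
      = -fieldRep (w t) q (flowRep η p q (t, y)) := by
  rw [fieldRep, ← chartRep_mfderiv_flow h.smooth ht hy hq, hu.eq t ht, chartRep_neg, flowRep,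
    fieldRep_extChartAt _ hq]

/-- In coordinates u = -(Dη_t)⁻¹ (w_t∘η_t), and inversion of operators is smooth at invertible ones.
-/
lemma IsInverseVelocity.isSmoothFamily (hu : IsInverseVelocity w η a b u) (h : IsFlow w η a b)
    (hJ : IsDensity g w J a b) (h0 : (0 : ℝ) ∈ Set.Ioo a b) :
    IsSmoothFamily (Set.Ioo a b) u := by
  rw [isSmoothFamily_iff]
  rintro p ⟨t, y⟩ ⟨ht, hy⟩
  refine ContDiffAt.contDiffWithinAt ?_
  have hq := mem_extChartAt_source (I := 𝓡 n) (η (t, (extChartAt (𝓡 n) p).symm y))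
  set q := η (t, (extChartAt (𝓡 n) p).symm y)
  have hev := eventually_flow_mem_source h.smooth ht hy hq
  have hτ := contDiffAt_flowRep h.smooth ht hy hq
  have hA : ContDiffAt ℝ ∞ (fun z : ℝ × 𝔼 => fderiv ℝ (fun x => flowRep η p q (z.1, x)) z.2)
      (t, y) := by
    have h1 : ContDiffAt ℝ ∞ (fun z : ℝ × 𝔼 => fderiv ℝ (flowRep η p q) z ∘L
        ContinuousLinearMap.inr ℝ ℝ 𝔼) (t, y) :=
      (hτ.fderiv_right (m := ∞) (by simp)).clm_comp contDiffAt_const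
    refine h1.congr_of_eventuallyEq ?_
    filter_upwards [hev] with z hz
    exact (hasFDerivAt_slice
      ((contDiffAt_flowRep h.smooth hz.1 hz.2.1 hz.2.2).differentiableAt (by norm_num))).fderiv
  have hW : ContDiffAt ℝ ∞ (fun z : ℝ × 𝔼 => -fieldRep (w z.1) q (flowRep η p q z)) (t, y) := by
    have h1 := (isSmoothFamily_iff.1 h.field q).contDiffAt (x := (t, flowRep η p q (t, y)))
      (prod_target_mem_nhds ht ((extChartAt (𝓡 n) q).map_source hq))
    exact (ContDiffAt.comp (f := fun z : ℝ × 𝔼 => (z.1, flowRep η p q z)) (t, y) h1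
      (contDiffAt_fst.prodMk hτ)).neg
  have hinv : ContDiffAt ℝ ∞ ContinuousLinearMap.inverse
      (fderiv ℝ (fun x => flowRep η p q (t, x)) y) :=
    (isInvertible_fderiv_flowRep h hJ h0 ht hy hq).contDiffAt_map_inverse
  have hmain := (ContDiffAt.comp (f := fun z : ℝ × 𝔼 =>
    fderiv ℝ (fun x => flowRep η p q (z.1, x)) z.2) (t, y) hinv hA).clm_apply hW
  refine hmain.congr_of_eventuallyEq ?_
  filter_upwards [hev] with z hz
  exact ((isInvertible_fderiv_flowRep h hJ h0 hz.1 hz.2.1 hz.2.2).inverse_apply_eq.2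
    (hu.eq_chart h hz.1 hz.2.1 hz.2.2).symm).symm

/-- The divergence of the velocity of the inverse flow. -/
theorem IsInverseVelocity.divergence_eq (hu : IsInverseVelocity w η a b u) (h : IsFlow w η a b)
    (hJ : IsDensity g w J a b) (h0 : (0 : ℝ) ∈ Set.Ioo a b) {t : ℝ} (ht : t ∈ Set.Ioo a b) (x : M) :
    divergence g (u t) x = derivWithin (fun s => J (s, η (t, x))) (Set.Ioo a b) t
      / J (t, η (t, x)) := by
  have hus := (hu.isSmoothFamily h hJ h0).isSmoothField ht
  have hy := mem_extChartAt_target (I := 𝓡 n) x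
  have hq : η (t, (extChartAt (𝓡 n) x).symm (extChartAt (𝓡 n) x x))
      ∈ (extChartAt (𝓡 n) (η (t, x))).source := by
    rw [extChartAt_to_inv]
    exact mem_extChartAt_source _
  set q := η (t, x) with hqdef
  set y := extChartAt (𝓡 n) x x with hydef
  have hzq : flowRep η x q (t, y) = extChartAt (𝓡 n) q q := by
    rw [flowRep, extChartAt_to_inv]
  have hz : flowRep η x q (t, y) ∈ (extChartAt (𝓡 n) q).target :=
    (extChartAt (𝓡 n) q).map_source hq
  have hsm : IsSmoothField fun x => J (t, x) • w t x :=
    isSmoothField_smul (hJ.smooth.contMDiff_slice ht) (h.field.isSmoothField ht)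
  have hc : Filter.Tendsto (fun z : 𝔼 => (t, z)) (𝓝 y) (𝓝 (t, y)) :=
    (Continuous.prodMk_right t).tendsto y
  have hev := hc.eventually (eventually_flow_mem_source h.smooth ht hy hq)
  have hτ : ContDiffAt ℝ ∞ (fun z => flowRep η x q (t, z)) y :=
    ContDiffAt.comp (f := fun z : 𝔼 => (t, z)) y (contDiffAt_flowRep h.smooth ht hy hq)
      (contDiffAt_const.prodMk contDiffAt_id)
  have hJz : DifferentiableAt ℝ (fun z => J (t, (extChartAt (𝓡 n) q).symm z))
      (flowRep η x q (t, y)) := (hasFDerivAt_slice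
        (f := fun z : ℝ × 𝔼 => J (z.1, (extChartAt (𝓡 n) q).symm z.2))
        (hJ.smooth.differentiableAt_chart ht hz)).differentiableAt
  -- The coordinate flow is treated as a change of variables. It carries u to -w and, by
  -- `weightedJacobian_sq`, the density √g to J√g. Hence div u at x is -J⁻¹ div(Jw) at η(t, x),
  -- which the continuity equation identifies with ∂_t J / J.
  have h1 := densityDiv_comp (τ := fun z => flowRep η x q (t, z)) (s := volDensity g x)
    (σ := fun z => J (t, (extChartAt (𝓡 n) q).symm z) * volDensity g q z)
    (v := fieldRep (u t) x) (w := fun z => -fieldRep (w t) q z) hτ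
    (differentiableAt_volDensity g hy) (hJz.mul (differentiableAt_volDensity g hz))
    (differentiableAt_fieldRep hus hy)
    (differentiableAt_fieldRep (h.field.isSmoothField ht) hz).neg (volDensity_pos g hy).ne' (by
      filter_upwards [hev] with z hz
      exact (hu.eq_chart h ht hz.2.1 hz.2.2).symm) (by
      filter_upwards [hev] with z hz
      rw [← weightedJacobian_sq h hJ h0 ht hz.2.1 hz.2.2, weightedJacobian, flowRep,
        (extChartAt (𝓡 n) q).left_inv hz.2.2]
      ring)
  rw [divergence_eq_densityDiv, h1, densityDiv]
  have h2 : ∀ i, partialDeriv i (fun z => J (t, (extChartAt (𝓡 n) q).symm z) * volDensity g q z *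
      (-fieldRep (w t) q z) i) (flowRep η x q (t, y))
      = -partialDeriv i (fun z => volDensity g q z *
        fieldRep (fun x => J (t, x) • w t x) q z i) (flowRep η x q (t, y)) := by
    intro i
    have h3 : (fun z => J (t, (extChartAt (𝓡 n) q).symm z) * volDensity g q z *
        (-fieldRep (w t) q z) i) = fun z => -(volDensity g q z *
          fieldRep (fun x => J (t, x) • w t x) q z i) := by
      ext1 z
      rw [fieldRep, fieldRep, chartRep_smul, PiLp.smul_apply, PiLp.neg_apply, smul_eq_mul]
      ring
    rw [h3, partialDeriv, partialDeriv, fderiv_fun_neg]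
    rfl
  have h4 := hJ.continuity t ht q
  rw [divergence_eq_densityDiv, ← hzq, densityDiv] at h4
  rw [Finset.sum_congr rfl fun i _ => h2 i, Finset.sum_neg_distrib]
  have h5 : (extChartAt (𝓡 n) q).symm (flowRep η x q (t, y)) = q := by
    rw [hzq, extChartAt_to_inv]
  have hpos := (hJ.pos t ht q).ne'
  have hvol := (volDensity_pos g hz).ne'
  rw [h5, eq_div_iff hpos, mul_inv]
  field_simp
  field_simp at h4
  linear_combination -h4

/-- A function transported by the flow evolves by transport along the inverse velocity. -/
theorem IsInverseVelocity.transport (hu : IsInverseVelocity w η a b u) (h : IsFlow w η a b)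
    {R : ℝ × M → ℝ} (hR : SmoothOver n (Set.Ioo a b) R) {t : ℝ} (ht : t ∈ Set.Ioo a b) (x : M) :
    HasDerivAt (fun s => R (s, η (s, x)))
      (derivWithin (fun s => R (s, η (t, x))) (Set.Ioo a b) t
        - dirDeriv (fun x => R (t, η (t, x))) x (u t x)) t := by
  have hy := mem_extChartAt_target (I := 𝓡 n) x
  have hq : η (t, (extChartAt (𝓡 n) x).symm (extChartAt (𝓡 n) x x))
      ∈ (extChartAt (𝓡 n) (η (t, x))).source := by
    rw [extChartAt_to_inv]
    exact mem_extChartAt_source _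
  set q := η (t, x) with hqdef
  set y := extChartAt (𝓡 n) x x with hydef
  have hz : flowRep η x q (t, y) ∈ (extChartAt (𝓡 n) q).target :=
    (extChartAt (𝓡 n) q).map_source hq
  have hzq : flowRep η x q (t, y) = extChartAt (𝓡 n) q q := by
    rw [flowRep, extChartAt_to_inv]
  have hRd := hR.differentiableAt_chart ht hz
  have hτ := (contDiffAt_flowRep h.smooth ht hy hq).differentiableAt (by norm_num)
  have hev := eventually_flow_mem_source h.smooth ht hy hq
  have hc : Filter.Tendsto (fun z : 𝔼 => (t, z)) (𝓝 y) (𝓝 (t, y)) :=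
    (Continuous.prodMk_right t).tendsto y
  have hc' : Filter.Tendsto (fun s : ℝ => (s, y)) (𝓝 t) (𝓝 (t, y)) :=
    (Continuous.prodMk_left y).tendsto t
  set D := fderiv ℝ (fun z : ℝ × 𝔼 => R (z.1, (extChartAt (𝓡 n) q).symm z.2))
    (t, flowRep η x q (t, y)) with hD
  have h1 : D (1, 0) = derivWithin (fun s => R (s, q)) (Set.Ioo a b) t := by
    have h2 := hasDerivAt_slice hRd
    have h3 := (hR.hasDerivWithinAt ht ((extChartAt (𝓡 n) q).symm
        (flowRep η x q (t, y)))).hasDerivAt (isOpen_Ioo.mem_nhds ht)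
    have h4 := h2.unique h3
    rwa [hzq, extChartAt_to_inv, ← hzq] at h4
  have h5 : HasDerivAt (fun s => R (s, η (s, x))) (D (1, fieldRep (w t) q
      (flowRep η x q (t, y)))) t := by
    have h6 := hasDerivAt_slice hτ
    rw [(h.fderiv_time ht hy hq).self_of_nhds] at h6
    have h7 : HasDerivAt (fun s => R (s, (extChartAt (𝓡 n) q).symm (flowRep η x q (s, y))))
        (D (1, fieldRep (w t) q (flowRep η x q (t, y)))) t :=
      HasFDerivAt.comp_hasDerivAt (f := fun s => (s, flowRep η x q (s, y))) t hRd.hasFDerivAt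
        ((hasDerivAt_id t).prodMk h6)
    refine h7.congr_of_eventuallyEq ?_
    filter_upwards [hc'.eventually hev] with s hs
    have h8 := (extChartAt (𝓡 n) q).left_inv hs.2.2
    rw [flowRep, h8, hydef, extChartAt_to_inv]
  -- By the chain rule the time derivative along the orbit is ∂_t R + dR(w), while dη(u) = -w gives
  -- d(R∘η)(u) = -dR(w).
  have h9 : dirDeriv (fun x => R (t, η (t, x))) x (u t x)
      = D (0, -fieldRep (w t) q (flowRep η x q (t, y))) := by
    have hsm : ContMDiff (𝓡 n) 𝓘(ℝ, ℝ) ∞ (fun x => R (t, η (t, x))) := by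
      have h10 : ContMDiff (𝓡 n) (𝓡 n) ∞ fun x : M => η (t, x) :=
        h.smooth.comp_contMDiff (contMDiff_const.prodMk contMDiff_id) fun _ => ⟨ht, Set.mem_univ _⟩
      exact (hR.contMDiff_slice ht).comp h10
    rw [dirDeriv_eq_chart (hsm.mdifferentiableAt (by norm_num)) (mem_extChartAt_source x)]
    have h11 : HasFDerivAt (fun z => R (t, (extChartAt (𝓡 n) q).symm (flowRep η x q (t, z))))
        ((D ∘L ContinuousLinearMap.inr ℝ ℝ 𝔼) ∘L fderiv ℝ (fun z => flowRep η x q (t, z)) y) y :=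
      HasFDerivAt.comp (g := fun z => R (t, (extChartAt (𝓡 n) q).symm z)) y
        (hasFDerivAt_slice (f := fun z : ℝ × 𝔼 => R (z.1, (extChartAt (𝓡 n) q).symm z.2)) hRd)
        (hasFDerivAt_slice hτ).differentiableAt.hasFDerivAt
    have h12 : (fun z => R (t, η (t, (extChartAt (𝓡 n) x).symm z))) =ᶠ[𝓝 y]
        fun z => R (t, (extChartAt (𝓡 n) q).symm (flowRep η x q (t, z))) := by
      filter_upwards [hc.eventually hev] with z hz
      have h8 := (extChartAt (𝓡 n) q).left_inv hz.2.2
      rw [flowRep, h8]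
    rw [h12.fderiv_eq, h11.fderiv, ← hu.eq_chart h ht hy hq,
      ← fieldRep_extChartAt _ (mem_extChartAt_source x)]
    rfl
  convert! h5 using 1
  rw [h9, ← h1, ← map_sub]
  simp

end Transport

/-! ### The explicit Jacobian and the construction of the solution. -/

section Existence

variable {n : ℕ} {M : Type*} [TopologicalSpace M] [ChartedSpace (EuclideanSpace ℝ (Fin n)) M]

/-- The square root of the Jacobian of the flow of a solution with initial divergence `ρ`. -/
def jacobianRoot (κ : ℝ) (ρ : M → ℝ) (z : ℝ × M) : ℝ :=
  Real.cos (κ * z.1) + ρ z.2 / (2 * κ) * Real.sin (κ * z.1)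

/-- The time derivative of `jacobianRoot`. -/
def jacobianRootDeriv (κ : ℝ) (ρ : M → ℝ) (z : ℝ × M) : ℝ :=
  -κ * Real.sin (κ * z.1) + ρ z.2 / 2 * Real.cos (κ * z.1)

omit [TopologicalSpace M] [ChartedSpace (EuclideanSpace ℝ (Fin n)) M] in
lemma hasDerivAt_jacobianRoot {κ : ℝ} (hκ : κ ≠ 0) (ρ : M → ℝ) (t : ℝ) (x : M) :
    HasDerivAt (fun s => jacobianRoot κ ρ (s, x)) (jacobianRootDeriv κ ρ (t, x)) t := by
  have h : HasDerivAt (fun s => κ * s) (κ * 1) t := (hasDerivAt_id t).const_mul κ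
  have h2 := h.cos.add (h.sin.const_mul (ρ x / (2 * κ)))
  convert! h2 using 1
  rw [jacobianRootDeriv]
  field_simp

omit [TopologicalSpace M] [ChartedSpace (EuclideanSpace ℝ (Fin n)) M] in
lemma hasDerivAt_jacobianRootDeriv {κ : ℝ} (hκ : κ ≠ 0) (ρ : M → ℝ) (t : ℝ) (x : M) :
    HasDerivAt (fun s => jacobianRootDeriv κ ρ (s, x)) (-κ ^ 2 * jacobianRoot κ ρ (t, x)) t := by
  have h : HasDerivAt (fun s => κ * s) (κ * 1) t := (hasDerivAt_id t).const_mul κ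
  have h2 := (h.sin.const_mul (-κ)).add (h.cos.const_mul (ρ x / 2))
  convert! h2 using 1
  rw [jacobianRoot]
  field_simp
  ring

omit [TopologicalSpace M] [ChartedSpace (EuclideanSpace ℝ (Fin n)) M] in
lemma derivWithin_jacobianRoot_sq {κ : ℝ} (hκ : κ ≠ 0) (ρ : M → ℝ) {a b t : ℝ}
    (ht : t ∈ Set.Ioo a b) (x : M) :
    derivWithin (fun s => jacobianRoot κ ρ (s, x) ^ 2) (Set.Ioo a b) t
      = 2 * jacobianRoot κ ρ (t, x) * jacobianRootDeriv κ ρ (t, x) := by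
  have h := ((hasDerivAt_jacobianRoot hκ ρ t x).pow 2).hasDerivWithinAt.derivWithin
    (isOpen_Ioo.uniqueDiffWithinAt ht)
  simpa [Pi.pow_def] using h

omit [TopologicalSpace M] [ChartedSpace (EuclideanSpace ℝ (Fin n)) M] in
-- Twice the logarithmic derivative of a solution of f'' = -κ²f solves the Riccati equation R' =
-- -2κ² - R²/2.
lemma hasDerivAt_logDeriv_jacobianRoot {κ : ℝ} (hκ : κ ≠ 0) (ρ : M → ℝ) {t : ℝ} {x : M}
    (hpos : jacobianRoot κ ρ (t, x) ≠ 0) :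
    HasDerivAt (fun s => 2 * (jacobianRootDeriv κ ρ (s, x) / jacobianRoot κ ρ (s, x)))
      (-2 * κ ^ 2 - 1 / 2 * (2 * (jacobianRootDeriv κ ρ (t, x) / jacobianRoot κ ρ (t, x))) ^ 2)
      t := by
  have h := (((hasDerivAt_jacobianRootDeriv hκ ρ t x).div
    (hasDerivAt_jacobianRoot hκ ρ t x) hpos)).const_mul 2
  convert! h using 1
  field_simp

lemma contMDiff_comp_mul_fst {f : ℝ → ℝ} (hf : ContDiff ℝ ∞ f) (κ : ℝ) :
    ContMDiff (𝓘(ℝ, ℝ).prod (𝓡 n)) 𝓘(ℝ, ℝ) ∞ fun z : ℝ × M => f (κ * z.1) :=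
  (hf.comp (contDiff_const.mul contDiff_id) :
    ContDiff ℝ ∞ fun s => f (κ * s)).contMDiff.comp contMDiff_fst

lemma smoothOver_jacobianRoot (κ : ℝ) {ρ : M → ℝ} (hρ : ContMDiff (𝓡 n) 𝓘(ℝ, ℝ) ∞ ρ) (S : Set ℝ) :
    SmoothOver n S (jacobianRoot κ ρ) := by
  have h : ContMDiff (𝓘(ℝ, ℝ).prod (𝓡 n)) 𝓘(ℝ, ℝ) ∞ fun z : ℝ × M => (2 * κ)⁻¹ * ρ z.2 :=
    contMDiff_const.mul (hρ.comp contMDiff_snd)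
  refine (((contMDiff_comp_mul_fst Real.contDiff_cos κ).add
    (h.mul (contMDiff_comp_mul_fst Real.contDiff_sin κ))).contMDiffOn).congr fun z _ => ?_
  simp only [jacobianRoot, div_eq_inv_mul, Pi.add_apply, Pi.mul_apply]

lemma smoothOver_jacobianRootDeriv (κ : ℝ) {ρ : M → ℝ} (hρ : ContMDiff (𝓡 n) 𝓘(ℝ, ℝ) ∞ ρ)
    (S : Set ℝ) : SmoothOver n S (jacobianRootDeriv κ ρ) := by
  have h : ContMDiff (𝓘(ℝ, ℝ).prod (𝓡 n)) 𝓘(ℝ, ℝ) ∞ fun z : ℝ × M => (2 : ℝ)⁻¹ * ρ z.2 :=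
    contMDiff_const.mul (hρ.comp contMDiff_snd)
  have hc : ContMDiff (𝓘(ℝ, ℝ).prod (𝓡 n)) 𝓘(ℝ, ℝ) ∞ fun _ : ℝ × M => -κ := contMDiff_const
  refine (((hc.mul (contMDiff_comp_mul_fst Real.contDiff_sin κ)).add
    (h.mul (contMDiff_comp_mul_fst Real.contDiff_cos κ))).contMDiffOn).congr fun z _ => ?_
  simp only [jacobianRootDeriv, div_eq_inv_mul, Pi.add_apply, Pi.mul_apply]

omit [TopologicalSpace M] [ChartedSpace (EuclideanSpace ℝ (Fin n)) M] in
/-- `jacobianRoot` is positive until the time determined by a lower bound of `ρ`. -/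
lemma jacobianRoot_pos {κ : ℝ} (hκ : 0 < κ) {ρ : M → ℝ} {m : ℝ} (hm : ∀ x, m ≤ ρ x) {t : ℝ}
    (h0 : 0 ≤ t) (ht : κ * t < Real.pi / 2 + Real.arctan (m / (2 * κ))) (x : M) :
    0 < jacobianRoot κ ρ (t, x) := by
  set θ := Real.arctan (m / (2 * κ)) with hθ
  have h1 := Real.neg_pi_div_two_lt_arctan (m / (2 * κ))
  have h2 := Real.arctan_lt_pi_div_two (m / (2 * κ))
  rw [← hθ] at h1 h2
  have hκt : 0 ≤ κ * t := mul_nonneg hκ.le h0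
  have hsin : 0 ≤ Real.sin (κ * t) := Real.sin_nonneg_of_nonneg_of_le_pi hκt (by linarith)
  have hcos : 0 < Real.cos θ := Real.cos_pos_of_mem_Ioo ⟨h1, h2⟩
  have htan : m / (2 * κ) = Real.sin θ / Real.cos θ := by
    rw [← Real.tan_eq_sin_div_cos, hθ, Real.tan_arctan]
  have h3 : 0 < Real.cos (κ * t - θ) := Real.cos_pos_of_mem_Ioo ⟨by linarith, by linarith⟩
  -- With tan θ = m/(2κ) the lower bound for f is cos(κt - θ)/cos θ, positive as long as κt - θ <
  -- π/2.
  have h4 : Real.cos (κ * t) + m / (2 * κ) * Real.sin (κ * t)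
      = Real.cos (κ * t - θ) / Real.cos θ := by
    rw [htan, Real.cos_sub]
    field_simp
  have h5 : m / (2 * κ) * Real.sin (κ * t) ≤ ρ x / (2 * κ) * Real.sin (κ * t) :=
    mul_le_mul_of_nonneg_right (div_le_div_of_nonneg_right (hm x) (by positivity)) hsin
  have h6 := div_pos h3 hcos
  rw [jacobianRoot]
  linarith

/-- At t = 0 the function is 1, and compactness keeps it positive for slightly negative times. This
makes 0 an interior time, so the flow lives on an open interval although the solution is wanted on
[0, T_max). -/
lemma exists_jacobianRoot_pos [CompactSpace M] (κ : ℝ) {ρ : M → ℝ}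
    (hρ : ContMDiff (𝓡 n) 𝓘(ℝ, ℝ) ∞ ρ) :
    ∃ a < 0, ∀ t, a < t → t ≤ 0 → ∀ x, 0 < jacobianRoot κ ρ (t, x) := by
  have hc : Continuous (jacobianRoot κ ρ) := by
    have h := hρ.continuous
    unfold jacobianRoot
    fun_prop
  have h1 : ∀ᶠ t in 𝓝 (0 : ℝ), ∀ x ∈ (Set.univ : Set M), 0 < jacobianRoot κ ρ (t, x) := by
    refine isCompact_univ.eventually_forall_of_forall_eventually fun x _ => ?_
    refine hc.continuousAt.eventually (lt_mem_nhds ?_)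
    simp [jacobianRoot]
  obtain ⟨a, ha, h⟩ := (mem_nhdsLE_iff_exists_Ioc_subset' (show (-1 : ℝ) < 0 by norm_num)).1
    (mem_nhdsWithin_of_mem_nhds h1)
  exact ⟨a, ha, fun t h2 h3 x => h ⟨h2, h3⟩ x (Set.mem_univ x)⟩

variable [IsManifold (𝓡 n) ∞ M]

lemma IsSmoothFamily.smul {S : Set ℝ} {F : ℝ × M → ℝ} (hF : SmoothOver n S F)
    {u : ℝ → (x : M) → TangentSpace (𝓡 n) x} (hu : IsSmoothFamily S u) :
    IsSmoothFamily S fun t x => F (t, x) • u t x := by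
  rw [isSmoothFamily_iff] at hu ⊢
  intro p
  exact ((hF.contDiffOn_chart p).smul (hu p)).congr fun z _ => chartRep_smul _ _ _ _

lemma IsSmoothFamily.add {S : Set ℝ} {u v : ℝ → (x : M) → TangentSpace (𝓡 n) x}
    (hu : IsSmoothFamily S u) (hv : IsSmoothFamily S v) :
    IsSmoothFamily S fun t x => u t x + v t x := by
  rw [isSmoothFamily_iff] at hu hv ⊢
  intro p
  exact ((hu p).add (hv p)).congr fun z _ => chartRep_add _ _ _ _

/-- The momentum `J w` of the flow of a solution. -/
def momentum (κ : ℝ) (u₀ v : (x : M) → TangentSpace (𝓡 n) x) (t : ℝ) (x : M) :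
    TangentSpace (𝓡 n) x :=
  (-Real.cos (2 * κ * t)) • u₀ x + (-Real.sin (2 * κ * t)) • v x

lemma isSmoothFamily_momentum (κ : ℝ) {u₀ v : (x : M) → TangentSpace (𝓡 n) x}
    (hu₀ : IsSmoothField u₀) (hv : IsSmoothField v) (S : Set ℝ) :
    IsSmoothFamily S (momentum κ u₀ v) :=
  (IsSmoothFamily.smul (F := fun z => -Real.cos (2 * κ * z.1))
    (contMDiff_comp_mul_fst Real.contDiff_cos.neg (2 * κ)).contMDiffOn
      (hu₀.isSmoothFamily S)).add
  (IsSmoothFamily.smul (F := fun z => -Real.sin (2 * κ * z.1))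
    (contMDiff_comp_mul_fst Real.contDiff_sin.neg (2 * κ)).contMDiffOn (hv.isSmoothFamily S))

lemma divergence_momentum (g : SmoothMetric n M) (κ : ℝ) {u₀ v : (x : M) → TangentSpace (𝓡 n) x}
    (hu₀ : IsSmoothField u₀) (hv : IsSmoothField v) (t : ℝ) (x : M) :
    divergence g (momentum κ u₀ v t) x = -Real.cos (2 * κ * t) * divergence g u₀ x
      + -Real.sin (2 * κ * t) * divergence g v x := by
  have h := divergence_add g (isSmoothField_smul (contMDiff_const (c := -Real.cos (2 * κ * t))) hu₀)
    (isSmoothField_smul (contMDiff_const (c := -Real.sin (2 * κ * t))) hv) x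
  rw [divergence_const_smul g _ hu₀, divergence_const_smul g _ hv] at h
  exact h

/-- By the double-angle formulas ∂_t(f²) = ρ₀ cos 2κt + (ρ₀²/(4κ) - κ) sin 2κt, which is minus the
divergence of the momentum. This is what dictates the divergence of v. -/
lemma isDensity_jacobianRoot_sq (g : SmoothMetric n M) {κ : ℝ} (hκ : κ ≠ 0)
    {u₀ v : (x : M) → TangentSpace (𝓡 n) x} (hu₀ : IsSmoothField u₀) (hv : IsSmoothField v)
    (hdiv : ∀ x, divergence g v x = divergence g u₀ x ^ 2 / (4 * κ) - κ) {a b : ℝ}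
    (hpos : ∀ t ∈ Set.Ioo a b, ∀ x, 0 < jacobianRoot κ (divergence g u₀) (t, x)) :
    IsDensity g (fun t x => (jacobianRoot κ (divergence g u₀) (t, x) ^ 2)⁻¹ • momentum κ u₀ v t x)
      (fun z => jacobianRoot κ (divergence g u₀) z ^ 2) a b where
  smooth := ContMDiffOn.pow (smoothOver_jacobianRoot κ (contMDiff_divergence g hu₀) _) 2
  pos t ht x := pow_pos (hpos t ht x) 2
  zero x := by simp [jacobianRoot]
  continuity t ht x := by
    have h1 : (fun x => (jacobianRoot κ (divergence g u₀) (t, x) ^ 2) •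
        ((jacobianRoot κ (divergence g u₀) (t, x) ^ 2)⁻¹ • momentum κ u₀ v t x))
        = momentum κ u₀ v t := by
      ext1 x
      exact smul_inv_smul₀ (pow_pos (hpos t ht x) 2).ne' _
    simp only [h1, derivWithin_jacobianRoot_sq hκ _ ht, divergence_momentum g κ hu₀ hv, hdiv]
    rw [jacobianRoot, jacobianRootDeriv, mul_assoc 2 κ, Real.cos_two_mul, Real.sin_two_mul]
    field_simp
    linear_combination (-8 * κ * divergence g u₀ x) * Real.sin_sq_add_cos_sq (κ * t)

lemma IsInverseVelocity.zero_eq {w : ℝ → (x : M) → TangentSpace (𝓡 n) x} {η : ℝ × M → M} {a b : ℝ}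
    {u : ℝ → (x : M) → TangentSpace (𝓡 n) x} (hu : IsInverseVelocity w η a b u)
    (h : IsFlow w η a b) (h0 : (0 : ℝ) ∈ Set.Ioo a b) (x : M) : u 0 x = -w 0 x := by
  -- The tangent space containing w 0 (φ x) depends on φ, so η(0, ·) is generalized before being
  -- replaced by the identity.
  have key : ∀ φ : M → M, φ = id →
      mfderiv (𝓡 n) (𝓡 n) φ x (u 0 x) = -w 0 (φ x) → u 0 x = -w 0 x := by
    rintro φ rfl hφ
    rw [mfderiv_id] at hφ
    exact hφ
  exact key _ (funext h.zero) (hu.eq 0 h0 x)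

variable [T2Space M] [CompactSpace M] [ConnectedSpace M] [MeasurableSpace M] [BorelSpace M]

/-- A field with divergence solving the local equation for the constant `-2κ²` solves the
`Ḣ¹` Euler–Arnold equation. -/
lemma isSolution_of_local_equation {g : SmoothMetric n M} {u₀ : (x : M) → TangentSpace (𝓡 n) x}
    {T : ℝ} {u : ℝ → (x : M) → TangentSpace (𝓡 n) x} (hu : IsSmoothFamily (Set.Ico 0 T) u)
    (h0 : ∀ x, divergence g (u 0) x = divergence g u₀ x)
    (heq : ∀ t ∈ Set.Ico 0 T, ∀ x : M,
      derivWithin (fun s => divergence g (u s) x) (Set.Ico 0 T) t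
        + dirDeriv (divergence g (u t)) x (u t x) + (1 / 2) * divergence g (u t) x ^ 2
      = -2 * kappa g u₀ ^ 2) : IsSolution g T u where
  smooth := hu
  equation t ht x := by
    have hμ := riemVolume_real_univ_pos g
    -- Energy conservation needs only a right-hand side constant in space, so it already holds for
    -- the local equation and shows that -2κ² is the required non-local term at every time.
    have h1 := integral_sq_divergence_eq g hu (c := fun _ => -2 * kappa g u₀ ^ 2) heq ht
    simp only [h0] at h1
    rw [heq t ht x, h1, kappa_sq g u₀]
    field_simp
    ring

/-- The definition of κ says ∫ρ₀² = 4 μ(M) κ², which is exactly the statement that this function has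
mean zero. -/
lemma isDivergence_sq_sub (g : SmoothMetric n M) {u₀ : (x : M) → TangentSpace (𝓡 n) x}
    (hu₀ : IsSmoothField u₀) :
    IsDivergence g fun x => divergence g u₀ x ^ 2 / (4 * kappa g u₀) - kappa g u₀ := by
  have hfin := isFiniteMeasure_riemVolume g
  have hρ := contMDiff_divergence g hu₀
  have hsq : Continuous fun x => divergence g u₀ x ^ 2 / (4 * kappa g u₀) :=
    (hρ.continuous.pow 2).div_const _
  refine isDivergence_of_integral_eq_zero g ?_ ?_
  · have h : ContDiff ℝ ∞ fun r : ℝ => r ^ 2 / (4 * kappa g u₀) - kappa g u₀ :=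
      ((contDiff_id.pow 2).div_const _).sub contDiff_const
    exact h.contMDiff.comp hρ
  · rw [MeasureTheory.integral_sub (hsq.integrable_of_hasCompactSupport
      (HasCompactSupport.of_compactSpace _)) (MeasureTheory.integrable_const _),
      MeasureTheory.integral_div, kappa_sq, MeasureTheory.integral_const, smul_eq_mul]
    field_simp
    ring

/-- With w = m/f² and its flow η, the velocity u of the inverse flow has divergence R(t, η(t, x)).
Then ρ_t + u·∇ρ equals ∂_t R along η, and the Riccati equation for R is the local equation. -/
theorem exists_isSolution (g : SmoothMetric n M) {u₀ : (x : M) → TangentSpace (𝓡 n) x}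
    (hu₀ : IsSmoothField u₀) (hκ : 0 < kappa g u₀) :
    ∃ u : ℝ → (x : M) → TangentSpace (𝓡 n) x, IsSolution g (maxTime g u₀) u ∧ u 0 = u₀ := by
  obtain ⟨v, hv, hdiv⟩ := isDivergence_sq_sub g hu₀
  have hρ := contMDiff_divergence g hu₀
  have hT := maxTime_pos g hκ
  have hκT := kappa_mul_maxTime g hκ
  have hmin : ∀ x, (⨅ x : M, divergence g u₀ x) ≤ divergence g u₀ x := by
    refine fun x => ciInf_le ?_ x
    exact (isCompact_range hρ.continuous).bddBelow
  obtain ⟨a, ha, hneg⟩ := exists_jacobianRoot_pos (kappa g u₀) hρ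
  set κ := kappa g u₀
  set T := maxTime g u₀
  set f := jacobianRoot κ (divergence g u₀)
  set f' := jacobianRootDeriv κ (divergence g u₀)
  have hpos : ∀ t ∈ Set.Ioo a T, ∀ x, 0 < f (t, x) := by
    intro t ht x
    rcases le_total t 0 with h | h
    · exact hneg t ht.1 h x
    · refine jacobianRoot_pos hκ hmin h ?_ x
      rw [← hκT]
      exact mul_lt_mul_of_pos_left ht.2 hκ
  have hf : SmoothOver n (Set.Ioo a T) f := smoothOver_jacobianRoot κ hρ _
  have hf' : SmoothOver n (Set.Ioo a T) f' := smoothOver_jacobianRootDeriv κ hρ _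
  have hJ := isDensity_jacobianRoot_sq g hκ.ne' hu₀ hv hdiv hpos
  have hw : IsSmoothFamily (Set.Ioo a T) fun t x => (f (t, x) ^ 2)⁻¹ • momentum κ u₀ v t x :=
    IsSmoothFamily.smul (F := fun z => (f z ^ 2)⁻¹)
      (ContMDiffOn.inv₀ (ContMDiffOn.pow hf 2) fun z hz => (pow_pos (hpos z.1 hz.1 z.2) 2).ne')
      (isSmoothFamily_momentum κ hu₀ hv _)
  have h0 : (0 : ℝ) ∈ Set.Ioo a T := ⟨ha, hT⟩
  obtain ⟨η, hη, hflow⟩ := exists_timeDependent_flow (I := 𝓡 n)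
    (w := fun t x => (f (t, x) ^ 2)⁻¹ • momentum κ u₀ v t x) ha hT hw
  have hF : IsFlow (fun t x => (f (t, x) ^ 2)⁻¹ • momentum κ u₀ v t x) η a T :=
    ⟨hw, hη, fun x => (hflow x).1, fun x => (hflow x).2⟩
  obtain ⟨u, hu⟩ := exists_isInverseVelocity hF hJ h0
  have hus : IsSmoothFamily (Set.Ioo a T) u := hu.isSmoothFamily hF hJ h0
  have hsub : Set.Ico 0 T ⊆ Set.Ioo a T := fun t ht => ⟨ha.trans_le ht.1, ht.2⟩
  have hu0 : u 0 = u₀ := by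
    ext1 x
    rw [hu.zero_eq hF h0 x]
    simp [momentum, f, jacobianRoot]
  set R : ℝ × M → ℝ := fun z => 2 * (f' z / f z)
  have hR : SmoothOver n (Set.Ioo a T) R :=
    contMDiffOn_const.mul (ContMDiffOn.div₀ hf' hf fun z hz => (hpos z.1 hz.1 z.2).ne')
  have hdivu : ∀ t ∈ Set.Ioo a T, ∀ x, divergence g (u t) x = R (t, η (t, x)) := by
    intro t ht x
    have h3 := (hpos t ht (η (t, x))).ne'
    rw [hu.divergence_eq hF hJ h0 ht x, derivWithin_jacobianRoot_sq hκ.ne' _ ht]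
    change 2 * f (t, η (t, x)) * f' (t, η (t, x)) / f (t, η (t, x)) ^ 2
      = 2 * (f' (t, η (t, x)) / f (t, η (t, x)))
    field_simp
  refine ⟨u, isSolution_of_local_equation (hus.mono hsub) (fun x => by rw [hu0]) ?_, hu0⟩
  intro t ht x
  have htI := hsub ht
  have h1 := (hasDerivAt_logDeriv_jacobianRoot hκ.ne' (divergence g u₀)
    (hpos t htI (η (t, x))).ne').hasDerivWithinAt.derivWithin (isOpen_Ioo.uniqueDiffWithinAt htI)
  -- At t = 0 the one-sided derivative on [0, T) is inherited from a genuine derivative, since all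
  -- objects extend to times in (a, 0).
  have h2 : derivWithin (fun s => divergence g (u s) x) (Set.Ico 0 T) t
      = derivWithin (fun s => R (s, η (t, x))) (Set.Ioo a T) t
        - dirDeriv (fun x => R (t, η (t, x))) x (u t x) := by
    rw [derivWithin_congr (fun s hs => hdivu s (hsub hs) x) (hdivu t htI x)]
    exact (hu.transport hF hR htI x).hasDerivWithinAt.derivWithin (uniqueDiffOn_Ico 0 T t ht)
  have h3 : divergence g (u t) = fun x => R (t, η (t, x)) := funext (hdivu t htI)
  have h4 : derivWithin (fun s => R (s, η (t, x))) (Set.Ioo a T) t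
      = -2 * κ ^ 2 - 1 / 2 * R (t, η (t, x)) ^ 2 := h1
  rw [h2, h3, h4]
  ring

end Existence

end HdotEulerArnold

end

theorem mainTheorem4 {n : ℕ} {M : Type*} [TopologicalSpace M]
    [ChartedSpace (EuclideanSpace ℝ (Fin n)) M] [IsManifold (𝓡 n) ∞ M]
    [T2Space M] [CompactSpace M] [ConnectedSpace M] [MeasurableSpace M] [BorelSpace M]
    (g : HdotEulerArnold.SmoothMetric n M)
    (u₀ : (x : M) → TangentSpace (𝓡 n) x) (hu₀ : HdotEulerArnold.IsSmoothField u₀)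
    (hdiv : ∃ x, HdotEulerArnold.divergence g u₀ x ≠ 0) :
    0 < HdotEulerArnold.maxTime g u₀ ∧
    (∃ u : ℝ → (x : M) → TangentSpace (𝓡 n) x,
      HdotEulerArnold.IsSolution g (HdotEulerArnold.maxTime g u₀) u ∧ u 0 = u₀) ∧
    (∀ (T : ℝ) (u : ℝ → (x : M) → TangentSpace (𝓡 n) x), 0 < T →
      HdotEulerArnold.IsSolution g T u →
      (∀ x, HdotEulerArnold.divergence g (u 0) x = HdotEulerArnold.divergence g u₀ x) →
      T ≤ HdotEulerArnold.maxTime g u₀) ∧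
    (∀ u : ℝ → (x : M) → TangentSpace (𝓡 n) x,
      HdotEulerArnold.IsSolution g (HdotEulerArnold.maxTime g u₀) u →
      (∀ x, HdotEulerArnold.divergence g (u 0) x = HdotEulerArnold.divergence g u₀ x) →
      Filter.Tendsto (fun t => HdotEulerArnold.normC1 g (u t))
        (𝓝[<] (HdotEulerArnold.maxTime g u₀)) (𝓝 ⊤)) := by
  have hκ := HdotEulerArnold.kappa_pos g hu₀ hdiv
  exact ⟨HdotEulerArnold.maxTime_pos g hκ, HdotEulerArnold.exists_isSolution g hu₀ hκ,
    fun _ _ _ hu h0 => hu.le_maxTime hu₀ hκ h0, fun _ hu h0 => hu.tendsto_normC1 hu₀ hκ h0⟩
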